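/- Graphs are finite, undirected and simple, and formulas are first-order sentences over adjacency and equality. A sentence is in $\Pi_3$ if it has the form $\forall x_1\cdots\forall x_r\,\exists y_1\cdots\exists y_s\,\forall z_1\cdots\forall z_t\;\psi$ with $\psi$ quantifier-free ($r,s,t\ge 0$). For a sentence $\varphi$ three elimination distances of a graph $G$ are defined. (conn) $\mathrm{ed}^{\mathsf{conn}}_\varphi(\emptyset)=0$. If $G$ is connected and nonempty, then $\mathrm{ed}^{\mathsf{conn}}_\varphi(G)=0$ if $G\models\varphi$, and $\mathrm{ed}^{\mathsf{conn}}_\varphi(G)=1+\min_{v\in V(G)}\mathrm{ed}^{\mathsf{conn}}_\varphi(G-v)$ otherwise. If $G$ is disconnected, $\mathrm{ed}^{\mathsf{conn}}_\varphi(G)$ is the maximum of $\mathrm{ed}^{\mathsf{conn}}_\varphi(C)$ over the components $C$ of $G$. (prop) $\mathrm{ed}^{\mathsf{prop}}_\varphi(\emptyset)=0$. For nonempty $G$, $\mathrm{ed}^{\mathsf{prop}}_\varphi(G)=0$ if $G\models\varphi$; $\mathrm{ed}^{\mathsf{prop}}_\varphi(G)=1+\min_{v\in V(G)}\mathrm{ed}^{\mathsf{prop}}_\varphi(G-v)$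 if $G\not\models\varphi$ and $G$ is connected; and $\mathrm{ed}^{\mathsf{prop}}_\varphi(G)=\max\{1,\max_C \mathrm{ed}^{\mathsf{prop}}_\varphi(C)\}$, with $C$ ranging over the components of $G$, otherwise. (depth) A nonempty set $X\subseteq V(G)$ is an elimination set of depth at most $d$ if there are a rooted tree $T$ of depth at most $d$ (the depth of a node is its distance to the root) and a bijection $\alpha\colon V(T)\to X$ such that, for any two nodes $x,y$ of $T$ neither of which is an ancestor of the other, every path of $G$ from $\alpha(x)$ to $\alpha(y)$ meets the image under $\alpha$ of the set of ancestors of the lowest common ancestor of $x$ and $y$ (each node counts as its own ancestor). The empty set has depth $-1$. $\mathrm{ed}^{\mathsf{depth}}_\varphi(G)$ is the minimum $d\ge 0$ such that some $X\subseteq V(G)$ of depth at most $d-1$ satisfies $G-X\models\varphi$ ($\infty$ if there is none). A parameterized problem is a language $L\subseteq\Sigma^*\times\mathbb{N}$ over a finite alphabet $\Sigma$. A parameterized reduction from $L$ to $L'$ is an algorithm that, given $(x,k)$, outputs in time $f(k)\cdot|x|^{O(1)}$ a pair $(x',k')$ with $k'\le g(k)$ such that $(x,k)\in L\iff(x',k')\in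 L'$, where $f$ and $g$ are computable. $\mathsf{W}[2]$ is the class of parameterized problems that have, for some $d$, a parameterized reduction to the problem of deciding whether a Boolean circuit of depth at most $d$ and of weft at most 2 (at most two gates of in-degree greater than 2 on any path to the output) has a satisfying assignment with exactly $k$ true inputs, parameterized by $k$. A problem is $\mathsf{W}[2]$-hard if every problem in $\mathsf{W}[2]$ has a parameterized reduction to it. **Theorem.** For every $\star\in\{\mathsf{conn},\mathsf{prop},\mathsf{depth}\}$ there is a sentence $\varphi\in\Pi_3$ such that the problem "given a graph $G$ and an integer $k\ge 0$, decide whether $\mathrm{ed}^\star_\varphi(G)\le k$", parameterized by $k$, is $\mathsf{W}[2]$-hard. Moreover, $\varphi$ can be chosen to express that for every vertex $u$ of the graph there is a vertex $v$ of degree at most one at distance at most two from $u$. -/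

import Mathlib

open FirstOrder

namespace ElimDist

/-! ### First-order formulas on graphs -/

/-- `IsPrefix true ℓ φ`: `φ` is a `Π_ℓ`-formula; `IsPrefix false ℓ φ`: `φ` is a `Σ_ℓ`-formula.
A block of quantifiers may be empty. Free variables are allowed. -/
inductive IsPrefix : Bool → ℕ → ∀ {m : ℕ}, Language.graph.BoundedFormula Empty m → Prop
  | quantifierFree {b : Bool} {m : ℕ} {φ : Language.graph.BoundedFormula Empty m} :
      φ.IsQF → IsPrefix b 0 φ
  | switch {b : Bool} {l m : ℕ} {φ : Language.graph.BoundedFormula Empty m} :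
      IsPrefix (!b) l φ → IsPrefix b (l + 1) φ
  | all {l m : ℕ} {φ : Language.graph.BoundedFormula Empty (m + 1)} :
      IsPrefix true (l + 1) φ → IsPrefix true (l + 1) φ.all
  | ex {l m : ℕ} {φ : Language.graph.BoundedFormula Empty (m + 1)} :
      IsPrefix false (l + 1) φ → IsPrefix false (l + 1) φ.ex

/-- The sentence `φ` is in the class `Π_ℓ`. -/
def IsPi (l : ℕ) (φ : Language.graph.Sentence) : Prop :=
  IsPrefix true l φ

/-- `G ⊨ φ`. -/
def Models {V : Type*} (G : SimpleGraph V) (φ : Language.graph.Sentence) : Prop :=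
  @Language.Sentence.Realize Language.graph V G.structure φ

/-! ### Elimination distances

For a fixed graph `G` on `V`, the distances `ed^conn` and `ed^prop` are defined for all induced
subgraphs `G[S]`, `S` a finite set of vertices, by recursion on `S`. -/

section
open Classical

variable {V : Type*}

/-- `G[S]`. -/
abbrev sub (G : SimpleGraph V) (S : Finset V) : SimpleGraph S :=
  G.induce (S : Set V)

/-- The vertex set of the connected component of `G[S]` that contains `v`. -/
noncomputable def comp (G : SimpleGraph V) (S : Finset V) (v : S) : Finset V :=
  (S.attach.filter fun w => (sub G S).Reachable v w).map (Function.Embedding.subtype _)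

theorem comp_ssubset (G : SimpleGraph V) (S : Finset V) (v : S)
    (h : ¬ (sub G S).Connected) : comp G S v ⊂ S := by
  rw [Finset.ssubset_iff_subset_ne]
  constructor
  · intro x hx
    obtain ⟨a, -, rfl⟩ := Finset.mem_map.1 hx
    exact a.2
  · intro hS
    have key : ∀ w : S, (sub G S).Reachable v w := by
      intro w
      have hw : (w : V) ∈ comp G S v := by rw [hS]; exact w.2
      obtain ⟨a, ha, hav⟩ := Finset.mem_map.1 hw
      have haw : a = w := Subtype.ext hav
      subst haw
      exact (Finset.mem_filter.1 ha).2
    have : Nonempty S := ⟨v⟩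
    exact h ⟨fun a b => (key a).symm.trans (key b)⟩

/-- `ed^conn_φ(G[S])`. -/
noncomputable def edConn (φ : Language.graph.Sentence) (G : SimpleGraph V) (S : Finset V) : ℕ :=
  if hS : S.Nonempty then
    if hc : (sub G S).Connected then
      if Models (sub G S) φ then 0
      else 1 + S.attach.inf' (Finset.attach_nonempty_iff.2 hS)
        (fun v => edConn φ G (S.erase v.1))
    else S.attach.sup fun v => edConn φ G (comp G S v)
  else 0
termination_by S.card
decreasing_by
  · exact Finset.card_erase_lt_of_mem v.2
  · exact Finset.card_lt_card (comp_ssubset G S v hc)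

/-- `ed^prop_φ(G[S])`. -/
noncomputable def edProp (φ : Language.graph.Sentence) (G : SimpleGraph V) (S : Finset V) : ℕ :=
  if hS : S.Nonempty then
    if Models (sub G S) φ then 0
    else if hc : (sub G S).Connected then
      1 + S.attach.inf' (Finset.attach_nonempty_iff.2 hS) (fun v => edProp φ G (S.erase v.1))
    else max 1 (S.attach.sup fun v => edProp φ G (comp G S v))
  else 0
termination_by S.card
decreasing_by
  · exact Finset.card_erase_lt_of_mem v.2
  · exact Finset.card_lt_card (comp_ssubset G S v hc)

end

/-- In the tree `T` with root `r`, the node `u` is an ancestor of `v` (possibly `u = v`), that is,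
it lies on the path from `r` to `v`. -/
def Anc {N : Type*} (T : SimpleGraph N) (r u v : N) : Prop :=
  ∃ p : T.Walk r v, p.IsPath ∧ u ∈ p.support

/-- `v` is a lowest common ancestor of `x` and `y`. -/
def IsLCA {N : Type*} (T : SimpleGraph N) (r x y v : N) : Prop :=
  Anc T r v x ∧ Anc T r v y ∧
    ∀ w, Anc T r w x → Anc T r w y → T.dist r w ≤ T.dist r v

/-- `S` is a `(u, v)`-separator: every walk from `u` to `v` meets `S`. -/
def IsSeparator {V : Type*} (G : SimpleGraph V) (S : Set V) (u v : V) : Prop :=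
  ∀ p : G.Walk u v, ∃ w ∈ p.support, w ∈ S

/-- `X` is a (nonempty) elimination set of depth at most `d`, witnessed by a representation
`(T, α)`, where `T` is a rooted tree with root `r`. -/
def IsElimSet {V : Type*} (G : SimpleGraph V) (X : Set V) (d : ℕ) : Prop :=
  ∃ (N : Type) (T : SimpleGraph N) (r : N) (α : N → V),
    T.IsTree ∧ (∀ v, T.dist r v ≤ d) ∧ Set.BijOn α Set.univ X ∧
    ∀ x y v : N, ¬ Anc T r x y → ¬ Anc T r y x → IsLCA T r x y v →
      IsSeparator G (α '' {a | Anc T r a v}) (α x) (α y)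

/-- The depth of `X` is at most `m - 1`; the empty set has depth `-1`. -/
def DepthLT {V : Type*} (G : SimpleGraph V) (X : Set V) (m : ℕ) : Prop :=
  X = ∅ ∨ ∃ d < m, IsElimSet G X d

/-- `ed^depth_φ(G)`; it is infinite if no set `X` has `G - X ⊨ φ`. -/
noncomputable def edDepth {V : Type*} (φ : Language.graph.Sentence) (G : SimpleGraph V) : ℕ∞ :=
  ⨅ (m : ℕ) (_ : ∃ X : Set V, DepthLT G X m ∧ Models (G.induce Xᶜ) φ), (m : ℕ∞)

/-- The three variants of elimination distance. -/
inductive Variant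
  | conn
  | prop
  | depth

/-- `ed^⋆_φ(G)`. -/
noncomputable def ed {V : Type*} [Fintype V] (φ : Language.graph.Sentence) (G : SimpleGraph V) :
    Variant → ℕ∞
  | .conn => (edConn φ G Finset.univ : ℕ)
  | .prop => (edProp φ G Finset.univ : ℕ)
  | .depth => edDepth φ G

/-! ### Random access machines

A unit-cost random access machine with structured control flow. It has registers and memory banks
that hold natural numbers (a program uses only finitely many of them). The instructions
are loading a constant, addition, truncated subtraction, and indirect reading and writing. Every
instruction and every test of a condition takes one step. -/

structure State where
  reg : ℕ → ℕ
  bank : ℕ → ℕ → ℕ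

/-- Programs. The arguments are names of registers, except that `c` is a constant and `b` is the
name of a memory bank. -/
inductive Prog
  /-- `r := c` -/
  | const (r c : ℕ)
  /-- `r := p + q` -/
  | add (r p q : ℕ)
  /-- `r := p - q` (zero if `p < q`) -/
  | sub (r p q : ℕ)
  /-- `r := b[i]` -/
  | load (r b i : ℕ)
  /-- `b[i] := r` -/
  | store (b i r : ℕ)
  /-- do nothing -/
  | skip
  /-- `P; Q` -/
  | seq (P Q : Prog)
  /-- if `r ≠ 0` then `P` else `Q` -/
  | ite (r : ℕ) (P Q : Prog)
  /-- while `r ≠ 0` do `P` -/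
  | loop (r : ℕ) (P : Prog)

def State.setReg (s : State) (r x : ℕ) : State :=
  { s with reg := Function.update s.reg r x }

def State.setBank (s : State) (b i x : ℕ) : State :=
  { s with bank := Function.update s.bank b (Function.update (s.bank b) i x) }

/-- `Exec P s s' t`: started in state `s`, the program `P` halts in state `s'` after `t` steps. -/
inductive Exec : Prog → State → State → ℕ → Prop
  | const (s : State) (r c : ℕ) : Exec (.const r c) s (s.setReg r c) 1
  | add (s : State) (r p q : ℕ) : Exec (.add r p q) s (s.setReg r (s.reg p + s.reg q)) 1
  | sub (s : State) (r p q : ℕ) : Exec (.sub r p q) s (s.setReg r (s.reg p - s.reg q)) 1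
  | load (s : State) (r b i : ℕ) : Exec (.load r b i) s (s.setReg r (s.bank b (s.reg i))) 1
  | store (s : State) (b i r : ℕ) : Exec (.store b i r) s (s.setBank b (s.reg i) (s.reg r)) 1
  | skip (s : State) : Exec .skip s s 1
  | seq {P Q : Prog} {s s' s'' : State} {t t' : ℕ} :
      Exec P s s' t → Exec Q s' s'' t' → Exec (.seq P Q) s s'' (t + t')
  | ite_true {r : ℕ} {P Q : Prog} {s s' : State} {t : ℕ} :
      s.reg r ≠ 0 → Exec P s s' t → Exec (.ite r P Q) s s' (t + 1)
  | ite_false {r : ℕ} {P Q : Prog} {s s' : State} {t : ℕ} :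
      s.reg r = 0 → Exec Q s s' t → Exec (.ite r P Q) s s' (t + 1)
  | loop_true {r : ℕ} {P : Prog} {s s' s'' : State} {t t' : ℕ} :
      s.reg r ≠ 0 → Exec P s s' t → Exec (.loop r P) s' s'' t' →
      Exec (.loop r P) s s'' (t + t' + 1)
  | loop_false {r : ℕ} {P : Prog} {s : State} : s.reg r = 0 → Exec (.loop r P) s s 1

/-- The content of a memory bank that holds the word `x`: letters are stored as nonzero numbers
and the word is followed by blanks (zeros). -/
def wordCells {a : ℕ} (x : List (Fin a)) (i : ℕ) : ℕ :=
  match x[i]? with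
  | some c => (c : ℕ) + 1
  | none => 0

/-- The initial state on the instance `(x, k)`: `k` is in register `0` and `x` is in bank `0`. -/
def inputState {a : ℕ} (x : List (Fin a)) (k : ℕ) : State where
  reg := fun r => if r = 0 then k else 0
  bank := fun b i => if b = 0 then wordCells x i else 0

/-- The state `s` presents the output `(y, k)`: register `0` holds `k`, and bank `0` holds `y` in
the cells before the first blank. (Blanks being zeros, writing `y` costs a step per letter.) -/
def Outputs {a : ℕ} (s : State) (y : List (Fin a)) (k : ℕ) : Prop :=
  s.reg 0 = k ∧ ∀ i ≤ y.length, s.bank 0 i = wordCells y i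

/-! ### Parameterized problems, parameterized reductions, and the W-hierarchy -/

/-- A parameterized problem: a language `L ⊆ Σ* × ℕ` over a finite alphabet `Σ`. -/
structure ParamProblem where
  alphabet : ℕ
  L : Set (List (Fin alphabet) × ℕ)

/-- There is a parameterized reduction from `A` to `B`: an algorithm that transforms `(x, k)` in
time `f(k) · |x|^O(1)` into an equivalent instance `(y, k')` with `k' ≤ g(k)`, where `f` and `g`
are computable. (The bound uses `|x| + 1` so that it makes sense for the empty word.) -/
def ParamReducible (A B : ParamProblem) : Prop :=
  ∃ (P : Prog) (f g : ℕ → ℕ) (c : ℕ), Computable f ∧ Computable g ∧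
    ∀ (x : List (Fin A.alphabet)) (k : ℕ),
      ∃ (y : List (Fin B.alphabet)) (k' : ℕ) (s : State) (t : ℕ),
        Exec P (inputState x k) s t ∧ Outputs s y k' ∧
        t ≤ f k * (x.length + 1) ^ c ∧ k' ≤ g k ∧
        ((x, k) ∈ A.L ↔ (y, k') ∈ B.L)

/-- A Boolean circuit: a directed acyclic graph, whose nodes are numbered in a topological order
with the output node last. Nodes of in-degree 0 are the inputs, nodes of in-degree 1 are negations,
and the other nodes are conjunctions or disjunctions, according to `isAnd`. -/
structure Circuit where
  last : ℕ
  isAnd : Fin (last + 1) → Bool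
  /-- `wire j i`: there is an arc from `j` to `i` -/
  wire : Fin (last + 1) → Fin (last + 1) → Bool
  topological : ∀ j i, wire j i = true → j < i

namespace Circuit

variable (C : Circuit)

def inputsOf (i : Fin (C.last + 1)) : Finset (Fin (C.last + 1)) :=
  Finset.univ.filter fun j => C.wire j i = true

def indeg (i : Fin (C.last + 1)) : ℕ := (C.inputsOf i).card

/-- `v` is the family of values of the nodes under some assignment to the inputs. -/
def IsValuation (v : Fin (C.last + 1) → Bool) : Prop :=
  ∀ i, (C.indeg i = 1 → (v i = true ↔ ∀ j ∈ C.inputsOf i, v j = false)) ∧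
    (2 ≤ C.indeg i → C.isAnd i = true → (v i = true ↔ ∀ j ∈ C.inputsOf i, v j = true)) ∧
    (2 ≤ C.indeg i → C.isAnd i = false → (v i = true ↔ ∃ j ∈ C.inputsOf i, v j = true))

/-- `C` has a satisfying assignment in which exactly `k` inputs are true. -/
def WeightedSat (k : ℕ) : Prop :=
  ∃ v, C.IsValuation v ∧ v (Fin.last C.last) = true ∧
    (Finset.univ.filter fun i => C.indeg i = 0 ∧ v i = true).card = k

/-- The list `p` of nodes is a directed path that ends in the output. (Any such path extends
backwards to one that starts in an input.) -/
def IsPathToOutput (p : List (Fin (C.last + 1))) : Prop :=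
  p.IsChain (fun j i => C.wire j i = true) ∧ p.getLast? = some (Fin.last C.last)

/-- The depth, i.e. the maximum length (number of arcs) of a path to the output, is at most `d`. -/
def DepthLE (d : ℕ) : Prop :=
  ∀ p, C.IsPathToOutput p → p.length ≤ d + 1

/-- The weft, i.e. the maximum number of large nodes (nodes of in-degree more than 2) on a path to
the output, is at most `t`. -/
def WeftLE (t : ℕ) : Prop :=
  ∀ p, C.IsPathToOutput p → (p.filter fun i => decide (2 < C.indeg i)).length ≤ t

/-- A circuit as a binary word: for each node, its label and its row of incoming arcs. -/
def encode : List (Fin 2) :=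
  (List.finRange (C.last + 1)).flatMap fun i =>
    (if C.isAnd i = true then 1 else 0) ::
      (List.finRange (C.last + 1)).map fun j => if C.wire j i = true then 1 else 0

end Circuit

/-- Weighted Circuit Satisfiability for circuits of weft at most `t` and depth at most `d`,
parameterized by the weight. -/
def WCS (t d : ℕ) : ParamProblem where
  alphabet := 2
  L := {p | ∃ C : Circuit, p.1 = C.encode ∧ C.WeftLE t ∧ C.DepthLE d ∧ C.WeightedSat p.2}

/-- Membership in the class `W[t]`. -/
def InW (t : ℕ) (A : ParamProblem) : Prop :=
  ∃ d, ParamReducible A (WCS t d)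

/-- `W[t]`-hardness. -/
def WHard (t : ℕ) (B : ParamProblem) : Prop :=
  ∀ A, InW t A → ParamReducible A B

/-! ### The elimination distance problems -/

open Classical in
/-- A graph as a binary word: its adjacency matrix, row by row. -/
noncomputable def encodeGraph {n : ℕ} (G : SimpleGraph (Fin n)) : List (Fin 2) :=
  (List.finRange n).flatMap fun i => (List.finRange n).map fun j => if G.Adj i j then 1 else 0

/-- The problem: given a graph `G` and `k ∈ ℕ`, decide whether `ed^⋆_φ(G) ≤ k`; the parameter
is `k`. -/
def EDProblem (star : Variant) (φ : Language.graph.Sentence) : ParamProblem where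
  alphabet := 2
  L := {p | ∃ (n : ℕ) (G : SimpleGraph (Fin n)), p.1 = encodeGraph G ∧ ed φ G star ≤ (p.2 : ℕ∞)}

end ElimDist

/-! The hardness comes from Hitting Set, which is itself shown to be hard directly from circuits of
weft 2, without a normal form theorem. One graph serves all three distances.

From hitting sets to distances (`gadget_ed_le_iff`). Every element `e` becomes a path `el e, mid e,
leaf e`; every set becomes `K + 3` copies of a vertex, all copies of all sets form a clique, and
each copy is joined to `el e` for the elements `e` of the set. A row is at distance at least three
from every leaf, and rows and vertices `el e` keep degree at least two as long as at most `K` rows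
are gone. So a row is satisfied only by some `mid e` that has lost its leaf: deleting leaves means
selecting elements. Deleting the leaves of a hitting set one by one keeps the graph connected, and
such a set of leaves is an elimination set with a path as its tree; this gives the upper bounds. For
the lower bounds, the clique keeps the surviving rows in one component, so `conn` and `prop` cannot
profit from splitting (`Reduced`). For `depth`, vertices of an elimination set that are pairwise
linked outside of it lie on one branch of the tree (`card_le_of_linked`).

From circuits to hitting sets. The truth of the output of a circuit of weft 2 and depth `d` is
expressed by a game. The prover announces a set `Y` of at most `2 ^ d` witnesses for the topmost
large gates of weft 2 whose value is existential. The refuter answers with a bounded set `X` of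
inputs of gates that are to be examined. Then a bounded number of circuit inputs suffices to show
the value (`shows_of_known`), and what can be shown against the best `X` is correct (`eq_of_shows`).
All bounds depend on `d` only.

An assignment of weight `k` is an increasing sequence of length `k`, extended by sentinels at both
ends. Two consecutive terms tell whether an input in between or at the lower end is true, so bounded
information about inputs is information about a bounded tuple of positions. There are `(k + 2) ^
numD d` tuples of positions. An element `(b, v)` says that the tuple `b` has the values `v`; one
further block holds the code of `Y`. With a budget of one element per block, sets force exactly one
choice in each block, agreement of the choices, and, for all `Y` and `X`, that either `Y` is not the
announced set or some chosen tuple shows the output to be true. The budget depends on `k` and `d`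
only, and for fixed `d` the size of the instance is polynomial in the circuit size and `k`.

Running times. Everything in the construction is written as an arithmetic term with bounded sums. A
fixed term compiles to a program of polynomial running time, and predicates such as gate evaluation
unfold into fixed terms because `d` is constant. `ParamReducible.trans_dfn` composes the given
reduction with such a definable one. -/

namespace ElimDist

/-! ### Arithmetic terms with bounded sums, and their compilation -/

/-- Extend an environment by a new innermost variable. -/
def push (x : ℕ) (env : ℕ → ℕ) : ℕ → ℕ
  | 0 => x
  | i + 1 => env i

/-- Arithmetic terms over a read-only tape, with de Bruijn variables. -/
inductive Arith
  | var (i : ℕ)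
  | const (c : ℕ)
  | add (a b : Arith)
  | sub (a b : Arith)
  | read (a : Arith)
  | bind (a b : Arith)
  | sum (a b : Arith)

namespace Arith

def eval (w : ℕ → ℕ) : Arith → (ℕ → ℕ) → ℕ
  | var i, env => env i
  | const c, _ => c
  | add a b, env => a.eval w env + b.eval w env
  | sub a b, env => a.eval w env - b.eval w env
  | read a, env => w (a.eval w env)
  | bind a b, env => b.eval w (push (a.eval w env) env)
  | sum a b, env => ∑ i ∈ Finset.range (a.eval w env), b.eval w (push i env)

/-- A bound on the number of steps of the compiled term. -/
def cost (w : ℕ → ℕ) : Arith → (ℕ → ℕ) → ℕ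
  | var _, _ => 2
  | const _, _ => 1
  | add a b, env => a.cost w env + b.cost w env + 1
  | sub a b, env => a.cost w env + b.cost w env + 1
  | read a, env => a.cost w env + 3
  | bind a b, env => a.cost w env + b.cost w (push (a.eval w env) env) + 2
  | sum a b, env =>
      a.cost w env + 3 + ∑ i ∈ Finset.range (a.eval w env), (b.cost w (push i env) + 5)

/-- Rename the free variables. -/
def rename : Arith → (ℕ → ℕ) → Arith
  | var i, ρ => var (ρ i)
  | const c, _ => const c
  | add a b, ρ => add (a.rename ρ) (b.rename ρ)
  | sub a b, ρ => sub (a.rename ρ) (b.rename ρ)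
  | read a, ρ => read (a.rename ρ)
  | bind a b, ρ => bind (a.rename ρ) (b.rename (push 0 fun i => ρ i + 1))
  | sum a b, ρ => sum (a.rename ρ) (b.rename (push 0 fun i => ρ i + 1))

theorem push_comp_lift (x : ℕ) (ρ env : ℕ → ℕ) :
    (fun i => push x env (push 0 (fun i => ρ i + 1) i)) = push x (fun i => env (ρ i)) := by
  funext i
  cases i <;> rfl

theorem eval_rename (w : ℕ → ℕ) (a : Arith) (ρ env : ℕ → ℕ) :
    (a.rename ρ).eval w env = a.eval w fun i => env (ρ i) := by
  induction a generalizing ρ env with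
  | var | const => rfl
  | add a b iha ihb => simp only [rename, eval, iha, ihb]
  | sub a b iha ihb => simp only [rename, eval, iha, ihb]
  | read a iha => simp only [rename, eval, iha]
  | bind a b iha ihb => simp only [rename, eval, iha, ihb, push_comp_lift]
  | sum a b iha ihb => simp only [rename, eval, iha, ihb, push_comp_lift]

/-- Values and costs are polynomially bounded in the values of variables and tape cells. -/
theorem exists_pow_bound (a : Arith) : ∃ c : ℕ, ∀ (w env : ℕ → ℕ) (m : ℕ), 2 ≤ m →
    (∀ i, w i ≤ m) → (∀ i, env i ≤ m) → a.eval w env ≤ m ^ c ∧ a.cost w env ≤ m ^ c := by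
  have two_pow : ∀ {m c : ℕ}, 2 ≤ m → 2 ^ c ≤ m ^ c := fun h => Nat.pow_le_pow_left h _
  have push_le : ∀ {m x : ℕ} {env : ℕ → ℕ}, x ≤ m → (∀ i, env i ≤ m) → ∀ i, push x env i ≤ m := by
    intro m x env hx he i
    cases i with
    | zero => exact hx
    | succ i => exact he i
  induction a with
  | var i =>
    refine ⟨1, fun w env m hm _ he => ⟨?_, ?_⟩⟩
    · simpa [eval] using he i
    · simpa [cost] using hm
  | const k =>
    refine ⟨k, fun w env m hm _ _ => ⟨?_, ?_⟩⟩
    · exact (Nat.lt_two_pow_self (n := k)).le.trans (two_pow hm)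
    · exact Nat.one_le_pow _ _ (by omega)
  | add a b iha ihb =>
    obtain ⟨c, hc⟩ := iha
    obtain ⟨d, hd⟩ := ihb
    refine ⟨max c d + 2, fun w env m hm hw he => ?_⟩
    obtain ⟨h1, h2⟩ := hc w env m hm hw he
    obtain ⟨h3, h4⟩ := hd w env m hm hw he
    have hc' : m ^ c ≤ m ^ max c d := Nat.pow_le_pow_right (by omega) (le_max_left _ _)
    have hd' : m ^ d ≤ m ^ max c d := Nat.pow_le_pow_right (by omega) (le_max_right _ _)
    have h4m : m ^ max c d * 4 ≤ m ^ (max c d + 2) := by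
      rw [pow_add]; exact Nat.mul_le_mul_left _ (by nlinarith)
    have h1m : 1 ≤ m ^ max c d := Nat.one_le_pow _ _ (by omega)
    simp only [eval, cost]
    omega
  | sub a b iha ihb =>
    obtain ⟨c, hc⟩ := iha
    obtain ⟨d, hd⟩ := ihb
    refine ⟨max c d + 2, fun w env m hm hw he => ?_⟩
    obtain ⟨h1, h2⟩ := hc w env m hm hw he
    obtain ⟨h3, h4⟩ := hd w env m hm hw he
    have hc' : m ^ c ≤ m ^ max c d := Nat.pow_le_pow_right (by omega) (le_max_left _ _)
    have hd' : m ^ d ≤ m ^ max c d := Nat.pow_le_pow_right (by omega) (le_max_right _ _)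
    have h4m : m ^ max c d * 4 ≤ m ^ (max c d + 2) := by
      rw [pow_add]; exact Nat.mul_le_mul_left _ (by nlinarith)
    have h1m : 1 ≤ m ^ max c d := Nat.one_le_pow _ _ (by omega)
    simp only [eval, cost]
    omega
  | read a iha =>
    obtain ⟨c, hc⟩ := iha
    refine ⟨c + 2, fun w env m hm hw he => ?_⟩
    obtain ⟨-, h2⟩ := hc w env m hm hw he
    have h4m : m ^ c * (2 * m) ≤ m ^ (c + 2) := by
      rw [pow_add]; exact Nat.mul_le_mul_left _ (by nlinarith)
    have h1m : 1 ≤ m ^ c := Nat.one_le_pow _ _ (by omega)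
    simp only [eval, cost]
    have := hw (a.eval w env)
    constructor <;> nlinarith
  | bind a b iha ihb =>
    obtain ⟨c, hc⟩ := iha
    obtain ⟨d, hd⟩ := ihb
    refine ⟨c + (c + 1) * d + 2, fun w env m hm hw he => ?_⟩
    obtain ⟨h1, h2⟩ := hc w env m hm hw he
    have hcm : m ^ c ≤ m ^ (c + 1) := Nat.pow_le_pow_right (by omega) (by omega)
    have hmm : m ≤ m ^ (c + 1) := Nat.le_self_pow (by omega) _
    -- The bound variable can be as large as `m ^ c`, so the bound for the body is used with `m ^ (c
    -- + 1)` in place of `m`. Exponents multiply, which is harmless for a fixed term.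
    obtain ⟨h3, h4⟩ := hd w (push (a.eval w env) env) (m ^ (c + 1)) (hm.trans hmm)
      (fun i => (hw i).trans hmm) (push_le (h1.trans hcm) fun i => (he i).trans hmm)
    rw [← pow_mul] at h3 h4
    have e1 : m ^ c ≤ m ^ (c + (c + 1) * d) := Nat.pow_le_pow_right (by omega) (by omega)
    have e2 : m ^ ((c + 1) * d) ≤ m ^ (c + (c + 1) * d) :=
      Nat.pow_le_pow_right (by omega) (by omega)
    have h4m : m ^ (c + (c + 1) * d) * 4 ≤ m ^ (c + (c + 1) * d + 2) := by
      rw [pow_add _ _ 2]; exact Nat.mul_le_mul_left _ (by nlinarith)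
    have h1m : 1 ≤ m ^ (c + (c + 1) * d) := Nat.one_le_pow _ _ (by omega)
    simp only [eval, cost]
    omega
  | sum a b iha ihb =>
    obtain ⟨c, hc⟩ := iha
    obtain ⟨d, hd⟩ := ihb
    refine ⟨c + (c + 1) * d + 4, fun w env m hm hw he => ?_⟩
    obtain ⟨h1, h2⟩ := hc w env m hm hw he
    have hcm : m ^ c ≤ m ^ (c + 1) := Nat.pow_le_pow_right (by omega) (by omega)
    have hmm : m ≤ m ^ (c + 1) := Nat.le_self_pow (by omega) _
    have key : ∀ i ∈ Finset.range (a.eval w env), b.eval w (push i env) ≤ m ^ ((c + 1) * d) ∧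
        b.cost w (push i env) ≤ m ^ ((c + 1) * d) := by
      intro i hi
      rw [pow_mul]
      exact hd w (push i env) (m ^ (c + 1)) (hm.trans hmm) (fun i => (hw i).trans hmm)
        (push_le ((Finset.mem_range.1 hi).le.trans (h1.trans hcm)) fun i => (he i).trans hmm)
    have s1 := Finset.sum_le_card_nsmul _ _ _ fun i hi => (key i hi).1
    have s2 := Finset.sum_le_card_nsmul _ (fun i => b.cost w (push i env) + 5)
      (m ^ ((c + 1) * d) + 5) fun i hi => Nat.add_le_add_right (key i hi).2 5
    simp only [Finset.card_range, smul_eq_mul] at s1 s2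
    have hx : 1 ≤ m ^ ((c + 1) * d) := Nat.one_le_pow _ _ (by omega)
    have hy : 1 ≤ m ^ c := Nat.one_le_pow _ _ (by omega)
    have h16 : m ^ c * m ^ ((c + 1) * d) * 16 ≤ m ^ (c + (c + 1) * d + 4) := by
      rw [pow_add _ _ 4, pow_add]
      exact Nat.mul_le_mul_left _ (by simpa using Nat.pow_le_pow_left hm 4)
    generalize m ^ ((c + 1) * d) = X at *
    generalize m ^ c = Y at *
    have hXY : Y ≤ Y * X := Nat.le_mul_of_pos_right _ hx
    have hXY' : 1 ≤ Y * X := hy.trans hXY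
    have t1 : a.eval w env * X ≤ Y * X := Nat.mul_le_mul_right _ h1
    have t2 : a.eval w env * (X + 5) ≤ Y * (X + 5) := Nat.mul_le_mul_right _ h1
    have t3 : Y * (X + 5) = Y * X + 5 * Y := by ring
    simp only [eval, cost]
    omega

/-- The program that computes the value of a term into register `r`, using the registers from `r`
on as work space. The `i`-th variable is in register `ctx i`, and bank `1` holds the tape, whose
length is in register `1`. -/
def compile : Arith → (ℕ → ℕ) → ℕ → Prog
  | var i, ctx, r => (Prog.const r 0).seq (.add r (ctx i) r)
  | const c, _, r => .const r c
  | add a b, ctx, r => (a.compile ctx r).seq ((b.compile ctx (r + 1)).seq (.add r r (r + 1)))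
  | sub a b, ctx, r => (a.compile ctx r).seq ((b.compile ctx (r + 1)).seq (.sub r r (r + 1)))
  | read a, ctx, r =>
      (a.compile ctx r).seq ((Prog.sub (r + 1) 1 r).seq (.ite (r + 1) (.load r 1 r) (.const r 0)))
  | bind a b, ctx, r =>
      (a.compile ctx (r + 1)).seq ((b.compile (push (r + 1) ctx) (r + 2)).seq
        ((Prog.const r 0).seq (.add r r (r + 2))))
  | sum a b, ctx, r =>
      (a.compile ctx (r + 1)).seq ((Prog.const r 0).seq ((Prog.const (r + 2) 0).seq
        (.loop (r + 1) ((b.compile (push (r + 2) ctx) (r + 3)).seq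
          ((Prog.add r r (r + 3)).seq ((Prog.const (r + 3) 1).seq
            ((Prog.add (r + 2) (r + 2) (r + 3)).seq (.sub (r + 1) (r + 1) (r + 3)))))))))

end Arith

/-! ### Program states and a calculus of running times -/

@[simp]
theorem State.setReg_reg (s : State) (r x i : ℕ) :
    (s.setReg r x).reg i = if i = r then x else s.reg i := by
  simp [State.setReg, Function.update_apply]

@[simp]
theorem State.setReg_bank (s : State) (r x : ℕ) : (s.setReg r x).bank = s.bank := rfl

@[simp]
theorem State.setBank_reg (s : State) (b i x : ℕ) : (s.setBank b i x).reg = s.reg := rfl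

theorem State.setBank_bank (s : State) (b i x c j : ℕ) :
    (s.setBank b i x).bank c j = if c = b ∧ j = i then x else s.bank c j := by
  by_cases hc : c = b
  · subst hc
    simp [State.setBank, Function.update_apply]
  · simp [State.setBank, hc]

/-- `P` turns `s` into a state that satisfies `Q`, in at most `t` steps. -/
def Runs (P : Prog) (s : State) (t : ℕ) (Q : State → Prop) : Prop :=
  ∃ s' t', Exec P s s' t' ∧ t' ≤ t ∧ Q s'

namespace Runs

variable {P P' : Prog} {s : State} {t t' : ℕ} {Q Q' : State → Prop}

theorem mono (h : Runs P s t Q) (ht : t ≤ t') (hQ : ∀ s', Q s' → Q' s') : Runs P s t' Q' := by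
  obtain ⟨s', u, hE, hu, hs⟩ := h
  exact ⟨s', u, hE, hu.trans ht, hQ s' hs⟩

theorem seq (h : Runs P s t fun s' => Runs P' s' t' Q) : Runs (P.seq P') s (t + t') Q := by
  obtain ⟨s', u, hE, hu, s'', u', hE', hu', hs⟩ := h
  exact ⟨s'', u + u', hE.seq hE', Nat.add_le_add hu hu', hs⟩

theorem const {r c : ℕ} (h : Q (s.setReg r c)) : Runs (.const r c) s 1 Q :=
  ⟨_, _, .const s r c, le_rfl, h⟩

theorem add {r p q : ℕ} (h : Q (s.setReg r (s.reg p + s.reg q))) : Runs (.add r p q) s 1 Q :=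
  ⟨_, _, .add s r p q, le_rfl, h⟩

theorem sub {r p q : ℕ} (h : Q (s.setReg r (s.reg p - s.reg q))) : Runs (.sub r p q) s 1 Q :=
  ⟨_, _, .sub s r p q, le_rfl, h⟩

theorem load {r b i : ℕ} (h : Q (s.setReg r (s.bank b (s.reg i)))) : Runs (.load r b i) s 1 Q :=
  ⟨_, _, .load s r b i, le_rfl, h⟩

theorem store {r b i : ℕ} (h : Q (s.setBank b (s.reg i) (s.reg r))) :
    Runs (.store b i r) s 1 Q :=
  ⟨_, _, .store s b i r, le_rfl, h⟩

theorem ite {r : ℕ} (h : s.reg r ≠ 0 → Runs P s t Q) (h' : s.reg r = 0 → Runs P' s t Q) :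
    Runs (.ite r P P') s (t + 1) Q := by
  by_cases hr : s.reg r = 0
  · obtain ⟨s', u, hE, hu, hs⟩ := h' hr
    exact ⟨s', u + 1, .ite_false hr hE, by omega, hs⟩
  · obtain ⟨s', u, hE, hu, hs⟩ := h hr
    exact ⟨s', u + 1, .ite_true hr hE, by omega, hs⟩

/-- A loop with invariant `I` that runs exactly `n` times. -/
theorem loop {r : ℕ} (n : ℕ) (c : ℕ → ℕ) (I : ℕ → State → Prop) (h0 : I 0 s)
    (hstep : ∀ i < n, ∀ s', I i s' → s'.reg r ≠ 0 ∧ Runs P s' (c i) (I (i + 1)))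
    (hend : ∀ s', I n s' → s'.reg r = 0) :
    Runs (.loop r P) s (1 + ∑ i ∈ Finset.range n, (c i + 1)) (I n) := by
  induction n generalizing s c I with
  | zero => exact ⟨s, 1, .loop_false (hend s h0), by simp, h0⟩
  | succ n ih =>
    obtain ⟨hr, s', u, hE, hu, hs⟩ := hstep 0 (by omega) s h0
    obtain ⟨s'', u', hE', hu', hs'⟩ := ih (s := s') (fun i => c (i + 1)) (fun i => I (i + 1)) hs
      (fun i hi s' => hstep (i + 1) (by omega) s') hend
    refine ⟨s'', u + u' + 1, .loop_true hr hE hE', ?_, hs'⟩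
    rw [Finset.sum_range_succ']
    omega

end Runs

namespace Arith

/-- Subterms are evaluated in ever higher registers, so variables, the tape length and intermediate
results survive. By `hw`, the tape is the part of bank `1` below the stored length, continued by
zeros: the cells behind it may contain leftovers of an earlier program. -/
theorem compile_runs (w : ℕ → ℕ) (a : Arith) (ctx env : ℕ → ℕ) (r : ℕ) (s : State)
    (hctx : ∀ i, ctx i < r) (hr : 1 < r) (henv : ∀ i, s.reg (ctx i) = env i)
    (hw : ∀ i, w i = if i < s.reg 1 then s.bank 1 i else 0) :
    Runs (a.compile ctx r) s (a.cost w env) fun s' =>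
      s'.reg r = a.eval w env ∧ (∀ i < r, s'.reg i = s.reg i) ∧ s'.bank = s.bank := by
  induction a generalizing ctx env r s with
  | var i =>
    have := hctx i
    refine Runs.seq (t := 1) (t' := 1) (Runs.const (Runs.add ⟨?_, fun j hj => ?_, rfl⟩))
    · simp [this.ne, henv, eval]
    · simp [hj.ne]
  | const c => exact Runs.const ⟨by simp [eval], fun j hj => by simp [hj.ne], rfl⟩
  | add a b iha ihb =>
    refine (Runs.seq ((iha ctx env r s hctx hr henv hw).mono le_rfl ?_)).mono
      (t := a.cost w env + (b.cost w env + 1)) (by simp only [cost]; omega) fun _ h => h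
    rintro s₁ ⟨h1, h2, h3⟩
    refine Runs.seq ((ihb ctx env (r + 1) s₁ (fun i => (hctx i).trans (by omega)) (by omega)
      (fun i => by rw [h2 _ (hctx i), henv]) (fun i => by rw [h2 1 hr, h3, hw])).mono le_rfl ?_)
    rintro s₂ ⟨h4, h5, h6⟩
    refine Runs.add ⟨?_, fun j hj => ?_, by simp [h6, h3]⟩
    · simp [h4, h5 r (by omega), h1, eval]
    · simp [hj.ne, h5 j (by omega), h2 j hj]
  | sub a b iha ihb =>
    refine (Runs.seq ((iha ctx env r s hctx hr henv hw).mono le_rfl ?_)).mono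
      (t := a.cost w env + (b.cost w env + 1)) (by simp only [cost]; omega) fun _ h => h
    rintro s₁ ⟨h1, h2, h3⟩
    refine Runs.seq ((ihb ctx env (r + 1) s₁ (fun i => (hctx i).trans (by omega)) (by omega)
      (fun i => by rw [h2 _ (hctx i), henv]) (fun i => by rw [h2 1 hr, h3, hw])).mono le_rfl ?_)
    rintro s₂ ⟨h4, h5, h6⟩
    refine Runs.sub ⟨?_, fun j hj => ?_, by simp [h6, h3]⟩
    · simp [h4, h5 r (by omega), h1, eval]
    · simp [hj.ne, h5 j (by omega), h2 j hj]
  | read a iha =>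
    refine (Runs.seq ((iha ctx env r s hctx hr henv hw).mono le_rfl ?_)).mono
      (t := a.cost w env + (1 + (1 + 1))) (by simp only [cost]; omega) fun _ h => h
    rintro s₁ ⟨h1, h2, h3⟩
    have h1r : s₁.reg 1 = s.reg 1 := h2 1 hr
    refine Runs.seq (Runs.sub (Runs.ite (fun h => Runs.load ⟨?_, fun j hj => ?_, by simp [h3]⟩)
      fun h => Runs.const ⟨?_, fun j hj => ?_, by simp [h3]⟩))
    · simp only [State.setReg_reg, if_true, h1r, h1, ne_eq, Nat.sub_eq_zero_iff_le, not_le] at h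
      simp [eval, hw, h1, h, h3]
    · simp [hj.ne, h2 j hj, (hj.trans (Nat.lt_succ_self r)).ne]
    · simp only [State.setReg_reg, if_true, h1r, h1, Nat.sub_eq_zero_iff_le] at h
      simp [eval, hw, h.not_gt]
    · simp [hj.ne, h2 j hj, (hj.trans (Nat.lt_succ_self r)).ne]
  | bind a b iha ihb =>
    refine (Runs.seq ((iha ctx env (r + 1) s (fun i => (hctx i).trans (by omega)) (by omega)
      henv hw).mono le_rfl ?_)).mono
      (t := a.cost w env + (b.cost w (push (a.eval w env) env) + (1 + 1)))
      (by simp only [cost]; omega) fun _ h => h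
    rintro s₁ ⟨h1, h2, h3⟩
    refine Runs.seq ((ihb (push (r + 1) ctx) (push (a.eval w env) env) (r + 2) s₁ ?_ (by omega) ?_
      fun i => by rw [h2 1 (by omega), h3, hw]).mono le_rfl ?_)
    · rintro (_ | i)
      · simp [push]
      · exact (hctx i).trans (by omega)
    · rintro (_ | i)
      · simpa [push] using h1
      · simp only [push]; rw [h2 _ ((hctx i).trans (by omega)), henv]
    rintro s₂ ⟨h4, h5, h6⟩
    refine Runs.seq (Runs.const (Runs.add ⟨?_, fun j hj => ?_, by simp [h6, h3]⟩))
    · simp [h4, eval]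
    · simp [hj.ne, h5 j (by omega), h2 j (by omega)]
  | sum a b iha ihb =>
    refine (Runs.seq ((iha ctx env (r + 1) s (fun i => (hctx i).trans (by omega)) (by omega)
      henv hw).mono le_rfl ?_)).mono
      (t := a.cost w env + (1 + (1 + (1 + ∑ i ∈ Finset.range (a.eval w env),
        (b.cost w (push i env) + 4 + 1)))))
      (by simp only [cost, Nat.add_assoc, Nat.reduceAdd]; omega) fun _ h => h
    rintro s₁ ⟨h1, h2, h3⟩
    refine Runs.seq (Runs.const (Runs.seq (Runs.const ?_)))
    refine (Runs.loop (a.eval w env) (fun i => b.cost w (push i env) + 4) (fun n s' =>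
      s'.reg r = ∑ i ∈ Finset.range n, b.eval w (push i env) ∧ s'.reg (r + 1) = a.eval w env - n ∧
        s'.reg (r + 2) = n ∧ (∀ i < r, s'.reg i = s.reg i) ∧ s'.bank = s.bank) ?_ ?_ ?_).mono le_rfl
        fun s' h => ⟨h.1, h.2.2.2.1, h.2.2.2.2⟩
    · refine ⟨by simp, by simp [h1], by simp, fun i hi => ?_, by simp [h3]⟩
      simp [hi.ne, (show i ≠ r + 2 by omega), h2 i (by omega)]
    · rintro n hn s₂ ⟨g1, g2, g3, g4, g5⟩
      refine ⟨by omega, (Runs.seq (t' := 1 + (1 + (1 + 1)))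
        ((ihb (push (r + 2) ctx) (push n env) (r + 3) s₂ ?_
        (by omega) ?_ fun i => by rw [g4 1 hr, g5, hw]).mono le_rfl ?_)).mono (by omega) fun _ h => h⟩
      · rintro (_ | i)
        · simp [push]
        · exact (hctx i).trans (by omega)
      · rintro (_ | i)
        · simpa [push] using g3
        · simp only [push]; rw [g4 _ (hctx i), henv]
      rintro s₃ ⟨h4, h5, h6⟩
      refine Runs.seq (Runs.add (Runs.seq (Runs.const (Runs.seq (Runs.add (Runs.sub
        ⟨?_, ?_, ?_, fun i hi => ?_, ?_⟩))))))
      · simp [Finset.sum_range_succ, h4, h5 r, g1]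
      · simp [h5 (r + 1), g2, Nat.sub_sub]
      · simp [h5 (r + 2), g3]
      · simp [hi.ne, (show i ≠ r + 1 by omega), (show i ≠ r + 2 by omega),
          (show i ≠ r + 3 by omega), h5 i (by omega), g4 i hi]
      · simp [h6, g5]
    · rintro s₂ ⟨-, g2, -⟩
      simpa using g2

end Arith

/-! ### Definable functions and predicates -/

section

variable {Γ : Type}

/-- Extend a context (a tape and an environment that depend on parameters in `Γ`) by a variable. -/
def extend (c : Γ → (ℕ → ℕ) × (ℕ → ℕ)) : Γ × ℕ → (ℕ → ℕ) × (ℕ → ℕ) :=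
  fun p => ((c p.1).1, push p.2 (c p.1).2)

/-- `f` is given by an arithmetic term in the context `c`. -/
def Dfn (c : Γ → (ℕ → ℕ) × (ℕ → ℕ)) (f : Γ → ℕ) : Prop :=
  ∃ a : Arith, ∀ γ, a.eval (c γ).1 (c γ).2 = f γ

/-- The truth value of `P` is given by an arithmetic term in the context `c`. -/
def DfnP (c : Γ → (ℕ → ℕ) × (ℕ → ℕ)) (P : Γ → Prop) : Prop :=
  ∃ a : Arith, ∀ γ, (a.eval (c γ).1 (c γ).2 = 1 ∧ P γ) ∨ (a.eval (c γ).1 (c γ).2 = 0 ∧ ¬ P γ)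

variable {c : Γ → (ℕ → ℕ) × (ℕ → ℕ)} {f g h : Γ → ℕ} {P Q : Γ → Prop}

namespace Dfn

theorem var (i : ℕ) : Dfn c fun γ => (c γ).2 i := ⟨.var i, fun _ => rfl⟩

theorem const (n : ℕ) : Dfn c fun _ => n := ⟨.const n, fun _ => rfl⟩

theorem add (hf : Dfn c f) (hg : Dfn c g) : Dfn c fun γ => f γ + g γ := by
  obtain ⟨a, ha⟩ := hf
  obtain ⟨b, hb⟩ := hg
  exact ⟨.add a b, fun γ => by simp [Arith.eval, ha, hb]⟩

theorem sub (hf : Dfn c f) (hg : Dfn c g) : Dfn c fun γ => f γ - g γ := by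
  obtain ⟨a, ha⟩ := hf
  obtain ⟨b, hb⟩ := hg
  exact ⟨.sub a b, fun γ => by simp [Arith.eval, ha, hb]⟩

theorem read (hf : Dfn c f) : Dfn c fun γ => (c γ).1 (f γ) := by
  obtain ⟨a, ha⟩ := hf
  exact ⟨.read a, fun γ => by simp [Arith.eval, ha]⟩

theorem last : Dfn (extend c) fun p => p.2 := ⟨.var 0, fun _ => rfl⟩

/-- Weakening. -/
theorem wk (hf : Dfn c f) : Dfn (extend c) fun p => f p.1 := by
  obtain ⟨a, ha⟩ := hf
  exact ⟨a.rename (· + 1), fun γ => by rw [Arith.eval_rename]; exact ha γ.1⟩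

theorem sum {F : Γ → ℕ → ℕ} (hf : Dfn c f) (hF : Dfn (extend c) fun p => F p.1 p.2) :
    Dfn c fun γ => ∑ i ∈ Finset.range (f γ), F γ i := by
  obtain ⟨a, ha⟩ := hf
  obtain ⟨b, hb⟩ := hF
  exact ⟨.sum a b, fun γ => by
    simp only [Arith.eval, ha]
    exact Finset.sum_congr rfl fun i _ => hb (γ, i)⟩

theorem bind {F : Γ → ℕ → ℕ} (hf : Dfn c f) (hF : Dfn (extend c) fun p => F p.1 p.2) :
    Dfn c fun γ => F γ (f γ) := by
  obtain ⟨a, ha⟩ := hf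
  obtain ⟨b, hb⟩ := hF
  exact ⟨.bind a b, fun γ => by simp only [Arith.eval, ha]; exact hb (γ, f γ)⟩

theorem congr (hf : Dfn c f) (hg : ∀ γ, f γ = g γ) : Dfn c g := by
  obtain rfl : f = g := funext hg
  exact hf

theorem mul (hf : Dfn c f) (hg : Dfn c g) : Dfn c fun γ => f γ * g γ :=
  (hf.sum (F := fun γ _ => g γ) hg.wk).congr fun γ => by simp

end Dfn

namespace DfnP

theorem congr (hP : DfnP c P) (h : ∀ γ, P γ ↔ Q γ) : DfnP c Q := by
  obtain rfl : P = Q := funext fun γ => propext (h γ)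
  exact hP

/-- With truncated subtraction, `1 - (1 - (g - f))` is the truth value. -/
theorem lt (hf : Dfn c f) (hg : Dfn c g) : DfnP c fun γ => f γ < g γ := by
  obtain ⟨a, ha⟩ := ((Dfn.const 1).sub ((Dfn.const 1).sub (hg.sub hf)))
  refine ⟨a, fun γ => ?_⟩
  rw [ha]
  dsimp only
  omega

theorem not (hP : DfnP c P) : DfnP c fun γ => ¬ P γ := by
  obtain ⟨a, ha⟩ := hP
  refine ⟨.sub (.const 1) a, fun γ => ?_⟩
  rcases ha γ with ⟨h, h'⟩ | ⟨h, h'⟩ <;> simp [Arith.eval, h, h']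

theorem and (hP : DfnP c P) (hQ : DfnP c Q) : DfnP c fun γ => P γ ∧ Q γ := by
  obtain ⟨a, ha⟩ := hP
  obtain ⟨b, hb⟩ := hQ
  refine ⟨.sub (.add a b) (.const 1), fun γ => ?_⟩
  rcases ha γ with ⟨h, h'⟩ | ⟨h, h'⟩ <;> rcases hb γ with ⟨g, g'⟩ | ⟨g, g'⟩ <;>
    simp [Arith.eval, h, h', g, g']

theorem or (hP : DfnP c P) (hQ : DfnP c Q) : DfnP c fun γ => P γ ∨ Q γ :=
  (hP.not.and hQ.not).not.congr fun γ => by tauto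

theorem imp (hP : DfnP c P) (hQ : DfnP c Q) : DfnP c fun γ => P γ → Q γ :=
  (hP.not.or hQ).congr fun γ => by tauto

theorem le (hf : Dfn c f) (hg : Dfn c g) : DfnP c fun γ => f γ ≤ g γ :=
  (lt hg hf).not.congr fun γ => by omega

theorem eq (hf : Dfn c f) (hg : Dfn c g) : DfnP c fun γ => f γ = g γ :=
  ((le hf hg).and (le hg hf)).congr fun γ => by omega

theorem ne (hf : Dfn c f) (hg : Dfn c g) : DfnP c fun γ => f γ ≠ g γ := (eq hf hg).not

theorem const (p : Prop) : DfnP c fun _ => p := by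
  by_cases h : p
  · exact ⟨.const 1, fun _ => Or.inl ⟨rfl, h⟩⟩
  · exact ⟨.const 0, fun _ => Or.inr ⟨rfl, h⟩⟩

open Classical in
theorem toNat (hP : DfnP c P) : Dfn c fun γ => if P γ then 1 else 0 := by
  obtain ⟨a, ha⟩ := hP
  refine ⟨a, fun γ => ?_⟩
  rcases ha γ with ⟨h, h'⟩ | ⟨h, h'⟩ <;> simp [h, h']

open Classical in
theorem cond (hP : DfnP c P) (hf : Dfn c f) (hg : Dfn c g) :
    Dfn c fun γ => if P γ then f γ else g γ :=
  ((hP.toNat.mul hf).add (hP.not.toNat.mul hg)).congr fun γ => by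
    by_cases h : P γ <;> simp [h]

theorem exists_lt {F : Γ → ℕ → Prop} (hf : Dfn c f) (hF : DfnP (extend c) fun p => F p.1 p.2) :
    DfnP c fun γ => ∃ i, i < f γ ∧ F γ i := by
  classical
  refine (lt (Dfn.const 0) (hf.sum (F := fun γ i => if F γ i then 1 else 0) ?_)).congr fun γ => ?_
  · exact hF.toNat.congr fun _ => by congr
  · simp [Finset.filter_nonempty_iff]

theorem forall_lt {F : Γ → ℕ → Prop} (hf : Dfn c f) (hF : DfnP (extend c) fun p => F p.1 p.2) :
    DfnP c fun γ => ∀ i, i < f γ → F γ i :=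
  (exists_lt (F := fun γ i => ¬ F γ i) hf hF.not).not.congr fun γ => by simp

/-- The range is a constant, so the quantifier unfolds into a disjunction. Unlike in `exists_lt`,
the index may occur where only a constant is allowed, such as the exponent that selects a digit. -/
theorem exists_fixed {F : Γ → ℕ → Prop} (n : ℕ) (hF : ∀ i, DfnP c fun γ => F γ i) :
    DfnP c fun γ => ∃ i, i < n ∧ F γ i := by
  induction n with
  | zero => exact (const False).congr fun γ => by simp
  | succ n ih =>
    refine (ih.or (hF n)).congr fun γ => ⟨?_, ?_⟩
    · rintro (⟨i, hi, h⟩ | h)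
      · exact ⟨i, by omega, h⟩
      · exact ⟨n, by omega, h⟩
    · rintro ⟨i, hi, h⟩
      rcases Nat.lt_succ_iff_lt_or_eq.1 hi with hi | rfl
      · exact Or.inl ⟨i, hi, h⟩
      · exact Or.inr h

theorem forall_fixed {F : Γ → ℕ → Prop} (n : ℕ) (hF : ∀ i, DfnP c fun γ => F γ i) :
    DfnP c fun γ => ∀ i, i < n → F γ i :=
  (exists_fixed (F := fun γ i => ¬ F γ i) n fun i => (hF i).not).not.congr fun γ => by simp

end DfnP

namespace Dfn

theorem pow (hf : Dfn c f) (n : ℕ) : Dfn c fun γ => f γ ^ n := by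
  induction n with
  | zero => exact (const 1).congr fun γ => by simp
  | succ n ih => exact (ih.mul hf).congr fun γ => by rw [pow_succ]

/-- The quotient is the number of `i` with `(i + 1) * g ≤ f`. For `g = 0` this would count every
`i`, whence the case distinction. -/
theorem div (hf : Dfn c f) (hg : Dfn c g) : Dfn c fun γ => f γ / g γ := by
  classical
  have h1 : DfnP (extend c) fun p => (p.2 + 1) * g p.1 ≤ f p.1 :=
    DfnP.le ((last.add (const 1)).mul hg.wk) hf.wk
  have h2 := hf.sum (F := fun γ i => if (i + 1) * g γ ≤ f γ then 1 else 0)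
    (h1.toNat.congr fun _ => by congr)
  refine ((DfnP.lt (const 0) hg).cond h2 (const 0)).congr fun γ => ?_
  rcases Nat.eq_zero_or_pos (g γ) with h0 | h0
  · simp [h0]
  · rw [if_pos h0, Finset.sum_boole]
    have : (Finset.range (f γ)).filter (fun i => (i + 1) * g γ ≤ f γ) =
        Finset.range (f γ / g γ) := by
      ext i
      simp only [Finset.mem_filter, Finset.mem_range, ← Nat.le_div_iff_mul_le h0]
      have := Nat.div_le_self (f γ) (g γ)
      omega
    simp [this]

theorem mod (hf : Dfn c f) (hg : Dfn c g) : Dfn c fun γ => f γ % g γ :=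
  (hf.sub (hg.mul (hf.div hg))).congr fun γ => by
    have := Nat.div_add_mod (f γ) (g γ)
    omega

end Dfn

end

/-! ### Definable reductions -/

/-- A step writes at most one cell. This is what bounds the length of an intermediate word by the
time spent on it. -/
theorem exec_changes {P : Prog} {s s' : State} {t : ℕ} (h : Exec P s s' t) :
    ∃ F : Finset ℕ, F.card ≤ t ∧ ∀ i ∉ F, s'.bank 0 i = s.bank 0 i := by
  classical
  induction h with
  | const | add | sub | load | skip | loop_false => exact ⟨∅, by simp, fun _ _ => rfl⟩
  | store s b i r =>
    refine ⟨{s.reg i}, by simp, fun j hj => ?_⟩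
    rw [State.setBank_bank, if_neg fun h => hj (by simp [h.2])]
  | seq _ _ ih ih' =>
    obtain ⟨F, hF, h⟩ := ih
    obtain ⟨F', hF', h'⟩ := ih'
    refine ⟨F ∪ F', (Finset.card_union_le _ _).trans (by omega), fun i hi => ?_⟩
    rw [Finset.notMem_union] at hi
    rw [h' i hi.2, h i hi.1]
  | ite_true _ _ ih | ite_false _ _ ih =>
    obtain ⟨F, hF, h⟩ := ih
    exact ⟨F, by omega, h⟩
  | loop_true _ _ _ ih ih' =>
    obtain ⟨F, hF, h⟩ := ih
    obtain ⟨F', hF', h'⟩ := ih'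
    refine ⟨F ∪ F', (Finset.card_union_le _ _).trans (by omega), fun i hi => ?_⟩
    rw [Finset.notMem_union] at hi
    rw [h' i hi.2, h i hi.1]

theorem wordCells_of_lt {a : ℕ} {x : List (Fin a)} {i : ℕ} (h : i < x.length) :
    wordCells x i = x[i] + 1 := by
  simp [wordCells, h]

theorem wordCells_of_le {a : ℕ} {x : List (Fin a)} {i : ℕ} (h : x.length ≤ i) :
    wordCells x i = 0 := by
  simp [wordCells, h]

theorem wordCells_le {a : ℕ} (x : List (Fin a)) (i : ℕ) : wordCells x i ≤ a := by
  rcases lt_or_ge i x.length with h | h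
  · rw [wordCells_of_lt h]; exact x[i].2
  · rw [wordCells_of_le h]; omega

/-- The output of a program on an input word is not much longer than the input plus the number
of steps. -/
theorem length_le_of_exec {a b : ℕ} {P : Prog} {x : List (Fin a)} {y : List (Fin b)} {k k' t : ℕ}
    {s : State} (h : Exec P (inputState x k) s t) (hs : Outputs s y k') :
    y.length ≤ x.length + t := by
  obtain ⟨F, hF, h⟩ := exec_changes h
  -- Letters are stored as nonzero numbers, so a cell of the output held an input letter or was
  -- written.
  have : Finset.range y.length ⊆ Finset.range x.length ∪ F := by
    intro i hi
    rw [Finset.mem_range] at hi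
    rw [Finset.mem_union, Finset.mem_range]
    by_contra! hc
    have h1 := hs.2 i hi.le
    rw [h i hc.2, wordCells_of_lt hi] at h1
    simp [inputState, wordCells_of_le hc.1] at h1
  have := (Finset.card_le_card this).trans (Finset.card_union_le _ _)
  simp only [Finset.card_range] at this
  omega

/-- The context of an instance: the word is on the tape, the parameter and the length of the word
are in the environment. -/
def instanceCtx {a : ℕ} (p : List (Fin a) × ℕ) : (ℕ → ℕ) × (ℕ → ℕ) :=
  (wordCells p.1, push p.2 fun _ => p.1.length)

/-- Copy the word in bank `0` to bank `1` and store its length in register `1`. -/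
def copyInput : Prog :=
  (Prog.const 1 0).seq ((Prog.load 2 0 1).seq (.loop 2 ((Prog.store 1 1 2).seq
    ((Prog.const 3 1).seq ((Prog.add 1 1 3).seq (.load 2 0 1))))))

theorem copyInput_runs {a : ℕ} {x : List (Fin a)} {k : ℕ} {s : State} (hs : Outputs s x k) :
    Runs copyInput s (3 + 5 * x.length) fun s' => s'.reg 0 = k ∧ s'.reg 1 = x.length ∧
      ∀ i, wordCells x i = if i < x.length then s'.bank 1 i else 0 := by
  obtain ⟨h0, hb⟩ := hs
  refine Runs.mono (Runs.seq (Runs.const (Runs.seq (Runs.load ?_))))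
    (t := 1 + (1 + (1 + ∑ i ∈ Finset.range x.length, (4 + 1)))) ?_ fun _ h => h
  rotate_left
  · simp only [Finset.sum_const, Finset.card_range, smul_eq_mul]
    omega
  refine (Runs.loop x.length (fun _ => 4) (fun n s' => s'.reg 0 = k ∧ s'.reg 1 = n ∧
    s'.reg 2 = wordCells x n ∧ s'.bank 0 = s.bank 0 ∧ ∀ i < n, wordCells x i = s'.bank 1 i)
      ?_ ?_ ?_).mono le_rfl ?_
  · refine ⟨by simp [h0], by simp, by simp [hb 0 (by omega)], by simp, by simp⟩
  · rintro n hn s₁ ⟨g0, g1, g2, g3, g4⟩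
    refine ⟨by rw [g2, wordCells_of_lt hn]; omega, ?_⟩
    refine Runs.seq (t := 1) (t' := 1 + (1 + 1)) (Runs.store (Runs.seq (Runs.const (Runs.seq
      (Runs.add (Runs.load ⟨?_, ?_, ?_, ?_, fun i hi => ?_⟩))))))
    · simp [g0]
    · simp [g1]
    · simp [State.setBank_bank, g3, g1, hb (n + 1) hn]
    · funext i
      simp [State.setBank_bank, g3]
    · simp only [State.setReg_bank, State.setBank_bank, g1, g2, true_and]
      split_ifs with hin
      · rw [hin]
      · exact g4 i (by omega)
  · rintro s₁ ⟨-, -, g2, -⟩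
    rw [g2, wordCells_of_le le_rfl]
  · rintro s₁ ⟨g0, g1, -, -, g4⟩
    refine ⟨g0, g1, fun i => ?_⟩
    split_ifs with hi
    · exact g4 i hi
    · exact wordCells_of_le (by omega)

/-- A word with definable length and letters, and a definable parameter, are computed in
polynomial time. The initial contents of registers and banks that do not belong to the input
are arbitrary. -/
theorem exists_prog {a b : ℕ} {T K : List (Fin a) × ℕ → ℕ} {cell : List (Fin a) × ℕ → ℕ → Fin b}
    (hT : Dfn instanceCtx T) (hK : Dfn instanceCtx K)
    (hcell : Dfn (extend instanceCtx) fun p => (cell p.1 p.2 : ℕ)) :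
    ∃ (P : Prog) (c : ℕ), ∀ (x : List (Fin a)) (k : ℕ) (s : State), Outputs s x k →
      Runs P s (((k + 2 + a) * (x.length + 1)) ^ c) fun s' =>
        Outputs s' ((List.range (T (x, k))).map (cell (x, k))) (K (x, k)) := by
  obtain ⟨eT, hT⟩ := hT.wk
  obtain ⟨eK, hK⟩ := hK.wk
  obtain ⟨eC, hC⟩ := hcell.add (Dfn.const 1)
  obtain ⟨cT, hcT⟩ := eT.exists_pow_bound
  obtain ⟨cK, hcK⟩ := eK.exists_pow_bound
  obtain ⟨cC, hcC⟩ := eC.exists_pow_bound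
  -- Register `4` holds the position of the output cell, register `0` the parameter, register `1`
  -- the length of the word; work space starts at `7`. Length and parameter of the output were
  -- weakened so that all three terms share this context.
  let ctx : ℕ → ℕ := push 4 (push 0 fun _ => 1)
  refine ⟨copyInput.seq ((Prog.const 4 0).seq ((eT.compile ctx 7).seq ((Prog.const 5 0).seq
    ((Prog.add 5 5 7).seq ((Prog.loop 5 ((eC.compile ctx 7).seq ((Prog.store 0 4 7).seq
      ((Prog.const 6 1).seq ((Prog.add 4 4 6).seq (.sub 5 5 6)))))).seq ((Prog.const 6 0).seq
        ((Prog.store 0 4 6).seq ((Prog.const 4 0).seq ((eK.compile ctx 7).seq ((Prog.const 0 0).seq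
          (.add 0 0 7))))))))))), cT + (cT + 1) * cC + cK + 8, fun x k s hs => ?_⟩
  set m := (k + 2 + a) * (x.length + 1) with hm
  have hm2 : 2 ≤ m := by nlinarith
  have hma : a ≤ m := by nlinarith
  have hmk : k ≤ m := by nlinarith
  have hmx : x.length ≤ m := by nlinarith
  let E : ℕ → ℕ → ℕ := fun p => push p (push k fun _ => x.length)
  have hEm : ∀ {p m' : ℕ}, p ≤ m' → m ≤ m' → ∀ i, E p i ≤ m' := by
    rintro p m' hp hm' (_ | _ | i)
    · exact hp
    · exact hmk.trans hm'
    · exact hmx.trans hm'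
  have hctx : ∀ i, ctx i < 7 := by
    rintro (_ | _ | i) <;> simp [ctx, push]
  have hE : ∀ {s' : State} {p : ℕ}, s'.reg 4 = p → s'.reg 0 = k → s'.reg 1 = x.length →
      ∀ i, s'.reg (ctx i) = E p i := by
    rintro s' p h1 h2 h3 (_ | _ | i)
    · exact h1
    · exact h2
    · exact h3
  have hw : ∀ i, wordCells x i ≤ m := fun i => (wordCells_le x i).trans hma
  have bT := hcT (wordCells x) (E 0) m hm2 hw (hEm (by omega) le_rfl)
  have bK := hcK (wordCells x) (E 0) m hm2 hw (hEm (by omega) le_rfl)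
  have vT : eT.eval (wordCells x) (E 0) = T (x, k) := hT ((x, k), 0)
  have vK : eK.eval (wordCells x) (E 0) = K (x, k) := hK ((x, k), 0)
  have vC : ∀ p, eC.eval (wordCells x) (E p) = cell (x, k) p + 1 := fun p => hC ((x, k), p)
  have hmm : m ≤ m ^ (cT + 1) := Nat.le_self_pow (by omega) _
  have bC : ∀ p ∈ Finset.range (T (x, k)),
      eC.cost (wordCells x) (E p) + 4 + 1 ≤ m ^ ((cT + 1) * cC) + 5 := by
    intro p hp
    have := (hcC (wordCells x) (E p) (m ^ (cT + 1)) (hm2.trans hmm) (fun i => (hw i).trans hmm)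
      (hEm ((Finset.mem_range.1 hp).le.trans ((vT ▸ bT.1).trans
        (Nat.pow_le_pow_right (by omega) (by omega)))) hmm)).2
    rw [← pow_mul] at this
    omega
  refine Runs.mono (t := (3 + 5 * x.length) + (1 + (eT.cost (wordCells x) (E 0) + (1 + (1 +
    ((1 + ∑ p ∈ Finset.range (T (x, k)), (eC.cost (wordCells x) (E p) + 4 + 1)) + (1 + (1 + (1 +
      (eK.cost (wordCells x) (E 0) + (1 + 1)))))))))))
    (Runs.seq ((copyInput_runs hs).mono le_rfl ?_)) ?_ fun _ h => h
  · rintro s₁ ⟨g0, g1, g2⟩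
    refine Runs.seq (Runs.const (Runs.seq ((eT.compile_runs (wordCells x) ctx (E 0) 7 _ hctx
      (by omega) (hE (by simp) (by simp [g0]) (by simp [g1])) (by simpa [g1] using g2)).mono
        le_rfl ?_)))
    rintro s₂ ⟨h1, h2, h3⟩
    have hs0 : s₂.reg 0 = k := by simp [h2 0, g0]
    have hs1 : s₂.reg 1 = x.length := by simp [h2 1, g1]
    have hs4 : s₂.reg 4 = 0 := by simp [h2 4]
    refine Runs.seq (Runs.const (Runs.seq (Runs.add (Runs.seq ((Runs.loop (T (x, k))
      (fun p => eC.cost (wordCells x) (E p) + 4) (fun p s' => s'.reg 0 = k ∧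
        s'.reg 1 = x.length ∧ s'.reg 4 = p ∧ s'.reg 5 = T (x, k) - p ∧
        (∀ i, s'.bank 1 i = s₁.bank 1 i) ∧ ∀ i < p, s'.bank 0 i = cell (x, k) i + 1)
          ?_ ?_ ?_).mono le_rfl ?_)))))
    · refine ⟨by simp [hs0], by simp [hs1], by simp [hs4], by simp [h1, vT], fun i => by simp [h3],
        by simp⟩
    · rintro p hp s₃ ⟨i0, i1, i4, i5, i6, i7⟩
      refine ⟨by omega, Runs.seq (t' := 1 + (1 + (1 + 1))) ((eC.compile_runs (wordCells x) ctx (E p)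
        7 s₃ hctx (by omega) (hE i4 i0 i1) (by simpa [i1, i6] using g2)).mono le_rfl ?_)⟩
      rintro s₄ ⟨j1, j2, j3⟩
      refine Runs.seq (Runs.store (Runs.seq (Runs.const (Runs.seq (Runs.add (Runs.sub
        ⟨?_, ?_, ?_, ?_, fun i => ?_, fun i hi => ?_⟩))))))
      · simp [j2 0, i0]
      · simp [j2 1, i1]
      · simp [j2 4, i4]
      · simp [j2 5, i5, Nat.sub_sub]
      · simp [State.setBank_bank, j3, i6]
      · simp only [State.setReg_bank, State.setBank_bank, true_and, j2 4 (by omega), i4, j1, vC, j3]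
        split_ifs with hip
        · rw [hip]
        · exact i7 i (by omega)
    · rintro s₃ ⟨-, -, -, i5, -⟩
      simpa using i5
    · rintro s₃ ⟨i0, i1, i4, i5, i6, i7⟩
      -- The old contents of bank `0` may extend beyond the new word, so a blank is written behind
      -- it. The new parameter comes last, since it overwrites the register of the old one.
      refine Runs.seq (Runs.const (Runs.seq (Runs.store (Runs.seq (Runs.const (Runs.seq
        ((eK.compile_runs (wordCells x) ctx (E 0) 7 _ hctx (by omega) (hE (by simp) (by simp [i0])
          (by simp [i1])) ?_).mono le_rfl ?_)))))))
      · intro i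
        simp [State.setBank_bank, i1, i6, g2]
      · rintro s₄ ⟨j1, j2, j3⟩
        refine Runs.seq (Runs.const (Runs.add ⟨by simp [j1, vK], fun i hi => ?_⟩))
        simp only [List.length_map, List.length_range] at hi
        simp only [State.setReg_bank, j3, State.setBank_bank, State.setReg_reg, true_and, i4,
          if_true, if_neg (show (4 : ℕ) ≠ 6 by omega)]
        split_ifs with hiT
        · rw [wordCells_of_le (by simp [hiT])]
        · rw [wordCells_of_lt (by simp; omega), i7 i (by omega)]
          simp
  · have s1 := Finset.sum_le_card_nsmul _ _ _ bC
    simp only [Finset.card_range, smul_eq_mul] at s1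
    have t1 : T (x, k) ≤ m ^ cT := vT ▸ bT.1
    have t2 := bT.2
    have t3 := bK.2
    have e : m ^ (cT + (cT + 1) * cC + cK + 8) = m ^ cT * m ^ ((cT + 1) * cC) * m ^ cK * m ^ 8 := by
      ring
    have one : ∀ j, 1 ≤ m ^ j := fun j => Nat.one_le_pow _ _ (by omega)
    -- The summand `8` in the exponent pays for the copying of the input and for all constant
    -- factors.
    have h128 : 128 * m ≤ m ^ 8 := by
      have := Nat.pow_le_pow_left hm2 7
      calc 128 * m ≤ m ^ 7 * m := Nat.mul_le_mul_right _ this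
        _ = m ^ 8 := by ring
    rw [e]
    have o1 := one cT
    have o2 := one ((cT + 1) * cC)
    have o3 := one cK
    generalize m ^ cT = X at *
    generalize m ^ ((cT + 1) * cC) = Y at *
    generalize m ^ cK = Z at *
    have s2 : T (x, k) * (Y + 5) ≤ X * Y + 5 * X :=
      (Nat.mul_le_mul_right _ t1).trans (by ring_nf; omega)
    have q1 : X ≤ X * Y * Z := by rw [mul_assoc]; exact Nat.le_mul_of_pos_right _ (Nat.mul_pos o2 o3)
    have q2 : X * Y ≤ X * Y * Z := Nat.le_mul_of_pos_right _ o3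
    have q3 : Z ≤ X * Y * Z := Nat.le_mul_of_pos_left _ (Nat.mul_pos o1 o2)
    have q4 : X * Y * Z * (128 * m) ≤ X * Y * Z * m ^ 8 := Nat.mul_le_mul_left _ h128
    have q5 : 1 ≤ X * Y * Z := Nat.mul_pos (Nat.mul_pos o1 o2) o3
    generalize X * Y * Z = W at *
    have q6 : W * (128 * m) = 128 * (W * m) := by ring
    have q7 : m ≤ W * m := Nat.le_mul_of_pos_left _ q5
    have q8 : W * 2 ≤ W * m := Nat.mul_le_mul_left _ hm2
    omega

theorem computable_pow_const {f : ℕ → ℕ} (hf : Computable f) (c : ℕ) :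
    Computable fun k => f k ^ c := by
  induction c with
  | zero => exact (Computable.const 1).of_eq fun k => by simp
  | succ c ih =>
    exact (Primrec.nat_mul.to_comp.comp ih hf).of_eq fun k => by rw [pow_succ]

/-- A parameterized reduction followed by a definable one. -/
theorem ParamReducible.trans_dfn {A B C : ParamProblem} (hAB : ParamReducible A B)
    {T K : List (Fin B.alphabet) × ℕ → ℕ} {cell : List (Fin B.alphabet) × ℕ → ℕ → Fin C.alphabet}
    (hT : Dfn instanceCtx T) (hK : Dfn instanceCtx K)
    (hcell : Dfn (extend instanceCtx) fun p => (cell p.1 p.2 : ℕ)) {e : ℕ}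
    (hKle : ∀ x k, K (x, k) ≤ (k + 2) ^ e)
    (hC : ∀ x k, (x, k) ∈ B.L ↔ ((List.range (T (x, k))).map (cell (x, k)), K (x, k)) ∈ C.L) :
    ParamReducible A C := by
  obtain ⟨P, f, g, c, hf, hg, hP⟩ := hAB
  obtain ⟨Q, c', hQ⟩ := exists_prog hT hK hcell
  have hg2 : ∀ n, Computable fun k => g k + n := fun n =>
    Primrec.nat_add.to_comp.comp hg (Computable.const n)
  have hf1 : Computable fun k => f k + 1 := Primrec.nat_add.to_comp.comp hf (Computable.const 1)
  refine ⟨P.seq Q, fun k => f k + (g k + (2 + B.alphabet)) ^ c' * (f k + 1) ^ c',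
    fun k => (g k + 2) ^ e, (c + 1) * (c' + 1), ?_, computable_pow_const (hg2 2) e,
    fun x k => ?_⟩
  · exact Primrec.nat_add.to_comp.comp hf (Primrec.nat_mul.to_comp.comp
      (computable_pow_const (hg2 _) c') (computable_pow_const hf1 c'))
  obtain ⟨y, k₁, s, t, hE, hO, ht, hk, hiff⟩ := hP x k
  obtain ⟨s', t', hE', ht', hO'⟩ := hQ y k₁ s hO
  refine ⟨_, _, s', t + t', hE.seq hE', hO', ?_, (hKle y k₁).trans ?_, hiff.trans (hC y k₁)⟩
  · have hy := length_le_of_exec hE hO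
    set X := x.length + 1 with hX
    have hX1 : 1 ≤ X := by omega
    have h1 : X ^ c ≤ X ^ (c + 1) := Nat.pow_le_pow_right hX1 (by omega)
    have h2 : X ≤ X ^ (c + 1) := Nat.le_self_pow (by omega) _
    have hy1 : y.length + 1 ≤ (f k + 1) * X ^ (c + 1) := by
      have : f k * X ^ c ≤ f k * X ^ (c + 1) := Nat.mul_le_mul_left _ h1
      rw [add_mul]
      omega
    have ht1 : t ≤ f k * X ^ ((c + 1) * (c' + 1)) :=
      ht.trans (Nat.mul_le_mul_left _ (Nat.pow_le_pow_right hX1 (by nlinarith)))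
    have ht2 : t' ≤ (g k + (2 + B.alphabet)) ^ c' * (f k + 1) ^ c' *
        X ^ ((c + 1) * (c' + 1)) := by
      refine ht'.trans ((Nat.pow_le_pow_left (Nat.mul_le_mul
        (show k₁ + 2 + B.alphabet ≤ g k + (2 + B.alphabet) by omega) hy1) c').trans ?_)
      rw [mul_pow, mul_pow, ← pow_mul, mul_assoc]
      exact Nat.mul_le_mul_left _ (Nat.mul_le_mul_left _
        (Nat.pow_le_pow_right hX1 (Nat.mul_le_mul_left _ (by omega))))
    calc t + t' ≤ _ := Nat.add_le_add ht1 ht2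
      _ = _ := by ring
  · exact Nat.pow_le_pow_left (by omega) e

/-! ### The sentence -/

section Sentence

open Language BoundedFormula

/-- The quantifier-free part of `nearLeafSentence`, with variables `u, v, m, a, b`. -/
def nearLeafMatrix : Language.graph.BoundedFormula Empty 5 :=
  ((&0).bdEqual (&1) ⊔ (adj.boundedFormula₂ (&0) (&1) ⊔
    (adj.boundedFormula₂ (&0) (&2) ⊓ adj.boundedFormula₂ (&2) (&1)))) ⊓
  ((adj.boundedFormula₂ (&1) (&3) ⊓ adj.boundedFormula₂ (&1) (&4)).imp ((&3).bdEqual (&4)))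

/-- Every vertex is at distance at most two from a vertex of degree at most one. -/
def nearLeafSentence : Language.graph.Sentence :=
  nearLeafMatrix.all.all.ex.ex.all

theorem isPi_nearLeafSentence : IsPi 3 nearLeafSentence := by
  have hadj : ∀ i j : Fin 5, (adj.boundedFormula₂ (α := Empty) (&i) (&j)).IsQF :=
    fun i j => (IsAtomic.rel _ _).isQF
  have hQF : nearLeafMatrix.IsQF :=
    ((IsAtomic.equal _ _).isQF.sup ((hadj _ _).sup ((hadj _ _).inf (hadj _ _)))).inf
      (((hadj _ _).inf (hadj _ _)).imp (IsAtomic.equal _ _).isQF)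
  exact .all (.switch (.ex (.ex (.switch (.all (.all (.switch (.quantifierFree hQF))))))))

end Sentence

/-! ### The meaning of the sentence -/

section NearLeaf

variable {V : Type*}

/-- `u` and `v` are at distance at most two. -/
def Near (G : SimpleGraph V) (u v : V) : Prop :=
  u = v ∨ G.Adj u v ∨ ∃ m, G.Adj u m ∧ G.Adj m v

/-- `v` has degree at most one. -/
def Low (G : SimpleGraph V) (v : V) : Prop :=
  ∀ a b, G.Adj v a → G.Adj v b → a = b

theorem models_nearLeafSentence (G : SimpleGraph V) :
    Models G nearLeafSentence ↔ ∀ u, ∃ v, Near G u v ∧ Low G v := by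
  let := G.structure
  have hrel : ∀ x y : V, Language.Structure.RelMap (L := Language.graph) Language.adj ![x, y] ↔
      G.Adj x y := fun x y => Iff.rfl
  simp only [Models, Language.Sentence.Realize, Language.Formula.Realize, nearLeafSentence,
    nearLeafMatrix, Language.BoundedFormula.realize_all, Language.BoundedFormula.realize_ex,
    Language.BoundedFormula.realize_inf, Language.BoundedFormula.realize_sup,
    Language.BoundedFormula.realize_imp, Language.BoundedFormula.realize_rel₂,
    Language.BoundedFormula.realize_bdEqual, Language.Term.realize_var, Function.comp_apply,
    Sum.elim_inr, hrel]
  refine forall_congr' fun u => ⟨?_, ?_⟩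
  · rintro ⟨v, m, h⟩
    refine ⟨v, ?_, fun a b ha hb => (h a b).2 ⟨ha, hb⟩⟩
    rcases (h u u).1 with h' | h' | h'
    · exact Or.inl h'
    · exact Or.inr (Or.inl h')
    · exact Or.inr (Or.inr ⟨m, h'⟩)
  · rintro ⟨v, hn, hl⟩
    rcases hn with h | h | ⟨m, h⟩
    · exact ⟨v, u, fun a b => ⟨Or.inl h, fun hab => hl a b hab.1 hab.2⟩⟩
    · exact ⟨v, u, fun a b => ⟨Or.inr (Or.inl h), fun hab => hl a b hab.1 hab.2⟩⟩
    · exact ⟨v, m, fun a b => ⟨Or.inr (Or.inr h), fun hab => hl a b hab.1 hab.2⟩⟩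

theorem edist_le_two_iff (G : SimpleGraph V) (u v : V) : G.edist u v ≤ 2 ↔ Near G u v := by
  constructor
  · intro h
    obtain ⟨p, hp⟩ := SimpleGraph.exists_walk_of_edist_ne_top
      (ne_top_of_le_ne_top (by simp) h)
    rw [← hp] at h
    have h : p.length ≤ 2 := by exact_mod_cast h
    match p, h with
    | .nil, _ => exact Or.inl rfl
    | .cons h₁ .nil, _ => exact Or.inr (Or.inl h₁)
    | .cons h₁ (.cons h₂ .nil), _ => exact Or.inr (Or.inr ⟨_, h₁, h₂⟩)
    | .cons h₁ (.cons h₂ (.cons h₃ q)), h => simp at h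
  · rintro (rfl | h | ⟨m, h₁, h₂⟩)
    · simp
    · exact (SimpleGraph.edist_le (.cons h .nil)).trans (by norm_num)
    · exact (SimpleGraph.edist_le (.cons h₁ (.cons h₂ .nil))).trans (by norm_num)

theorem models_nearLeafSentence_iff [Finite V] (G : SimpleGraph V) :
    Models G nearLeafSentence ↔ ∀ u, ∃ v, G.edist u v ≤ 2 ∧ (G.neighborSet v).ncard ≤ 1 := by
  rw [models_nearLeafSentence]
  refine forall_congr' fun u => exists_congr fun v => and_congr (edist_le_two_iff G u v).symm ?_
  rw [Set.ncard_le_one (Set.toFinite _)]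
  exact ⟨fun h a ha b hb => h a b ha hb, fun h a b ha hb => h a ha b hb⟩

end NearLeaf

/-! ### Bounds for the elimination distances -/

section Recursive

variable {V : Type*} {φ : Language.graph.Sentence} {G : SimpleGraph V} {S : Finset V}

theorem edConn_eq_zero (hc : (sub G S).Connected) (hm : Models (sub G S) φ) :
    edConn φ G S = 0 := by
  rw [edConn]
  split_ifs <;> rfl

open Classical in
theorem edConn_le_succ (hc : (sub G S).Connected) {v : V} (hv : v ∈ S) :
    edConn φ G S ≤ 1 + edConn φ G (S.erase v) := by
  rw [edConn]
  split_ifs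
  · exact Nat.zero_le _
  · exact Nat.add_le_add_left (Finset.inf'_le _ (Finset.mem_attach S ⟨v, hv⟩)) 1
  · exact Nat.zero_le _

theorem edProp_eq_zero (hm : Models (sub G S) φ) : edProp φ G S = 0 := by
  rw [edProp]
  split_ifs <;> rfl

open Classical in
theorem edProp_le_succ (hc : (sub G S).Connected) {v : V} (hv : v ∈ S) :
    edProp φ G S ≤ 1 + edProp φ G (S.erase v) := by
  rw [edProp]
  split_ifs
  · exact Nat.zero_le _
  · exact Nat.add_le_add_left (Finset.inf'_le _ (Finset.mem_attach S ⟨v, hv⟩)) 1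
  · exact Nat.zero_le _

open Classical in
/-- If a property of a set of vertices and a budget is preserved when a vertex is paid for and
when a suitable component is selected, then within the budget some set with this property
is reached that induces a model. -/
theorem exists_models_of_edConn_le {I : Finset V → ℕ → Prop}
    (hne : ∀ S j, I S j → S.Nonempty) (herase : ∀ S j v, I S (j + 1) → v ∈ S → I (S.erase v) j)
    (hcomp : ∀ S j, I S j → ∃ v, I (comp G S v) j) {j : ℕ} (hI : I S j)
    (h : edConn φ G S ≤ j) : ∃ S' j', I S' j' ∧ Models (sub G S') φ := by
  induction hn : S.card using Nat.strong_induction_on generalizing S j with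
  | _ n ih =>
    subst hn
    have hS := hne S j hI
    rw [edConn, dif_pos hS] at h
    split_ifs at h with hc hm
    · exact ⟨S, j, hI, hm⟩
    · obtain ⟨v, -, hv⟩ := Finset.exists_mem_eq_inf' (Finset.attach_nonempty_iff.2 hS)
        fun v => edConn φ G (S.erase v.1)
      obtain ⟨j, rfl⟩ : ∃ i, j = i + 1 := ⟨j - 1, by omega⟩
      refine ih _ (Finset.card_erase_lt_of_mem v.2) (herase S j v hI v.2) ?_ rfl
      rw [hv] at h
      omega
    · obtain ⟨v, hv⟩ := hcomp S j hI
      exact ih _ (Finset.card_lt_card (comp_ssubset G S v hc)) hv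
        ((Finset.le_sup (f := fun v => edConn φ G (comp G S v)) (Finset.mem_attach S v)).trans h) rfl

-- The same descent as for `edConn`; the maximum with `1` in the disconnected case only raises the
-- distance.
open Classical in
theorem exists_models_of_edProp_le {I : Finset V → ℕ → Prop}
    (hne : ∀ S j, I S j → S.Nonempty) (herase : ∀ S j v, I S (j + 1) → v ∈ S → I (S.erase v) j)
    (hcomp : ∀ S j, I S j → ∃ v, I (comp G S v) j) {j : ℕ} (hI : I S j)
    (h : edProp φ G S ≤ j) : ∃ S' j', I S' j' ∧ Models (sub G S') φ := by
  induction hn : S.card using Nat.strong_induction_on generalizing S j with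
  | _ n ih =>
    subst hn
    have hS := hne S j hI
    rw [edProp, dif_pos hS] at h
    split_ifs at h with hm hc
    · exact ⟨S, j, hI, hm⟩
    · obtain ⟨v, -, hv⟩ := Finset.exists_mem_eq_inf' (Finset.attach_nonempty_iff.2 hS)
        fun v => edProp φ G (S.erase v.1)
      obtain ⟨j, rfl⟩ : ∃ i, j = i + 1 := ⟨j - 1, by omega⟩
      refine ih _ (Finset.card_erase_lt_of_mem v.2) (herase S j v hI v.2) ?_ rfl
      rw [hv] at h
      omega
    · obtain ⟨v, hv⟩ := hcomp S j hI
      exact ih _ (Finset.card_lt_card (comp_ssubset G S v hc)) hv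
        ((Finset.le_sup (f := fun v => edProp φ G (comp G S v)) (Finset.mem_attach S v)).trans
          ((le_max_right _ _).trans h)) rfl

theorem mem_comp {v : S} {w : V} :
    w ∈ comp G S v ↔ ∃ h : w ∈ S, (sub G S).Reachable v ⟨w, h⟩ := by
  classical
  simp [comp]

end Recursive

/-! ### Elimination sets and rooted trees -/

section Tree

variable {N : Type*} {T : SimpleGraph N} {r : N}

theorem Anc.trans (hT : T.IsTree) {u v w : N} (huv : Anc T r u v) (hvw : Anc T r v w) :
    Anc T r u w := by
  classical
  obtain ⟨p, hp, hu⟩ := huv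
  obtain ⟨q, hq, hv⟩ := hvw
  have := (hT.existsUnique_path r v).unique hp (hq.takeUntil hv)
  subst this
  exact ⟨q, hq, q.support_takeUntil_subset_support hv hu⟩

/-- The path from the root to `v` passes through `u` after as many steps as it has in total. Hence
the nodes of one branch can be counted by their depths. -/
theorem Anc.eq_of_dist_eq (hT : T.IsTree) {u v : N} (h : Anc T r u v)
    (hd : T.dist r u = T.dist r v) : u = v := by
  classical
  obtain ⟨p, hp, hu⟩ := h
  have dist_eq : ∀ {w : N} (q : T.Walk r w), q.IsPath → q.length = T.dist r w := by
    intro w q hq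
    obtain ⟨q', hq', hl⟩ := hT.1.exists_path_of_dist r w
    rw [(hT.existsUnique_path r w).unique hq hq', hl]
  have h1 := dist_eq p hp
  have h2 := dist_eq _ (hp.takeUntil hu)
  have h3 := congrArg SimpleGraph.Walk.length (p.take_spec hu)
  rw [SimpleGraph.Walk.length_append] at h3
  exact SimpleGraph.Walk.eq_of_length_eq_zero (p := p.dropUntil u hu) (by omega)

/-- The tree need not be finite, but the depths of common ancestors are bounded and the root is one
of them. -/
theorem exists_isLCA (hT : T.IsTree) {d : ℕ} (hd : ∀ v, T.dist r v ≤ d) (x y : N) :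
    ∃ v, IsLCA T r x y v := by
  have hroot : ∀ z, Anc T r r z := fun z => by
    obtain ⟨p, hp, -⟩ := hT.existsUnique_path r z
    exact ⟨p, hp, p.start_mem_support⟩
  by_contra! hno
  have : ∀ n, ∃ w, Anc T r w x ∧ Anc T r w y ∧ n ≤ T.dist r w := by
    intro n
    induction n with
    | zero => exact ⟨r, hroot x, hroot y, Nat.zero_le _⟩
    | succ n ih =>
      obtain ⟨w, hx, hy, hw⟩ := ih
      by_contra! hc
      exact hno w ⟨hx, hy, fun w' hx' hy' => by have := hc w' hx' hy'; omega⟩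
  obtain ⟨w, -, -, hw⟩ := this (d + 1)
  have := hd w
  omega

end Tree

/-- If any two vertices from a subset of an elimination set are linked outside of the elimination
set, then the subset is on one branch of the tree. -/
theorem card_le_of_linked {V : Type*} {G : SimpleGraph V} {X : Set V} {d : ℕ}
    (h : IsElimSet G X d) (F : Finset V) (hF : ∀ v ∈ F, v ∈ X)
    (hlink : ∀ u ∈ F, ∀ v ∈ F, u ≠ v → ∃ p : G.Walk u v, ∀ w ∈ p.support, w ∈ X → w = u ∨ w = v) :
    F.card ≤ d + 1 := by
  obtain ⟨N, T, r, α, hT, hd, hα, hsep⟩ := h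
  have hex : ∀ v ∈ F, ∃ x, α x = v := fun v hv => by
    obtain ⟨x, -, hx⟩ := hα.surjOn (hF v hv)
    exact ⟨x, hx⟩
  have : Nonempty N := ⟨r⟩
  choose! β hβ using hex
  have hcmp : ∀ u ∈ F, ∀ v ∈ F, Anc T r (β u) (β v) ∨ Anc T r (β v) (β u) := by
    intro u hu v hv
    by_contra! hc
    have hne : u ≠ v := by
      rintro rfl
      obtain ⟨p, hp, -⟩ := hT.existsUnique_path r (β u)
      exact hc.1 ⟨p, hp, p.end_mem_support⟩
    obtain ⟨z, hz⟩ := exists_isLCA hT hd (β u) (β v)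
    obtain ⟨p, hp⟩ := hlink u hu v hv hne
    -- The linking walk can meet the ancestors of the lowest common ancestor only in one of its
    -- ends, and then this end is an ancestor of the other.
    have hs := hsep _ _ z hc.1 hc.2 hz
    rw [hβ u hu, hβ v hv] at hs
    obtain ⟨w, hw, a, ha, rfl⟩ := hs p
    rcases hp _ hw (hα.mapsTo (Set.mem_univ a)) with h | h
    · have : a = β u := hα.injOn (Set.mem_univ _) (Set.mem_univ _) (h.trans (hβ u hu).symm)
      exact hc.1 ((this ▸ ha : Anc T r (β u) z).trans hT hz.2.1)
    · have : a = β v := hα.injOn (Set.mem_univ _) (Set.mem_univ _) (h.trans (hβ v hv).symm)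
      exact hc.2 ((this ▸ ha : Anc T r (β v) z).trans hT hz.1)
  have := Finset.card_le_card_of_injOn (s := F) (t := Finset.range (d + 1))
    (fun v => T.dist r (β v)) (fun v _ => by
      have := hd (β v)
      simp only [Finset.coe_range, Set.mem_Iio]
      omega) ?_
  · simpa using this
  · intro u hu v hv huv
    have : β u = β v := by
      rcases hcmp u hu v hv with h | h
      · exact h.eq_of_dist_eq hT huv
      · exact (h.eq_of_dist_eq hT huv.symm).symm
    rw [← hβ u hu, ← hβ v hv, this]

/-- Every edge is a bridge: a walk that avoids the edge from `v` to its successor cannot leave the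
vertices up to `v`. -/
theorem pathGraph_isTree (n : ℕ) : (SimpleGraph.pathGraph (n + 1)).IsTree := by
  refine ⟨SimpleGraph.pathGraph_connected n, ?_⟩
  rw [SimpleGraph.isAcyclic_iff_forall_adj_isBridge]
  intro v w hvw
  wlog hlt : v.val + 1 = w.val generalizing v w
  · rw [Sym2.eq_swap]
    exact this hvw.symm ((SimpleGraph.pathGraph_adj.1 hvw).resolve_left hlt)
  rw [SimpleGraph.isBridge_iff]
  rintro ⟨p⟩
  have key : ∀ {a b : Fin (n + 1)}
      (p : ((SimpleGraph.pathGraph (n + 1)).deleteEdges {s(v, w)}).Walk a b), a ≤ v → b ≤ v := by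
    intro a b p
    induction p with
    | nil => exact id
    | cons h p ih =>
      intro ha
      refine ih ?_
      rw [SimpleGraph.deleteEdges_adj, SimpleGraph.pathGraph_adj] at h
      by_contra hc
      refine h.2 (Set.mem_singleton_iff.2 ?_)
      rw [Sym2.eq_iff]
      refine Or.inl ⟨Fin.ext ?_, Fin.ext ?_⟩ <;> rw [Fin.le_def] at * <;> omega
  have := key p le_rfl
  rw [Fin.le_def] at this
  omega

/-- A set of size `d + 1` is an elimination set of depth at most `d`. -/
theorem isElimSet_of_card {V : Type*} {G : SimpleGraph V} {X : Finset V} {d : ℕ}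
    (hX : X.card = d + 1) : IsElimSet G (X : Set V) d := by
  have hT := pathGraph_isTree d
  -- The tree is a path rooted at its end `0`. Since walks skip no vertex between their ends, any
  -- two nodes are comparable and the separation condition is vacuous.
  have hmem : ∀ {u y : Fin (d + 1)} (p : (SimpleGraph.pathGraph (d + 1)).Walk u y) (x),
      u ≤ x → x ≤ y → x ∈ p.support := by
    intro u y p
    induction p with
    | nil => exact fun x h h' => by simp [le_antisymm h' h]
    | cons h p ih =>
      rename_i u v w
      intro x hux hxw
      by_cases hx : x = u
      · simp [hx]
      · rw [SimpleGraph.Walk.support_cons]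
        refine List.mem_cons_of_mem _ (ih x ?_ hxw)
        rw [SimpleGraph.pathGraph_adj] at h
        have : u.val ≠ x.val := fun h => hx (Fin.ext h.symm)
        rw [Fin.le_def] at *
        omega
  have hanc : ∀ x y : Fin (d + 1), x ≤ y → Anc (SimpleGraph.pathGraph (d + 1)) 0 x y := by
    intro x y hxy
    obtain ⟨p, hp, -⟩ := hT.existsUnique_path 0 y
    exact ⟨p, hp, hmem p x (Fin.zero_le _) hxy⟩
  let e := (Fintype.equivFinOfCardEq (α := X) (by simpa using hX)).symm
  refine ⟨Fin (d + 1), SimpleGraph.pathGraph (d + 1), 0, fun i => e i, hT, fun v => ?_, ?_,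
    fun x y v hxy hyx _ => ?_⟩
  · obtain ⟨p, hp, -⟩ := hT.existsUnique_path 0 v
    have h1 := SimpleGraph.dist_le p
    have h2 := hp.length_lt
    simp only [Fintype.card_fin] at h2
    omega
  · refine ⟨fun i _ => (e i).2, fun i _ j _ h => e.injective (Subtype.ext h), fun v hv => ?_⟩
    exact ⟨e.symm ⟨v, hv⟩, Set.mem_univ _, by simp⟩
  · rcases le_total x y with h | h
    · exact absurd (hanc x y h) hxy
    · exact absurd (hanc y x h) hyx

/-! ### From hitting sets to elimination distances -/

/-- Vertices of the graph that encodes a hitting set instance with elements `E` and sets `A`. The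
set `a` is represented by the copies `row a c`, the element `e` by a path `el e, mid e, leaf e`. -/
inductive GadgetVertex (E A C : Type)
  | el (e : E)
  | mid (e : E)
  | leaf (e : E)
  | row (a : A) (c : C)

section Gadget

open GadgetVertex

variable {E A C V : Type}

/-- The rows form a clique, and `R a e` means that the set `a` contains the element `e`. -/
def gadgetAdj (R : A → E → Prop) : GadgetVertex E A C → GadgetVertex E A C → Prop
  | .row a c, .row a' c' => ¬ (a = a' ∧ c = c')
  | .row a _, .el e => R a e
  | .el e, .row a _ => R a e
  | .el e, .mid e' => e = e'
  | .mid e, .el e' => e = e'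
  | .mid e, .leaf e' => e = e'
  | .leaf e, .mid e' => e = e'
  | _, _ => False

variable {R : A → E → Prop} {G : SimpleGraph V} {f : GadgetVertex E A C ≃ V}

theorem eq_mid_of_gadgetAdj_leaf {e : E} {x : GadgetVertex E A C} (h : gadgetAdj R (leaf e) x) :
    x = mid e :=
  match x, h with
  | .mid _, h => congrArg mid (Eq.symm h)

theorem eq_or_eq_of_gadgetAdj_mid {e : E} {x : GadgetVertex E A C} (h : gadgetAdj R (mid e) x) :
    x = el e ∨ x = leaf e :=
  match x, h with
  | .el _, h => Or.inl (congrArg el (Eq.symm h))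
  | .leaf _, h => Or.inr (congrArg leaf (Eq.symm h))

/-- Removing leaves does not disconnect: the rows form a clique, by `hR` every `el e` is attached to
it, and the rest of each element path hangs on `el e`. -/
theorem gadget_connected (hG : ∀ x y, G.Adj (f x) (f y) ↔ gadgetAdj R x y) [Nonempty A] [Nonempty C]
    (hR : ∀ e, ∃ a, R a e) {S : Set V} {F : Finset E}
    (hS : ∀ x, f x ∈ S ↔ ∀ e ∈ F, x ≠ .leaf e) : (G.induce S).Connected := by
  obtain ⟨a₀⟩ := ‹Nonempty A›
  obtain ⟨c₀⟩ := ‹Nonempty C›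
  have hrow : ∀ a c, f (row a c) ∈ S := fun a c => (hS _).2 fun e _ => by simp
  have hel : ∀ e, f (el e) ∈ S := fun e => (hS _).2 fun e _ => by simp
  have hmid : ∀ e, f (mid e) ∈ S := fun e => (hS _).2 fun e _ => by simp
  have adj : ∀ {x y : GadgetVertex E A C} (hx : f x ∈ S) (hy : f y ∈ S), gadgetAdj R x y →
      (G.induce S).Reachable ⟨f x, hx⟩ ⟨f y, hy⟩ := fun hx hy h =>
    SimpleGraph.Adj.reachable (by simpa [hG] using h)
  have r1 : ∀ a c, (G.induce S).Reachable ⟨_, hrow a₀ c₀⟩ ⟨_, hrow a c⟩ := by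
    intro a c
    by_cases h : a₀ = a ∧ c₀ = c
    · obtain ⟨rfl, rfl⟩ := h
      exact .refl _
    · exact adj _ _ h
  have r2 : ∀ e, (G.induce S).Reachable ⟨_, hrow a₀ c₀⟩ ⟨_, hel e⟩ := by
    intro e
    obtain ⟨a, ha⟩ := hR e
    exact (r1 a c₀).trans (adj _ _ ha)
  have r3 : ∀ e, (G.induce S).Reachable ⟨_, hrow a₀ c₀⟩ ⟨_, hmid e⟩ := fun e =>
    (r2 e).trans (adj _ _ (show gadgetAdj R (el e) (mid e) from rfl))
  have key : ∀ x (hx : f x ∈ S), (G.induce S).Reachable ⟨_, hrow a₀ c₀⟩ ⟨f x, hx⟩ := by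
    rintro (e | e | e | ⟨a, c⟩) hx
    · exact r2 e
    · exact r3 e
    · exact (r3 e).trans (adj _ _ (show gadgetAdj R (mid e) (leaf e) from rfl))
    · exact r1 a c
  have key' : ∀ v : S, (G.induce S).Reachable ⟨_, hrow a₀ c₀⟩ v := by
    rintro ⟨v, hv⟩
    obtain ⟨x, rfl⟩ := f.surjective v
    exact key x hv
  have : Nonempty S := ⟨⟨_, hrow a₀ c₀⟩⟩
  exact ⟨fun v w => (key' v).symm.trans (key' w)⟩

/-- Deleting the leaves of a hitting set yields a model. -/
theorem gadget_models (hG : ∀ x y, G.Adj (f x) (f y) ↔ gadgetAdj R x y) {S : Set V} {F : Finset E}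
    (hS : ∀ x, f x ∈ S ↔ ∀ e ∈ F, x ≠ .leaf e) (hF : ∀ a, ∃ e ∈ F, R a e) :
    Models (G.induce S) nearLeafSentence := by
  rw [models_nearLeafSentence]
  have hel : ∀ e, f (el e) ∈ S := fun e => (hS _).2 fun e _ => by simp
  have hmid : ∀ e, f (mid e) ∈ S := fun e => (hS _).2 fun e _ => by simp
  have hleaf : ∀ e, e ∉ F → f (leaf e) ∈ S := fun e he => (hS _).2 fun e' he' h => by
    cases h
    exact he he'
  have adj : ∀ {x y : GadgetVertex E A C} (hx : f x ∈ S) (hy : f y ∈ S), gadgetAdj R x y →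
      (G.induce S).Adj ⟨f x, hx⟩ ⟨f y, hy⟩ := fun hx hy h => by simpa [hG] using h
  have low_leaf : ∀ e (he : f (leaf e) ∈ S), Low (G.induce S) ⟨_, he⟩ := by
    rintro e he ⟨v, hv⟩ ⟨w, hw⟩ h1 h2
    obtain ⟨x, rfl⟩ := f.surjective v
    obtain ⟨y, rfl⟩ := f.surjective w
    simp only [SimpleGraph.comap_adj, Function.Embedding.subtype_apply, hG] at h1 h2
    simp only [eq_mid_of_gadgetAdj_leaf h1, eq_mid_of_gadgetAdj_leaf h2]
  have low_mid : ∀ e ∈ F, Low (G.induce S) ⟨_, hmid e⟩ := by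
    rintro e he ⟨v, hv⟩ ⟨w, hw⟩ h1 h2
    obtain ⟨x, rfl⟩ := f.surjective v
    obtain ⟨y, rfl⟩ := f.surjective w
    have hx := (hS x).1 hv e he
    have hy := (hS y).1 hw e he
    simp only [SimpleGraph.comap_adj, Function.Embedding.subtype_apply, hG] at h1 h2
    simp only [(eq_or_eq_of_gadgetAdj_mid h1).resolve_right hx,
      (eq_or_eq_of_gadgetAdj_mid h2).resolve_right hy]
  rintro ⟨u, hu⟩
  obtain ⟨x, rfl⟩ := f.surjective u
  match x, hu with
  | .row a c, hu =>
    obtain ⟨e, he, hae⟩ := hF a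
    exact ⟨⟨_, hmid e⟩, Or.inr (Or.inr ⟨⟨_, hel e⟩, adj _ _ hae,
      adj _ _ (show gadgetAdj R (el e) (mid e) from rfl)⟩), low_mid e he⟩
  | .el e, hu =>
    by_cases he : e ∈ F
    · exact ⟨⟨_, hmid e⟩, Or.inr (Or.inl (adj _ _ (show gadgetAdj R (el e) (mid e) from rfl))),
        low_mid e he⟩
    · exact ⟨⟨_, hleaf e he⟩, Or.inr (Or.inr ⟨⟨_, hmid e⟩,
        adj _ _ (show gadgetAdj R (el e) (mid e) from rfl),
        adj _ _ (show gadgetAdj R (mid e) (leaf e) from rfl)⟩), low_leaf e _⟩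
  | .mid e, hu =>
    by_cases he : e ∈ F
    · exact ⟨⟨_, hmid e⟩, Or.inl rfl, low_mid e he⟩
    · exact ⟨⟨_, hleaf e he⟩, Or.inr (Or.inl
        (adj _ _ (show gadgetAdj R (mid e) (leaf e) from rfl))), low_leaf e _⟩
  | .leaf e, hu => exact ⟨⟨_, hu⟩, Or.inl rfl, low_leaf e hu⟩

/-- In an induced subgraph that models the sentence and contains enough rows, every set is hit by an
element whose leaf is missing. -/
theorem exists_of_gadget_models (hG : ∀ x y, G.Adj (f x) (f y) ↔ gadgetAdj R x y)
    (hR : ∀ e, ∃ a, R a e) {S : Set V}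
    (h3 : ∀ a (x : GadgetVertex E A C), ∃ c c', c ≠ c' ∧ x ≠ row a c ∧ x ≠ row a c' ∧
      f (row a c) ∈ S ∧ f (row a c') ∈ S)
    (hm : Models (G.induce S) nearLeafSentence) (a : A) (c : C) (hc : f (row a c) ∈ S) :
    ∃ e, R a e ∧ f (el e) ∈ S ∧ f (mid e) ∈ S ∧ f (leaf e) ∉ S := by
  rw [models_nearLeafSentence] at hm
  have eq_of_low : ∀ {z x y : GadgetVertex E A C} (hz : f z ∈ S), Low (G.induce S) ⟨f z, hz⟩ →
      f x ∈ S → f y ∈ S → gadgetAdj R z x → gadgetAdj R z y → x = y := by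
    intro z x y hz hl hx hy h1 h2
    have := hl ⟨f x, hx⟩ ⟨f y, hy⟩ (by simpa [hG] using h1) (by simpa [hG] using h2)
    simpa using this
  obtain ⟨⟨v, hv⟩, hn, hl⟩ := hm ⟨f (row a c), hc⟩
  obtain ⟨z, rfl⟩ := f.surjective v
  have hn' : row a c = z ∨ gadgetAdj R (row a c) z ∨
      ∃ y, f y ∈ S ∧ gadgetAdj R (row a c) y ∧ gadgetAdj R y z := by
    rcases hn with h | h | ⟨⟨w, hw⟩, h1, h2⟩
    · exact Or.inl (by simpa using h)
    · exact Or.inr (Or.inl (by simpa [hG] using h))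
    · obtain ⟨y, rfl⟩ := f.surjective w
      exact Or.inr (Or.inr ⟨y, hw, by simpa [hG] using h1, by simpa [hG] using h2⟩)
  match z, hv, hl, hn' with
  | .row a' c', hv, hl, _ =>
    -- A row keeps two further copies of its own set as neighbours, so its degree is at least two.
    obtain ⟨c₁, c₂, hne, h1, h2, m1, m2⟩ := h3 a' (row a' c')
    have := eq_of_low hv hl m1 m2 (fun h => h1 (by rw [h.2])) (fun h => h2 (by rw [h.2]))
    exact absurd (by simpa using this) hne
  | .el e, hv, hl, _ =>
    obtain ⟨a', ha'⟩ := hR e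
    -- Two copies of a set that contains `e` survive, so `el e` has degree at least two as well.
    obtain ⟨c₁, c₂, hne, h1, h2, m1, m2⟩ := h3 a' (el e)
    have := eq_of_low hv hl m1 m2 ha' ha'
    exact absurd (by simpa using this) hne
  | .mid e, hv, hl, hn' =>
    rcases hn' with h | h | ⟨y, hy, h1, h2⟩
    · cases h
    · exact h.elim
    · match y, hy, h1, h2 with
      | .el e', hy, h1, h2 =>
        obtain rfl : e' = e := h2
        refine ⟨e', h1, hy, hv, fun hleaf => ?_⟩
        have := eq_of_low (x := el e') (y := leaf e') hv hl hy hleaf rfl rfl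
        cases this
  -- A leaf is at distance at least three from every row.
  | .leaf e, hv, hl, hn' =>
    rcases hn' with h | h | ⟨y, hy, h1, h2⟩
    · cases h
    · exact h.elim
    · match y, h1, h2 with
      | .el e', h1, h2 => exact h2.elim

/-- Of the `K + 3` copies of `a`, at most `K` are deleted and at most one is `x`; two are left. -/
theorem exists_rows {K : ℕ} [Finite C] (hC : K + 3 ≤ Nat.card C) {S : Set V} (D : Finset V)
    (hD : D.card ≤ K)
    (hS : ∀ a c, f (row a c) ∉ D → f (row a c) ∈ S) (a : A) (x : GadgetVertex E A C) :
    ∃ c c', c ≠ c' ∧ x ≠ row a c ∧ x ≠ row a c' ∧ f (row a c) ∈ S ∧ f (row a c') ∈ S := by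
  classical
  have := Fintype.ofFinite C
  rw [Nat.card_eq_fintype_card] at hC
  let B : Finset C := Finset.univ.filter fun c => f (row a c) ∈ insert (f x) D
  have hB : B.card ≤ K + 1 := by
    refine le_trans ?_ ((Finset.card_insert_le (f x) D).trans (Nat.add_le_add_right hD 1))
    refine Finset.card_le_card_of_injOn (fun c => f (row a c)) (fun c hc => ?_) fun c _ c' _ h => ?_
    · exact (Finset.mem_filter.1 hc).2
    · simpa using h
  have h1 : 1 < Bᶜ.card := by
    rw [Finset.card_compl]
    omega
  obtain ⟨c, hc, c', hc', hne⟩ := Finset.one_lt_card.1 h1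
  simp only [B, Finset.mem_compl, Finset.mem_filter, Finset.mem_univ, true_and,
    Finset.mem_insert, not_or, f.injective.eq_iff] at hc hc'
  exact ⟨c, c', hne, Ne.symm hc.1, Ne.symm hc'.1, hS _ _ hc.2, hS _ _ hc'.2⟩

/-- The invariant for lower bounds: from the part of the graph that contains the rows, only
vertices in a small set have been deleted. -/
def Reduced (G : SimpleGraph V) (f : GadgetVertex E A C ≃ V) (K : ℕ) (S : Finset V) (j : ℕ) : Prop :=
  ∃ D : Finset V, D.card + j ≤ K ∧ (∀ a c, f (row a c) ∉ D → f (row a c) ∈ S) ∧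
    ∀ v ∈ S, ∀ w, G.Adj v w → w ∈ S ∨ w ∈ D

/-- Each set still has a row, and this row needs a vertex `mid e` without its leaf. As `mid e` is
present, the invariant says that the leaf was deleted at a cost, not separated for free. So the
elements with a leaf in `D` form a hitting set. -/
theorem exists_hitting_of_reduced [Fintype V] (hG : ∀ x y, G.Adj (f x) (f y) ↔ gadgetAdj R x y)
    (hR : ∀ e, ∃ a, R a e) {K : ℕ} [Finite C] (hC : K + 3 ≤ Nat.card C) {S : Finset V} {j : ℕ}
    (hS : Reduced G f K S j) (hm : Models (sub G S) nearLeafSentence) :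
    ∃ F : Finset E, F.card ≤ K ∧ ∀ a, ∃ e ∈ F, R a e := by
  classical
  obtain ⟨D, hD, hrow, hcl⟩ := hS
  have h3 := exists_rows (S := (S : Set V)) hC D (by omega) hrow
  let F : Finset E := (D.image f.symm).biUnion fun x => match x with
    | .leaf e => {e}
    | _ => ∅
  refine ⟨F, ?_, fun a => ?_⟩
  · refine Finset.card_biUnion_le.trans ?_
    refine (Finset.sum_le_card_nsmul _ _ 1 fun x _ => ?_).trans ?_
    · cases x <;> simp
    · have := Finset.card_image_le (s := D) (f := f.symm)
      simp only [smul_eq_mul, mul_one]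
      omega
  · rcases isEmpty_or_nonempty (GadgetVertex E A C) with hE | ⟨⟨x⟩⟩
    · have : Nonempty C := by
        by_contra hne
        rw [not_nonempty_iff] at hne
        simp at hC
      obtain ⟨c⟩ := this
      exact hE.elim (row a c)
    obtain ⟨c, -, -, -, -, hc, -⟩ := h3 a x
    obtain ⟨e, hae, hel, hmid, hleaf⟩ := exists_of_gadget_models hG hR h3 hm a c hc
    refine ⟨e, ?_, hae⟩
    rcases hcl _ hmid (f (leaf e)) ((hG _ _).2 rfl) with h | h
    · exact absurd h hleaf
    · exact Finset.mem_biUnion.2 ⟨leaf e, Finset.mem_image.2 ⟨_, h, by simp⟩, by simp⟩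

open Classical in
theorem Reduced.erase {K : ℕ} {S : Finset V} {j : ℕ} {v : V} (h : Reduced G f K S (j + 1)) :
    Reduced G f K (S.erase v) j := by
  obtain ⟨D, hD, hrow, hcl⟩ := h
  refine ⟨insert v D, ?_, fun a c hc => ?_, fun w hw u hu => ?_⟩
  · have := Finset.card_insert_le v D
    omega
  · rw [Finset.mem_insert, not_or] at hc
    exact Finset.mem_erase.2 ⟨hc.1, hrow a c hc.2⟩
  · by_cases huv : u = v
    · exact Or.inr (by simp [huv])
    · exact (hcl w (Finset.mem_of_mem_erase hw) u hu).imp (fun h => Finset.mem_erase.2 ⟨huv, h⟩)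
        Finset.mem_insert_of_mem

theorem Reduced.exists_row {K : ℕ} [Finite C] (hC : K + 3 ≤ Nat.card C) [Nonempty A] {S : Finset V}
    {j : ℕ} (h : Reduced G f K S j) : ∃ a c, f (row a c) ∈ S := by
  obtain ⟨D, hD, hrow, -⟩ := h
  have hC' : Nonempty C := by
    by_contra hne
    rw [not_nonempty_iff] at hne
    simp at hC
  obtain ⟨a⟩ := ‹Nonempty A›
  obtain ⟨c⟩ := hC'
  obtain ⟨c, -, -, -, -, hc, -⟩ := exists_rows (S := (S : Set V)) hC D (by omega) hrow a (row a c)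
  exact ⟨a, c, hc⟩

/-- The surviving rows form a clique and lie in one component. Passing to it needs no new vertices
in `D`, since neighbours of the component within `S` belong to it. -/
theorem Reduced.comp (hG : ∀ x y, G.Adj (f x) (f y) ↔ gadgetAdj R x y) {K : ℕ} {S : Finset V}
    {j : ℕ} (h : Reduced G f K S j) {a : A} {c : C} (hac : f (row a c) ∈ S) :
    Reduced G f K (comp G S ⟨_, hac⟩) j := by
  obtain ⟨D, hD, hrow, hcl⟩ := h
  refine ⟨D, hD, fun a' c' hc => mem_comp.2 ⟨hrow a' c' hc, ?_⟩, fun w hw u hu => ?_⟩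
  · by_cases h : a = a' ∧ c = c'
    · obtain ⟨rfl, rfl⟩ := h
      exact .refl _
    · exact SimpleGraph.Adj.reachable ((hG _ _).2 h)
  · obtain ⟨hwS, hr⟩ := mem_comp.1 hw
    refine (hcl w hwS u hu).imp_left fun huS => mem_comp.2 ⟨huS, hr.trans ?_⟩
    exact SimpleGraph.Adj.reachable (by simpa using hu)

/-- A bound for `ed^conn` and `ed^prop`, by deleting the leaves of a hitting set one by one. -/
theorem gadget_upper [Fintype V] (hG : ∀ x y, G.Adj (f x) (f y) ↔ gadgetAdj R x y) [Nonempty A] [Nonempty C]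
    (hR : ∀ e, ∃ a, R a e) {F : Finset E} (hF : ∀ a, ∃ e ∈ F, R a e) {d : Finset V → ℕ}
    (h0 : ∀ S, (sub G S).Connected → Models (sub G S) nearLeafSentence → d S = 0)
    (h1 : ∀ S v S', (sub G S).Connected → v ∈ S → (∀ w, w ∈ S' ↔ w ∈ S ∧ w ≠ v) → d S ≤ 1 + d S') :
    d Finset.univ ≤ F.card := by
  classical
  -- `F'` is the set of elements whose leaves are still to be deleted; those of `F \ F'` are gone.
  have key : ∀ F' : Finset E, F' ⊆ F → ∀ S : Finset V,
      (∀ x, f x ∈ S ↔ ∀ e ∈ F \ F', x ≠ leaf e) → d S ≤ F'.card := by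
    intro F'
    induction F' using Finset.induction_on with
    | empty =>
      intro _ S hS
      rw [Finset.sdiff_empty] at hS
      rw [h0 S (gadget_connected hG hR hS) (gadget_models hG hS hF)]
      exact Nat.zero_le _
    | insert e F' he ih =>
      intro hsub S hS
      rw [Finset.insert_subset_iff] at hsub
      rw [Finset.card_insert_of_notMem he]
      refine (h1 S (f (leaf e)) (S.erase (f (leaf e))) (gadget_connected hG hR hS) ?_
        fun w => by simp [and_comm]).trans ?_
      · rw [hS]
        rintro e' he' h
        cases h
        simp at he'
      · have := ih hsub.2 (S.erase (f (leaf e))) fun x => ?_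
        · omega
        rw [Finset.mem_erase, hS, Ne, f.injective.eq_iff]
        constructor
        · rintro ⟨hx, h⟩ e' he'
          by_cases hee : e' = e
          · rwa [hee]
          · exact h e' (by simp_all)
        · intro h
          exact ⟨h e (by simp [hsub.1, he]), fun e' he' => h e' (by simp_all)⟩
  exact key F subset_rfl Finset.univ fun x => by simp

/-- The leaves of a hitting set, in any order, form a branch; an elimination set needs no further
structure. -/
theorem gadget_depth_upper (hG : ∀ x y, G.Adj (f x) (f y) ↔ gadgetAdj R x y) {F : Finset E}
    (hF : ∀ a, ∃ e ∈ F, R a e) : edDepth nearLeafSentence G ≤ F.card := by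
  classical
  let X : Finset V := F.image fun e => f (leaf e)
  have hX : X.card = F.card := Finset.card_image_of_injective _ fun e e' h => by simpa using h
  refine iInf₂_le F.card ⟨(X : Set V), ?_, gadget_models hG (F := F) (fun x => ?_) hF⟩
  · rcases Nat.eq_zero_or_pos F.card with h | h
    · left
      rw [h, Finset.card_eq_zero] at hX
      simp [hX]
    · exact Or.inr ⟨F.card - 1, by omega, isElimSet_of_card (by omega)⟩
  · simp only [X, Finset.coe_image, Set.mem_compl_iff, Set.mem_image, Finset.mem_coe, not_exists,
      not_and, f.injective.eq_iff]
    exact forall₂_congr fun e _ => ne_comm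

/-- The elimination set `X` may be much larger than `K`, but its subsets that are pairwise linked
outside of `X` are not. The rows in `X` are linked by clique edges, so enough rows survive. The
leaves in `X` whose paths reach surviving rows through vertices outside of `X` are linked along
these paths, and their elements form the hitting set. -/
theorem gadget_depth_lower [Fintype V] (hG : ∀ x y, G.Adj (f x) (f y) ↔ gadgetAdj R x y)
    (hR : ∀ e, ∃ a, R a e) {K : ℕ} [Finite C] (hC : K + 3 ≤ Nat.card C) [Finite E]
    (h : edDepth nearLeafSentence G ≤ K) : ∃ F : Finset E, F.card ≤ K ∧ ∀ a, ∃ e ∈ F, R a e := by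
  classical
  obtain ⟨m, hmK, X, hX, hm⟩ : ∃ m ≤ K, ∃ X : Set V, DepthLT G X m ∧
      Models (G.induce Xᶜ) nearLeafSentence := by
    by_contra! hc
    have : ((K + 1 : ℕ) : ℕ∞) ≤ edDepth nearLeafSentence G := by
      refine le_iInf₂ fun m hm => ?_
      obtain ⟨X, hX, hmod⟩ := hm
      by_contra hlt
      exact hc m (by
        have : m < K + 1 := by exact_mod_cast not_le.1 hlt
        omega) X hX hmod
    have := this.trans h
    norm_cast at this
    omega
  have hlinked : ∀ F : Finset V, (∀ v ∈ F, v ∈ X) →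
      (∀ u ∈ F, ∀ v ∈ F, u ≠ v → ∃ p : G.Walk u v, ∀ w ∈ p.support, w ∈ X → w = u ∨ w = v) →
      F.card ≤ K := by
    intro F hFX hlink
    rcases hX with rfl | ⟨d, hd, hX⟩
    · rw [Finset.eq_empty_of_forall_notMem (s := F) fun v hv => hFX v hv]
      simp
    · have := card_le_of_linked hX F hFX hlink
      omega
  have := Fintype.ofFinite E
  have hadj : ∀ {x y : GadgetVertex E A C}, gadgetAdj R x y → G.Adj (f x) (f y) := (hG _ _).2
  have h3 := exists_rows (f := f) (S := Xᶜ) hC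
    (Finset.univ.filter fun v => v ∈ X ∧ ∃ a c, v = f (row a c)) (hlinked _ (fun v hv => (Finset.mem_filter.1 hv).2.1) (by
      intro u hu v hv huv
      obtain ⟨-, -, a, c, rfl⟩ := Finset.mem_filter.1 hu
      obtain ⟨-, -, a', c', rfl⟩ := Finset.mem_filter.1 hv
      have : G.Adj (f (row a c)) (f (row a' c')) := hadj fun h => huv (by rw [h.1, h.2])
      exact ⟨.cons this .nil, fun w hw _ => by simpa using hw⟩)) (by
      intro a c hc hX
      exact hc (Finset.mem_filter.2 ⟨Finset.mem_univ _, hX, a, c, rfl⟩))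
  let F : Finset E := Finset.univ.filter fun e => ∃ a c, R a e ∧ f (row a c) ∉ X ∧
    f (el e) ∉ X ∧ f (mid e) ∉ X ∧ f (leaf e) ∈ X
  refine ⟨F, ?_, fun a => ?_⟩
  · have hcard : (F.image fun e => f (leaf e)).card = F.card :=
      Finset.card_image_of_injective _ fun e e' h => by simpa using h
    rw [← hcard]
    refine hlinked _ (fun v hv => ?_) ?_
    · obtain ⟨e, he, rfl⟩ := Finset.mem_image.1 hv
      obtain ⟨-, -, -, -, -, -, -, h⟩ := Finset.mem_filter.1 he
      exact h
    intro u hu v hv huv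
    obtain ⟨e, he, rfl⟩ := Finset.mem_image.1 hu
    obtain ⟨e', he', rfl⟩ := Finset.mem_image.1 hv
    obtain ⟨-, a, c, hae, h1, h2, h3, h4⟩ := Finset.mem_filter.1 he
    obtain ⟨-, a', c', hae', h1', h2', h3', h4'⟩ := Finset.mem_filter.1 he'
    have w1 : G.Adj (f (leaf e)) (f (mid e)) := hadj rfl
    have w2 : G.Adj (f (mid e)) (f (el e)) := hadj rfl
    have w3 : G.Adj (f (el e)) (f (row a c)) := hadj hae
    have w1' : G.Adj (f (mid e')) (f (leaf e')) := hadj rfl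
    have w2' : G.Adj (f (el e')) (f (mid e')) := hadj rfl
    have w3' : G.Adj (f (row a' c')) (f (el e')) := hadj hae'
    by_cases hrow : a = a' ∧ c = c'
    · obtain ⟨rfl, rfl⟩ := hrow
      refine ⟨.cons w1 (.cons w2 (.cons w3 (.cons w3' (.cons w2' (.cons w1' .nil))))), ?_⟩
      simp only [SimpleGraph.Walk.support_cons, SimpleGraph.Walk.support_nil, List.mem_cons,
        List.not_mem_nil, or_false]
      rintro w (rfl | rfl | rfl | rfl | rfl | rfl | rfl) hw <;> first | contradiction | simp
    · have w4 : G.Adj (f (row a c)) (f (row a' c')) := hadj hrow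
      refine ⟨.cons w1 (.cons w2 (.cons w3 (.cons w4 (.cons w3' (.cons w2' (.cons w1' .nil)))))), ?_⟩
      simp only [SimpleGraph.Walk.support_cons, SimpleGraph.Walk.support_nil, List.mem_cons,
        List.not_mem_nil, or_false]
      rintro w (rfl | rfl | rfl | rfl | rfl | rfl | rfl | rfl) hw <;> first | contradiction | simp
  · have hC' : Nonempty C := by
      by_contra hne
      rw [not_nonempty_iff] at hne
      simp at hC
    obtain ⟨c₀⟩ := hC'
    obtain ⟨c, -, -, -, -, hc, -⟩ := h3 a (row a c₀)
    obtain ⟨e, hae, hel, hmid, hleaf⟩ := exists_of_gadget_models hG hR h3 hm a c hc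
    exact ⟨e, Finset.mem_filter.2 ⟨Finset.mem_univ _, a, c, hae, hc, hel, hmid, by simpa using hleaf⟩,
      hae⟩

/-- The gadget graph has elimination distance at most `K` if and only if there is a hitting set of
size at most `K`. -/
theorem gadget_ed_le_iff [Fintype V] (hG : ∀ x y, G.Adj (f x) (f y) ↔ gadgetAdj R x y)
    (hR : ∀ e, ∃ a, R a e) {K : ℕ} [Finite C] (hC : K + 3 ≤ Nat.card C) [Finite E] [Nonempty A]
    (star : Variant) :
    ed nearLeafSentence G star ≤ K ↔ ∃ F : Finset E, F.card ≤ K ∧ ∀ a, ∃ e ∈ F, R a e := by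
  classical
  have hC' : Nonempty C := by
    by_contra hne
    rw [not_nonempty_iff] at hne
    simp at hC
  have huniv : Reduced G f K Finset.univ K := ⟨∅, by simp, by simp, by simp⟩
  have hne : ∀ S j, Reduced G f K S j → S.Nonempty := fun S j h => by
    obtain ⟨a, c, hac⟩ := h.exists_row hC
    exact ⟨_, hac⟩
  have hcomp : ∀ S j, Reduced G f K S j → ∃ v, Reduced G f K (comp G S v) j := fun S j h => by
    obtain ⟨a, c, hac⟩ := h.exists_row hC
    exact ⟨_, h.comp hG hac⟩
  constructor
  · intro h
    cases star with
    | conn =>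
      obtain ⟨S, j, hS, hm⟩ := exists_models_of_edConn_le hne
        (fun S j v h _ => by convert h.erase) hcomp huniv (Nat.cast_le.1 h)
      exact exists_hitting_of_reduced hG hR hC hS hm
    | prop =>
      obtain ⟨S, j, hS, hm⟩ := exists_models_of_edProp_le hne
        (fun S j v h _ => by convert h.erase) hcomp huniv (Nat.cast_le.1 h)
      exact exists_hitting_of_reduced hG hR hC hS hm
    | depth => exact gadget_depth_lower hG hR hC h
  · rintro ⟨F, hFK, hF⟩
    have hFK' : (F.card : ℕ∞) ≤ K := by exact_mod_cast hFK
    refine le_trans ?_ hFK'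
    cases star with
    | conn =>
      have := gadget_upper hG hR hF (d := edConn nearLeafSentence G)
        (fun S hc hm => edConn_eq_zero hc hm) (fun S v S' hc hv hS' => by
          obtain rfl : S' = S.erase v := by ext w; simp [hS', and_comm]
          convert edConn_le_succ hc hv)
      exact Nat.cast_le.2 this
    | prop =>
      have := gadget_upper hG hR hF (d := edProp nearLeafSentence G)
        (fun S hc hm => edProp_eq_zero hm) (fun S v S' hc hv hS' => by
          obtain rfl : S' = S.erase v := by ext w; simp [hS', and_comm]
          convert edProp_le_succ hc hv)
      exact Nat.cast_le.2 this
    | depth => exact gadget_depth_upper hG hF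

end Gadget

/-! ### Evaluation of circuits from partial information -/

/-- A Boolean circuit whose nodes are the numbers below `n`. -/
structure Net where
  n : ℕ
  isAnd : ℕ → Bool
  wire : ℕ → ℕ → Prop
  lt_of_wire : ∀ {j i}, wire j i → j < i
  lt_n_of_wire : ∀ {j i}, wire j i → i < n

namespace Net

open Classical in
noncomputable def children (N : Net) (i : ℕ) : Finset ℕ :=
  (Finset.range N.n).filter fun j => N.wire j i

noncomputable def indeg (N : Net) (i : ℕ) : ℕ := (N.children i).card

variable {N : Net} {i j l : ℕ} {v : ℕ → Bool}

@[simp]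
theorem mem_children : j ∈ N.children i ↔ N.wire j i := by
  simp only [children, Finset.mem_filter, Finset.mem_range, and_iff_right_iff_imp]
  exact fun h => (N.lt_of_wire h).trans (N.lt_n_of_wire h)

theorem indeg_eq_zero : N.indeg i = 0 ↔ ∀ j, ¬ N.wire j i := by
  simp [indeg, Finset.eq_empty_iff_forall_notMem]

/-- `v` assigns consistent values to the nodes. For gates with at least two inputs, `isAnd i` is
the value that is attained if and only if it is attained by all inputs. -/
def IsVal (N : Net) (v : ℕ → Bool) : Prop :=
  ∀ i < N.n, (N.indeg i = 1 → ∀ j, N.wire j i → v i = !v j) ∧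
    (2 ≤ N.indeg i → (v i = N.isAnd i ↔ ∀ j, N.wire j i → v j = N.isAnd i))

/-- Conjunctions and disjunctions are treated at once: the value `isAnd i` of a gate is universal
over its inputs, the opposite value is existential. -/
theorem IsVal.eq_iff_exists (hv : N.IsVal v) (hi : i < N.n) (h2 : 2 ≤ N.indeg i) {b : Bool}
    (hb : N.isAnd i ≠ b) : v i = b ↔ ∃ j, N.wire j i ∧ v j = b := by
  have := (hv i hi).2 h2
  have hb' : N.isAnd i = !b := by cases b <;> simpa using hb
  rw [hb'] at this
  rw [← not_iff_not]
  simpa [Bool.eq_not] using this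

/-- The assignments to the inputs extend to valuations. -/
theorem exists_isVal (N : Net) (S : ℕ → Bool) :
    ∃ v, N.IsVal v ∧ ∀ i, N.indeg i = 0 → v i = S i := by
  classical
  have key : ∀ m, ∃ v : ℕ → Bool, ∀ i < m, (N.indeg i = 0 → v i = S i) ∧
      (N.indeg i = 1 → ∀ j, N.wire j i → v i = !v j) ∧
      (2 ≤ N.indeg i → (v i = N.isAnd i ↔ ∀ j, N.wire j i → v j = N.isAnd i)) := by
    intro m
    induction m with
    | zero => exact ⟨S, by simp⟩
    | succ m ih =>
      obtain ⟨v, hv⟩ := ih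
      let b : Bool := if N.indeg m = 0 then S m else if N.indeg m = 1 then
        decide (∀ j, N.wire j m → v j = false) else
        if ∀ j, N.wire j m → v j = N.isAnd m then N.isAnd m else !N.isAnd m
      have hold : ∀ j < m, Function.update v m b j = v j := fun j hj =>
        Function.update_of_ne hj.ne _ _
      refine ⟨Function.update v m b, fun i hi => ?_⟩
      rcases Nat.lt_succ_iff_lt_or_eq.1 hi with hi | rfl
      · rw [hold i hi]
        obtain ⟨h0, h1, h2⟩ := hv i hi
        refine ⟨h0, fun h j hj => ?_, fun h => (h2 h).trans (forall₂_congr fun j hj => ?_)⟩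
        · rw [hold j ((N.lt_of_wire hj).trans hi)]
          exact h1 h j hj
        · rw [hold j ((N.lt_of_wire hj).trans hi)]
      · rw [Function.update_self]
        refine ⟨fun h => by simp [b, h], fun h j hj => ?_, fun h => ?_⟩
        · rw [hold j (N.lt_of_wire hj)]
          obtain ⟨j', hj'⟩ := Finset.card_eq_one.1 h
          have uniq : ∀ k, N.wire k i ↔ k = j' := fun k => by
            rw [← mem_children, hj', Finset.mem_singleton]
          obtain rfl := (uniq j).1 hj
          simp only [b, h, one_ne_zero, if_false, if_true, uniq, forall_eq]
          cases v j <;> rfl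
        · have hb : b = if ∀ j, N.wire j i → v j = N.isAnd i then N.isAnd i else !N.isAnd i := by
            simp only [b, if_neg (show N.indeg i ≠ 0 by omega),
              if_neg (show N.indeg i ≠ 1 by omega)]
          have hcongr : (∀ j, N.wire j i → Function.update v i b j = N.isAnd i) ↔
              ∀ j, N.wire j i → v j = N.isAnd i :=
            forall₂_congr fun j hj => by rw [hold j (N.lt_of_wire hj)]
          rw [hcongr, hb]
          split_ifs with hall
          · simpa using hall
          · simpa using hall
  obtain ⟨v, hv⟩ := key N.n
  refine ⟨fun i => if i < N.n then v i else S i, fun i hi => ⟨fun h j hj => ?_, fun h => ?_⟩,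
    fun i h => ?_⟩
  · simp only [hi, (N.lt_of_wire hj).trans hi, if_true]
    exact (hv i hi).2.1 h j hj
  · simp only [hi, if_true]
    refine ((hv i hi).2.2 h).trans (forall₂_congr fun j hj => ?_)
    rw [if_pos ((N.lt_of_wire hj).trans hi)]
  · dsimp only
    split_ifs with hi
    · exact (hv i hi).1 h
    · rfl

/-- All paths that end in `i` have length at most `δ`. -/
def HeightLE (N : Net) : ℕ → ℕ → Prop
  | 0, i => N.indeg i = 0
  | δ + 1, i => ∀ j, j < N.n → N.wire j i → HeightLE N δ j

/-- The bound `j < N.n` in `HeightLE` follows from the wire; it is there to make the quantifier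
bounded, hence definable. -/
theorem HeightLE.child {δ : ℕ} (h : N.HeightLE (δ + 1) i) (hj : N.wire j i) : N.HeightLE δ j :=
  h j ((N.lt_of_wire hj).trans (N.lt_n_of_wire hj)) hj

theorem HeightLE.succ {δ : ℕ} (h : N.HeightLE δ i) : N.HeightLE (δ + 1) i := by
  induction δ generalizing i with
  | zero => exact fun j _ hj => absurd hj (indeg_eq_zero.1 h j)
  | succ δ ih => exact fun j hjn hj => ih (h j hjn hj)

theorem HeightLE.mono {δ δ' : ℕ} (h : N.HeightLE δ i) (hδ : δ ≤ δ') : N.HeightLE δ' i := by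
  induction hδ with
  | refl => exact h
  | step _ ih => exact ih.succ

theorem heightLE_self (i : ℕ) : N.HeightLE i i := by
  induction i using Nat.strong_induction_on with
  | _ i ih =>
    match i with
    | 0 => exact indeg_eq_zero.2 fun j hj => absurd (N.lt_of_wire hj) (Nat.not_lt_zero j)
    | i + 1 => exact fun j _ hj => (ih j (N.lt_of_wire hj)).mono (Nat.lt_succ_iff.1 (N.lt_of_wire hj))

open Classical in
/-- The maximum number of large gates on a path of length at most `δ` that ends in `i`. -/
noncomputable def weft (N : Net) : ℕ → ℕ → ℕ
  | 0, _ => 0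
  | δ + 1, i => (if 2 < N.indeg i then 1 else 0) + (N.children i).sup (N.weft δ)

theorem weft_of_heightLE {δ δ' : ℕ} (h : N.HeightLE δ i) (hδ : δ ≤ δ') :
    N.weft δ' i = N.weft δ i := by
  induction δ generalizing i δ' with
  | zero =>
    cases δ' with
    | zero => rfl
    | succ δ' =>
      have h0 : N.indeg i = 0 := h
      have : N.children i = ∅ := Finset.card_eq_zero.1 h0
      simp [weft, h0, this]
  | succ δ ih =>
    obtain ⟨δ', rfl⟩ : ∃ k, δ' = k + 1 := ⟨δ' - 1, by omega⟩
    simp only [weft]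
    congr 1
    exact Finset.sup_congr rfl fun j hj => ih (h.child (mem_children.1 hj)) (by omega)

/-- The maximum number of large gates on a path that ends in `i`. -/
noncomputable def wt (N : Net) (i : ℕ) : ℕ := N.weft i i

/-- `weft δ` with constant `δ` unfolds into a fixed arithmetic term, while `wt` suits inductions
along wires. -/
theorem weft_eq_wt {δ : ℕ} (h : N.HeightLE δ i) : N.weft δ i = N.wt i := by
  rw [wt]
  rcases le_total δ i with h' | h'
  · exact (weft_of_heightLE h h').symm
  · exact weft_of_heightLE (heightLE_self i) h'

theorem wt_eq : N.wt i = (if 2 < N.indeg i then 1 else 0) + (N.children i).sup N.wt := by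
  rw [← weft_eq_wt (heightLE_self i).succ, weft]
  congr 1
  exact Finset.sup_congr rfl fun j hj => weft_eq_wt ((heightLE_self i).succ.child (mem_children.1 hj))

theorem wt_le_of_wire (h : N.wire j i) : N.wt j ≤ N.wt i := by
  rw [wt_eq (i := i)]
  exact (Finset.le_sup (mem_children.2 h)).trans (Nat.le_add_left _ _)

theorem wt_lt_of_wire (h : N.wire j i) (hi : 2 < N.indeg i) : N.wt j < N.wt i := by
  rw [wt_eq (i := i), if_pos hi]
  have := Finset.le_sup (f := N.wt) (mem_children.2 h)
  omega

theorem wt_pos (hi : 2 < N.indeg i) : 0 < N.wt i := by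
  rw [wt_eq, if_pos hi]
  omega

/-- `Top l i`: `l` is the first large gate on some backward path from `i`. -/
inductive Top (N : Net) : ℕ → ℕ → Prop
  | refl {i : ℕ} : 2 < N.indeg i → Top N i i
  | step {l j i : ℕ} : ¬ 2 < N.indeg i → N.wire j i → Top N l j → Top N l i

namespace Top

theorem large (h : N.Top l i) : 2 < N.indeg l := by
  induction h with
  | refl h => exact h
  | step _ _ _ ih => exact ih

theorem wt_le (h : N.Top l i) : N.wt l ≤ N.wt i := by
  induction h with
  | refl => exact le_rfl
  | step _ hw _ ih => exact ih.trans (wt_le_of_wire hw)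

theorem heightLE (h : N.Top l i) {δ : ℕ} (hi : N.HeightLE δ i) : N.HeightLE δ l := by
  induction h with
  | refl => exact hi
  | step _ hw _ ih => exact ih (hi.succ.child hw)

theorem lt_n (h : N.Top l i) : l < N.n := by
  have := h.large
  obtain ⟨j, hj⟩ := Finset.card_pos.1 (show 0 < (N.children l).card from by
    rw [indeg] at this
    omega)
  exact N.lt_n_of_wire (mem_children.1 hj)

end Top

/-- The backward search stops at large gates and continues only through gates with at most two
inputs. -/
theorem exists_top_finset {δ : ℕ} (h : N.HeightLE δ i) :
    ∃ F : Finset ℕ, F.card ≤ 2 ^ δ ∧ ∀ l, N.Top l i → l ∈ F := by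
  classical
  induction δ generalizing i with
  | zero =>
    refine ⟨∅, by simp, fun l hl => ?_⟩
    have h0 : N.indeg i = 0 := h
    cases hl with
    | refl h => omega
    | step _ hw _ => exact absurd hw (indeg_eq_zero.1 h0 _)
  | succ δ ih =>
    by_cases hi : 2 < N.indeg i
    · refine ⟨{i}, by simpa using Nat.one_le_two_pow, fun l hl => ?_⟩
      cases hl with
      | refl => simp
      | step h => exact absurd hi h
    · choose! F hF hF' using fun j (hj : N.wire j i) => ih (h.child hj)
      refine ⟨(N.children i).biUnion F, ?_, fun l hl => ?_⟩
      · refine Finset.card_biUnion_le.trans ((Finset.sum_le_card_nsmul _ _ (2 ^ δ) fun j hj =>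
          hF j (mem_children.1 hj)).trans ?_)
        rw [smul_eq_mul, pow_succ, mul_comm]
        exact Nat.mul_le_mul_left _ (by rw [indeg] at hi; omega)
      · cases hl with
        | refl h => exact absurd h hi
        | step _ hw hl => exact Finset.mem_biUnion.2 ⟨_, mem_children.2 hw, hF' _ hw _ hl⟩

/-- `Shows kn X Y δ b i`: it can be shown that node `i` has value `b`, where `kn b j` means that
the input `j` is known to have value `b`. Where all inputs of a large gate would have to be examined,
only those in `X` are. Where one input of a gate of weft `2` has to be selected, it is taken from
`Y`. -/
def Shows (N : Net) (d : ℕ) (kn : Bool → ℕ → Prop) (X Y : ℕ → Prop) : ℕ → Bool → ℕ → Prop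
  | 0, b, i => N.indeg i = 0 ∧ kn b i
  | δ + 1, b, i => (N.indeg i = 0 ∧ kn b i) ∨
      (N.indeg i = 1 ∧ ∃ j, j < N.n ∧ N.wire j i ∧ Shows N d kn X Y δ (!b) j) ∨
      (2 ≤ N.indeg i ∧ N.isAnd i = b ∧
        ∀ j, j < N.n → N.wire j i → (2 < N.indeg i → X j) → Shows N d kn X Y δ b j) ∨
      (2 ≤ N.indeg i ∧ N.isAnd i ≠ b ∧ ∃ j, j < N.n ∧ N.wire j i ∧
        (2 < N.indeg i → 2 ≤ N.weft d i → Y j) ∧ Shows N d kn X Y δ b j)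

/-- Every large gate of weft `2` near `i` whose value needs a witness has one in `Y`. -/
def Selects (N : Net) (v : ℕ → Bool) (Y : ℕ → Prop) (i : ℕ) : Prop :=
  ∀ l, N.Top l i → 2 ≤ N.wt l → N.isAnd l ≠ v l → ∃ j, Y j ∧ N.wire j l ∧ v j = v l

/-- Completeness of the game. A proof of the true value branches at universal claims only: into at
most two inputs at a small gate, into the at most `M` inputs from `X` at a large one. This gives at
most `(M + 2) ^ δ` circuit inputs. Below a large gate the weft is at most `1`, so the condition on
`Y` is vacuous there. -/
theorem shows_of_known {d : ℕ} (hv : N.IsVal v) {X : Finset ℕ} {Y : ℕ → Prop} {M : ℕ}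
    (hX : X.card ≤ M) {δ : ℕ} (hδ : δ ≤ d) (hi : N.HeightLE δ i) (hin : i < N.n) (hw : N.wt i ≤ 2)
    (hY : N.Selects v Y i) :
    ∃ Q : Finset ℕ, Q.card ≤ (M + 2) ^ δ ∧ (∀ j ∈ Q, N.indeg j = 0 ∧ j < N.n) ∧
      ∀ kn : Bool → ℕ → Prop, (∀ j ∈ Q, kn (v j) j) → N.Shows d kn (· ∈ X) Y δ (v i) i := by
  classical
  induction δ generalizing i with
  | zero =>
    have h0 : N.indeg i = 0 := hi
    exact ⟨{i}, by simp, by simp [h0, hin], fun kn h => ⟨h0, h i (by simp)⟩⟩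
  | succ δ ih =>
    have hchild : ∀ j, N.wire j i → ∃ Q : Finset ℕ, Q.card ≤ (M + 2) ^ δ ∧
        (∀ j ∈ Q, N.indeg j = 0 ∧ j < N.n) ∧ ∀ kn : Bool → ℕ → Prop, (∀ j ∈ Q, kn (v j) j) →
          N.Shows d kn (· ∈ X) Y δ (v j) j := by
      intro j hj
      refine ih (by omega) (hi.child hj) ((N.lt_of_wire hj).trans hin)
        ((wt_le_of_wire hj).trans hw) ?_
      intro l hl hl2
      by_cases hlarge : 2 < N.indeg i
      · have := wt_lt_of_wire hj hlarge
        have := hl.wt_le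
        omega
      · exact hY l (.step hlarge hj hl) hl2
    have hpow : (M + 2) ^ δ ≤ (M + 2) ^ (δ + 1) := Nat.pow_le_pow_right (by omega) (by omega)
    rcases Nat.lt_or_ge (N.indeg i) 2 with h2 | h2
    · rcases Nat.lt_or_ge (N.indeg i) 1 with h1 | h1
      · have h0 : N.indeg i = 0 := by omega
        exact ⟨{i}, by simpa using Nat.one_le_pow _ _ (by omega), by simp [h0, hin],
          fun kn h => Or.inl ⟨h0, h i (by simp)⟩⟩
      · have h1 : N.indeg i = 1 := by omega
        obtain ⟨j, hj⟩ := Finset.card_pos.1 (show 0 < (N.children i).card from by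
          rw [indeg] at h1; omega)
        rw [mem_children] at hj
        obtain ⟨Q, hQ, hQ', hs⟩ := hchild j hj
        refine ⟨Q, hQ.trans hpow, hQ', fun kn h => Or.inr (Or.inl ⟨h1, j,
          (N.lt_of_wire hj).trans hin, hj, ?_⟩)⟩
        rw [(hv i hin).1 h1 j hj, Bool.not_not]
        exact hs kn h
    · by_cases hb : N.isAnd i = v i
      · have hall := ((hv i hin).2 h2).1 hb.symm
        choose! Q hQ hQ' hs using hchild
        let Z : Finset ℕ := (N.children i).filter fun j => 2 < N.indeg i → j ∈ X
        have hZ : Z.card ≤ M + 2 := by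
          by_cases hlarge : 2 < N.indeg i
          · have : Z ⊆ X := fun j hj => (Finset.mem_filter.1 hj).2 hlarge
            have := Finset.card_le_card this
            omega
          · have := Finset.card_filter_le (N.children i) fun j => 2 < N.indeg i → j ∈ X
            rw [indeg] at hlarge
            simp only [Z]
            omega
        have hZw : ∀ j ∈ Z, N.wire j i := fun j hj => mem_children.1 (Finset.mem_filter.1 hj).1
        refine ⟨Z.biUnion Q, ?_, fun j hj => ?_, fun kn h => Or.inr (Or.inr (Or.inl
          ⟨h2, hb, fun j _ hj hjX => ?_⟩))⟩
        · refine Finset.card_biUnion_le.trans ((Finset.sum_le_card_nsmul _ _ ((M + 2) ^ δ)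
            fun j hj => hQ j (hZw j hj)).trans ?_)
          rw [smul_eq_mul, pow_succ, mul_comm ((M + 2) ^ δ)]
          exact Nat.mul_le_mul_right _ hZ
        · obtain ⟨k, hk, hj⟩ := Finset.mem_biUnion.1 hj
          exact hQ' k (hZw k hk) j hj
        · have hjZ : j ∈ Z := Finset.mem_filter.2 ⟨mem_children.2 hj, hjX⟩
          rw [← hb, ← hall j hj]
          exact hs j hj kn fun k hk => h k (Finset.mem_biUnion.2 ⟨j, hjZ, hk⟩)
      · obtain ⟨j, hj, hjv, hjY⟩ : ∃ j, N.wire j i ∧ v j = v i ∧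
            (2 < N.indeg i → 2 ≤ N.weft d i → Y j) := by
          by_cases hlev : 2 < N.indeg i ∧ 2 ≤ N.weft d i
          · rw [weft_eq_wt (hi.mono hδ)] at hlev
            obtain ⟨j, hjY, hj, hjv⟩ := hY i (.refl hlev.1) hlev.2 hb
            exact ⟨j, hj, hjv, fun _ _ => hjY⟩
          · obtain ⟨j, hj, hjv⟩ := (hv.eq_iff_exists hin h2 hb).1 rfl
            exact ⟨j, hj, hjv, fun h h' => absurd ⟨h, h'⟩ hlev⟩
        obtain ⟨Q, hQ, hQ', hs⟩ := hchild j hj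
        refine ⟨Q, hQ.trans hpow, hQ', fun kn h => Or.inr (Or.inr (Or.inr ⟨h2, hb, j,
          (N.lt_of_wire hj).trans hin, hj, hjY, ?_⟩))⟩
        rw [← hjv]
        exact hs kn h

/-- Every large gate near `i` whose value is refuted by some input has such an input in `X`. -/
def Refutes (N : Net) (v : ℕ → Bool) (X : ℕ → Prop) (i : ℕ) : Prop :=
  ∀ l, N.Top l i → v l ≠ N.isAnd l → ∃ j, X j ∧ N.wire j l ∧ v j ≠ N.isAnd l

/-- Moreover, the same holds near the inputs of gates of weft `2` that are in question. -/
def Refutes₂ (N : Net) (v : ℕ → Bool) (X Y : ℕ → Prop) (i : ℕ) : Prop :=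
  ∀ l, N.Top l i → (v l ≠ N.isAnd l → ∃ j, X j ∧ N.wire j l ∧ v j ≠ N.isAnd l ∧
    (2 ≤ N.wt l → N.Refutes v X j)) ∧ (2 ≤ N.wt l → ∀ j, Y j → N.wire j l → N.Refutes v X j)

/-- The additional demands concern gates of weft `2` only. -/
theorem Refutes.refutes₂ {X Y : ℕ → Prop} (h : N.Refutes v X i) (hi : N.wt i ≤ 1) :
    N.Refutes₂ v X Y i := by
  intro l hl
  have hw := hl.wt_le
  refine ⟨fun hne => ?_, fun h2 => by omega⟩
  obtain ⟨j, hj⟩ := h l hl hne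
  exact ⟨j, hj.1, hj.2.1, hj.2.2, fun h2 => by omega⟩

theorem refutes_of_wt_eq_zero {X : ℕ → Prop} (hi : N.wt i = 0) : N.Refutes v X i := by
  intro l hl
  have := hl.wt_le
  have := wt_pos hl.large
  omega

/-- Soundness of the game. If a universal claim at a large gate is false, `X` contains an input with
the opposite value, yet this input had to be shown. An existential claim at a gate of weft `2` rests
on an input from `Y`, near which `X` refutes as well. In both cases one passes to weft at most `1`;
after the next large gate the weft is `0` and nothing is left to refute. This is where weft at most
`2` is needed. -/
theorem eq_of_shows {d : ℕ} (hv : N.IsVal v) {X Y : ℕ → Prop} {kn : Bool → ℕ → Prop}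
    (hkn : ∀ b j, N.indeg j = 0 → j < N.n → kn b j → v j = b) {δ : ℕ} (hδ : δ ≤ d)
    (hi : N.HeightLE δ i) (hin : i < N.n) (hw : N.wt i ≤ 2) (hX : N.Refutes₂ v X Y i) {b : Bool}
    (h : N.Shows d kn X Y δ b i) : v i = b := by
  induction δ generalizing i b with
  | zero => exact hkn b i h.1 hin h.2
  | succ δ ih =>
    have hweft := weft_eq_wt (hi.mono hδ)
    have hsmall : ∀ j, N.wire j i → ¬ 2 < N.indeg i → N.Refutes₂ v X Y j :=
      fun j hj hs l hl => hX l (.step hs hj hl)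
    have hchild : ∀ {j b}, N.wire j i → N.Refutes₂ v X Y j → N.Shows d kn X Y δ b j → v j = b :=
      fun hj hR h => ih (by omega) (hi.child hj) ((N.lt_of_wire hj).trans hin)
        ((wt_le_of_wire hj).trans hw) hR h
    have hlow : ∀ j, N.wire j i → 2 < N.indeg i → (2 ≤ N.wt i → N.Refutes v X j) →
        N.Refutes₂ v X Y j := by
      intro j hj hlarge hR
      have hlt := wt_lt_of_wire hj hlarge
      refine Refutes.refutes₂ ?_ (by omega)
      by_cases h2 : 2 ≤ N.wt i
      · exact hR h2
      · exact refutes_of_wt_eq_zero (by omega)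
    rcases h with ⟨h0, h⟩ | ⟨h1, j, -, hj, h⟩ | ⟨h2, hb, h⟩ | ⟨h2, hb, j, -, hj, hjY, h⟩
    · exact hkn b i h0 hin h
    · have := hchild hj (hsmall j hj (by omega)) h
      rw [(hv i hin).1 h1 j hj, this, Bool.not_not]
    · by_cases hlarge : 2 < N.indeg i
      · by_contra hne
        rw [← hb] at hne
        obtain ⟨⟨j, hjX, hj, hjv, hR⟩, -⟩ := And.imp_left (· hne) (hX i (.refl hlarge))
        refine hjv ?_
        rw [hb]
        exact hchild hj (hlow j hj hlarge hR)
          (h j ((N.lt_of_wire hj).trans hin) hj fun _ => hjX)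
      · rw [← hb, (hv i hin).2 h2]
        intro j hj
        rw [hb]
        exact hchild hj (hsmall j hj hlarge) (h j ((N.lt_of_wire hj).trans hin) hj fun h => absurd h hlarge)
    · rw [hv.eq_iff_exists hin h2 hb]
      refine ⟨j, hj, hchild hj ?_ h⟩
      by_cases hlarge : 2 < N.indeg i
      · exact hlow j hj hlarge fun hw2 => (hX i (.refl hlarge)).2 hw2 j (hjY hlarge (by rwa [hweft])) hj
      · exact hsmall j hj hlarge

/-- One witness for each of the at most `2 ^ δ` first large gates suffices. It does not depend on
the refuter. -/
theorem exists_selects (hv : N.IsVal v) {δ : ℕ} (hi : N.HeightLE δ i) :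
    ∃ Y : Finset ℕ, Y.card ≤ 2 ^ δ ∧ (∀ j ∈ Y, j < N.n) ∧ N.Selects v (· ∈ Y) i := by
  classical
  obtain ⟨F, hF, hF'⟩ := exists_top_finset hi
  have hex : ∀ l, ∃ j, N.Top l i → N.isAnd l ≠ v l → N.wire j l ∧ v j = v l := by
    intro l
    by_cases h : N.Top l i ∧ N.isAnd l ≠ v l
    · obtain ⟨j, hj⟩ := (hv.eq_iff_exists h.1.lt_n h.1.large.le h.2).1 rfl
      exact ⟨j, fun _ _ => hj⟩
    · exact ⟨0, fun h1 h2 => absurd ⟨h1, h2⟩ h⟩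
  choose w hw using hex
  refine ⟨(F.image w).filter (· < N.n), (Finset.card_filter_le _ _).trans
    (Finset.card_image_le.trans hF), by simp, fun l hl _ hne => ?_⟩
  obtain ⟨h1, h2⟩ := hw l hl hne
  exact ⟨w l, Finset.mem_filter.2 ⟨Finset.mem_image_of_mem _ (hF' l hl),
    (N.lt_of_wire h1).trans (N.lt_n_of_wire h1)⟩, h1, h2⟩

/-- One refuting input for each first large gate, and again for the first large gates near those
inputs and near the members of `Y`. Knowing `Y` in advance keeps this number bounded. -/
theorem exists_refutes₂ (hv : N.IsVal v) {δ : ℕ} (hi : N.HeightLE δ i) {Y : Finset ℕ} {M : ℕ}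
    (hY : Y.card ≤ M) :
    ∃ X : Finset ℕ, X.card ≤ 2 ^ δ + (2 ^ δ + M) * 2 ^ δ ∧ (∀ j ∈ X, j < N.n) ∧
      N.Refutes₂ v (· ∈ X) (· ∈ Y) i := by
  classical
  have hex : ∀ l, ∃ j, l < N.n → 2 < N.indeg l → v l ≠ N.isAnd l →
      N.wire j l ∧ v j ≠ N.isAnd l := by
    intro l
    by_cases h : l < N.n ∧ 2 < N.indeg l ∧ v l ≠ N.isAnd l
    · have := mt ((hv l h.1).2 h.2.1.le).2 h.2.2
      push Not at this
      obtain ⟨j, hj⟩ := this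
      exact ⟨j, fun _ _ _ => hj⟩
    · exact ⟨0, fun h1 h2 h3 => absurd ⟨h1, h2, h3⟩ h⟩
  choose w hw using hex
  have hwn : ∀ {l i}, N.Top l i → v l ≠ N.isAnd l → w l < N.n := fun h hne => by
    have := (hw _ h.lt_n h.large hne).1
    exact (N.lt_of_wire this).trans (N.lt_n_of_wire this)
  choose! F hF hF' using fun j (hj : N.HeightLE δ j) => exists_top_finset hj
  let X₂ : Finset ℕ := (F i).image w
  -- Members of `Y` are arbitrary numbers; the filter keeps those for which the bound on first large
  -- gates holds.
  let J : Finset ℕ := (X₂ ∪ Y).filter fun j => N.HeightLE δ j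
  let X : Finset ℕ := (X₂ ∪ J.biUnion fun j => (F j).image w).filter (· < N.n)
  have hX₂ : X₂.card ≤ 2 ^ δ := Finset.card_image_le.trans (hF i hi)
  have hJ : J.card ≤ 2 ^ δ + M := (Finset.card_filter_le _ _).trans
    ((Finset.card_union_le _ _).trans (Nat.add_le_add hX₂ hY))
  have hR : ∀ j ∈ J, N.Refutes v (· ∈ X) j := by
    intro j hj l hl hne
    obtain ⟨h1, h2⟩ := hw l hl.lt_n hl.large hne
    refine ⟨w l, Finset.mem_filter.2 ⟨Finset.mem_union_right _ (Finset.mem_biUnion.2 ⟨j, hj,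
      Finset.mem_image_of_mem _ (hF' j (Finset.mem_filter.1 hj).2 l hl)⟩), hwn hl hne⟩, h1, h2⟩
  refine ⟨X, ?_, by simp [X], fun l hl => ⟨fun hne => ?_, fun _ j hjY hj => hR j ?_⟩⟩
  · refine (Finset.card_filter_le _ _).trans ((Finset.card_union_le _ _).trans
      (Nat.add_le_add hX₂ ?_))
    refine Finset.card_biUnion_le.trans ((Finset.sum_le_card_nsmul _ _ (2 ^ δ) fun j hj =>
      Finset.card_image_le.trans (hF j (Finset.mem_filter.1 hj).2)).trans ?_)
    rw [smul_eq_mul]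
    exact Nat.mul_le_mul_right _ hJ
  · obtain ⟨h1, h2⟩ := hw l hl.lt_n hl.large hne
    have hmem : w l ∈ X₂ := Finset.mem_image_of_mem _ (hF' i hi l hl)
    refine ⟨w l, Finset.mem_filter.2 ⟨Finset.mem_union_left _ hmem, hwn hl hne⟩, h1, h2,
      fun _ => hR _ (Finset.mem_filter.2 ⟨Finset.mem_union_left _ hmem, ?_⟩)⟩
    exact (hl.heightLE hi).succ.child h1
  · exact Finset.mem_filter.2 ⟨Finset.mem_union_right _ hjY, (hl.heightLE hi).succ.child hj⟩

end Net

/-! ### From weighted circuit satisfiability to hitting sets -/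

/-- The digit at position `p` of `x` in base `B`. -/
def digit (B p x : ℕ) : ℕ := x / B ^ p % B

theorem digit_lt {B : ℕ} (hB : 0 < B) (p x : ℕ) : digit B p x < B := Nat.mod_lt _ hB

theorem exists_digits {B D : ℕ} {g : ℕ → ℕ} (hg : ∀ p < D, g p < B) :
    ∃ x < B ^ D, ∀ p < D, digit B p x = g p := by
  induction D generalizing g with
  | zero => exact ⟨0, by simp, by simp⟩
  | succ D ih =>
    obtain ⟨x, hx, h⟩ := ih (g := fun p => g (p + 1)) fun p hp => hg (p + 1) (by omega)
    have h0 := hg 0 (by omega)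
    refine ⟨g 0 + B * x, ?_, fun p hp => ?_⟩
    · calc g 0 + B * x < B + B * x := by omega
        _ = B * (x + 1) := by ring
        _ ≤ B * B ^ D := Nat.mul_le_mul_left _ hx
        _ = B ^ (D + 1) := by ring
    · cases p with
      | zero => simp [digit, Nat.mod_eq_of_lt h0]
      | succ p =>
        rw [← h p (by omega), digit, digit, pow_succ', ← Nat.div_div_eq_div_mul,
          Nat.add_mul_div_left _ _ (by omega), Nat.div_eq_of_lt h0, zero_add]

/-- `j` is a member of the set with code `x`. -/
def CodeMem (B M x j : ℕ) : Prop := ∃ p, p < M ∧ digit B p x = j + 1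

/-- Members are stored as digits shifted by one, so that the digit `0` marks an unused place. -/
theorem exists_code {n M D : ℕ} (hMD : M ≤ D) {F : Finset ℕ} (hF : F.card ≤ M)
    (hn : ∀ j ∈ F, j < n) : ∃ x < (n + 2) ^ D, ∀ j, CodeMem (n + 2) M x j ↔ j ∈ F := by
  have hlen : F.toList.length ≤ M := by simpa using hF
  obtain ⟨x, hx, h⟩ := exists_digits (B := n + 2) (D := D)
    (g := fun p => if h : p < F.toList.length then F.toList[p] + 1 else 0) (by
      intro p hp
      split_ifs with h
      · have := hn _ (Finset.mem_toList.1 (List.getElem_mem h))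
        omega
      · omega)
  refine ⟨x, hx, fun j => ⟨?_, fun hj => ?_⟩⟩
  · rintro ⟨p, hp, hpj⟩
    rw [h p (by omega)] at hpj
    split_ifs at hpj with hlt
    have : F.toList[p] = j := by omega
    rw [← this]
    exact Finset.mem_toList.1 (List.getElem_mem hlt)
  · obtain ⟨p, hp, hpj⟩ := List.getElem_of_mem (Finset.mem_toList.2 hj)
    exact ⟨p, by omega, by rw [h p (by omega), dif_pos hp, hpj]⟩

theorem exists_finset_of_code (B M x : ℕ) :
    ∃ F : Finset ℕ, F.card ≤ M ∧ ∀ j, CodeMem B M x j ↔ j ∈ F := by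
  refine ⟨((Finset.range M).filter fun p => digit B p x ≠ 0).image fun p => digit B p x - 1,
    Finset.card_image_le.trans ((Finset.card_filter_le _ _).trans (by simp)), fun j => ?_⟩
  simp only [Finset.mem_image, Finset.mem_filter, Finset.mem_range, CodeMem]
  refine exists_congr fun p => ?_
  rw [and_assoc]
  refine and_congr_right fun _ => ⟨fun h => by omega, fun h => by omega⟩

/-- What is known about the input `j` from the values `v` of an increasing sequence at the
positions `ι` (`v` and `ι` being given by their digits): `j + 1` is in the sequence, or it is
strictly between two consecutive elements. -/
def Known (k B D ι v : ℕ) : Bool → ℕ → Prop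
  | true, j => ∃ q, q < D ∧ digit B q v = j + 1
  | false, j => ∃ q, q < D ∧ ∃ q', q' < D ∧ digit (k + 2) q' ι = digit (k + 2) q ι + 1 ∧
      digit B q v < j + 1 ∧ j + 1 < digit B q' v

namespace Net

/-- The number of gates that may be selected by the prover. -/
def numY (d : ℕ) : ℕ := 2 ^ d

/-- The number of gates that may be selected by the refuter. -/
def numX (d : ℕ) : ℕ := 2 ^ d + (2 ^ d + 2 ^ d) * 2 ^ d

/-- The number of digits of codes. -/
def numD (d : ℕ) : ℕ := 2 * (numX d + 2) ^ (d + 1)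

variable (N : Net) (d k : ℕ)

/-- The values `v` at the positions `ι` are those of an increasing sequence of inputs (shifted
by one), preceded by `0` and followed by `n + 1`. -/
def Good (ι v : ℕ) : Prop :=
  ∀ q, q < numD d → (digit (k + 2) q ι = 0 → digit (N.n + 2) q v = 0) ∧
    (digit (k + 2) q ι = k + 1 → digit (N.n + 2) q v = N.n + 1) ∧
    (0 < digit (k + 2) q ι → digit (k + 2) q ι < k + 1 → 0 < digit (N.n + 2) q v ∧
      digit (N.n + 2) q v < N.n + 1 ∧ N.indeg (digit (N.n + 2) q v - 1) = 0) ∧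
    ∀ q', q' < numD d → digit (k + 2) q' ι = digit (k + 2) q ι + 1 →
      digit (N.n + 2) q v < digit (N.n + 2) q' v

/-- Larger than every relevant component of a code of a set: tuples of values and codes, tuples of
positions, indices of digits, and the three types. -/
def base : ℕ := (N.n + 2) ^ numD d + (k + 2) ^ numD d + numD d + 3

/-- The set with the given data contains the element `(b, v)`. For `b < (k + 2) ^ numD d`, this
element means that `v` is the tuple of values of a sequence at the positions `b`; for
`b = (k + 2) ^ numD d`, it means that `v` is the code of the prover's selection. -/
def HitsRow (τ α β t q q' b v : ℕ) : Prop :=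
  (τ = 0 → α ≤ (k + 2) ^ numD d → b = α ∧ (α < (k + 2) ^ numD d → N.Good d k α v)) ∧
  (τ = 1 → α < (k + 2) ^ numD d → β < (k + 2) ^ numD d → ∀ r, r < numD d → q = r →
    ∀ r', r' < numD d → q' = r' → digit (k + 2) r α = digit (k + 2) r' β →
      (b = α ∧ digit (N.n + 2) r v ≠ t) ∨ (b = β ∧ digit (N.n + 2) r' v = t)) ∧
  (τ = 2 → (b = (k + 2) ^ numD d ∧ v ≠ α) ∨ (b < (k + 2) ^ numD d ∧
    N.Shows d (Known k (N.n + 2) (numD d) b v) (CodeMem (N.n + 2) (numX d) β)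
      (CodeMem (N.n + 2) (numY d) α) d true (N.n - 1)))

/-- The set with code `a` contains the element `(b, v)`. -/
def Hits (a b v : ℕ) : Prop :=
  N.HitsRow d k (digit (N.base d k) 0 a) (digit (N.base d k) 1 a) (digit (N.base d k) 2 a)
    (digit (N.base d k) 3 a) (digit (N.base d k) 4 a) (digit (N.base d k) 5 a) b v

/-- The net has a satisfying assignment of weight `k`. -/
def WeightedSat : Prop :=
  ∃ (v : ℕ → Bool) (S : Finset ℕ), N.IsVal v ∧ v (N.n - 1) = true ∧ S.card = k ∧
    ∀ i, i ∈ S ↔ i < N.n ∧ N.indeg i = 0 ∧ v i = true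

variable {N d k}

/-- There have to be enough digits for the codes of `X` and `Y` and for two positions per circuit
input that is asked for. -/
theorem le_numD : numX d ≤ numD d ∧ numY d ≤ numD d ∧ 2 * (numX d + 2) ^ d ≤ numD d ∧
    2 ≤ numD d := by
  have h1 : numX d + 2 ≤ (numX d + 2) ^ (d + 1) := Nat.le_self_pow (by omega) _
  have h2 : (numX d + 2) ^ d ≤ (numX d + 2) ^ (d + 1) := Nat.pow_le_pow_right (by omega) (by omega)
  have h3 : numY d ≤ numX d := Nat.le_add_right _ _
  simp only [numD]
  omega

theorem exists_row_code {τ α β t q q' Z : ℕ} (h0 : τ < Z) (h1 : α < Z) (h2 : β < Z) (h3 : t < Z)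
    (h4 : q < Z) (h5 : q' < Z) : ∃ a < Z ^ 6, digit Z 0 a = τ ∧ digit Z 1 a = α ∧ digit Z 2 a = β ∧
      digit Z 3 a = t ∧ digit Z 4 a = q ∧ digit Z 5 a = q' := by
  obtain ⟨a, ha, h⟩ := exists_digits (B := Z) (D := 6)
    (g := fun p => [τ, α, β, t, q, q'].getD p 0) (by
      intro p hp
      interval_cases p <;> simpa)
  exact ⟨a, ha, h 0 (by omega), h 1 (by omega), h 2 (by omega), h 3 (by omega), h 4 (by omega),
    h 5 (by omega)⟩

/-- `x` enumerates `S`, shifted by one, between `0` and `n + 1`. -/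
structure Enumerates (n k : ℕ) (x : ℕ → ℕ) (S : Finset ℕ) : Prop where
  first : x 0 = 0
  last : x (k + 1) = n + 1
  lt_succ : ∀ i ≤ k, x i < x (i + 1)
  mem : ∀ j, j ∈ S ↔ ∃ i, 1 ≤ i ∧ i ≤ k ∧ x i = j + 1

namespace Enumerates

variable {n : ℕ} {x : ℕ → ℕ} {S : Finset ℕ}

theorem lt (h : Enumerates n k x S) {i i' : ℕ} (hi : i < i') (hi' : i' ≤ k + 1) : x i < x i' := by
  induction hi with
  | refl => exact h.lt_succ i (by omega)
  | step hlt ih => exact (ih (by omega)).trans (h.lt_succ _ (by omega))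

/-- Input `j` is true if `x i = j + 1` and false if the inequality is strict. So a pair of
consecutive terms decides it. -/
theorem exists_gap (h : Enumerates n k x S) {j : ℕ} (hj : j < n) :
    ∃ i ≤ k, x i ≤ j + 1 ∧ j + 1 < x (i + 1) := by
  have key : ∀ m, j + 1 < x m → ∃ i < m, x i ≤ j + 1 ∧ j + 1 < x (i + 1) := by
    intro m
    induction m with
    | zero => rw [h.first]; omega
    | succ m ih =>
      intro hm
      by_cases hlt : j + 1 < x m
      · obtain ⟨i, hi, hij⟩ := ih hlt
        exact ⟨i, by omega, hij⟩
      · exact ⟨m, by omega, by omega, hm⟩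
  obtain ⟨i, hi, hij⟩ := key (k + 1) (by rw [h.last]; omega)
  exact ⟨i, by omega, hij⟩

theorem mem_of_eq (h : Enumerates n k x S) {i j : ℕ} (hj : j < n) (hi : i ≤ k + 1)
    (hx : x i = j + 1) : j ∈ S := by
  refine (h.mem j).2 ⟨i, ?_, ?_, hx⟩
  · by_contra hc
    have : i = 0 := by omega
    rw [this, h.first] at hx
    omega
  · by_contra hc
    have : i = k + 1 := by omega
    rw [this, h.last] at hx
    omega

theorem notMem_of_between (h : Enumerates n k x S) {i j : ℕ} (hi : i ≤ k) (h1 : x i < j + 1)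
    (h2 : j + 1 < x (i + 1)) : j ∉ S := by
  intro hj
  obtain ⟨i', -, hi'k, hi'⟩ := (h.mem j).1 hj
  rcases lt_trichotomy i' i with hlt | rfl | hlt
  · have := h.lt hlt (by omega)
    omega
  · omega
  · rcases Nat.lt_or_eq_of_le (Nat.succ_le_of_lt hlt) with hlt' | heq
    · have := h.lt hlt' (by omega)
      simp only [Nat.succ_eq_add_one] at this
      omega
    · simp only [Nat.succ_eq_add_one] at heq
      rw [heq] at h2
      omega

theorem le_last (h : Enumerates n k x S) {i : ℕ} (hi : i ≤ k + 1) : x i ≤ n + 1 := by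
  rcases Nat.lt_or_eq_of_le hi with hlt | rfl
  · rw [← h.last]
    exact (h.lt hlt le_rfl).le
  · exact h.last.le

end Enumerates

theorem exists_enumerates {n : ℕ} {S : Finset ℕ} (hS : S.card = k) (hn : ∀ j ∈ S, j < n) :
    ∃ x, Enumerates n k x S := by
  have hrange := Finset.range_orderEmbOfFin S hS
  have hmem : ∀ i, S.orderEmbOfFin hS i ∈ S := Finset.orderEmbOfFin_mem S hS
  refine ⟨fun i => if h : 1 ≤ i ∧ i ≤ k then S.orderEmbOfFin hS ⟨i - 1, by omega⟩ + 1 else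
    if i = 0 then 0 else n + 1, by simp, by simp, fun i hi => ?_, fun j => ?_⟩
  · by_cases h0 : i = 0
    · subst h0
      rw [dif_neg (by omega), if_pos rfl]
      split_ifs <;> first | exact Nat.succ_pos _ | contradiction
    · rw [dif_pos ⟨by omega, hi⟩]
      by_cases hik : i + 1 ≤ k
      · rw [dif_pos ⟨by omega, hik⟩]
        refine Nat.add_lt_add_right ((S.orderEmbOfFin hS).strictMono ?_) 1
        rw [Fin.lt_def]
        simp only
        omega
      · rw [dif_neg (by omega), if_neg (by omega)]
        have := hn _ (hmem ⟨i - 1, by omega⟩)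
        omega
  · constructor
    · intro hj
      rw [← Finset.mem_coe, ← hrange] at hj
      obtain ⟨i, rfl⟩ := hj
      refine ⟨i + 1, by omega, i.2, ?_⟩
      rw [dif_pos ⟨by omega, i.2⟩]
      rfl
    · rintro ⟨i, h1, h2, h⟩
      rw [dif_pos ⟨h1, h2⟩] at h
      rw [← Nat.succ_injective h]
      exact hmem _

/-- Choose the true values in each block of positions and the code of the prover's witnesses in the
last block. Only the sets of type `2` for the announced `Y` need an argument: the inputs that
`shows_of_known` provides for the given `X` are asked for by a single tuple of positions, and the
element of this block hits the set. -/
theorem exists_hitting_of_weightedSat (hn : 0 < N.n) (hh : N.HeightLE d (N.n - 1))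
    (hw : N.wt (N.n - 1) ≤ 2) (hsat : N.WeightedSat k) :
    ∃ F : Finset ℕ, F ⊆ Finset.range (((k + 2) ^ numD d + 1) * (N.n + 2) ^ numD d) ∧
      F.card ≤ (k + 2) ^ numD d + 1 ∧ ∀ a < N.base d k ^ 6, ∃ e ∈ F,
        N.Hits d k a (e / (N.n + 2) ^ numD d) (e % (N.n + 2) ^ numD d) := by
  classical
  obtain ⟨v, S, hv, hout, hcard, hS⟩ := hsat
  obtain ⟨x, hx⟩ := exists_enumerates hcard (fun j hj => ((hS j).1 hj).1)
  obtain ⟨Ys, hYc, hYn, hYs⟩ := exists_selects hv hh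
  obtain ⟨hXD, hYD, hQD, hD2⟩ := le_numD (d := d)
  obtain ⟨Y, hY, hYm⟩ := exists_code hYD hYc hYn
  set K := (k + 2) ^ numD d with hK
  set V := (N.n + 2) ^ numD d with hV
  have hVpos : 0 < V := by positivity
  have hdig : ∀ ι q, digit (k + 2) q ι ≤ k + 1 := fun ι q =>
    Nat.lt_succ_iff.1 (digit_lt (by omega) q ι)
  choose val hval hvald using fun ι => exists_digits (B := N.n + 2) (D := numD d)
    (g := fun q => x (digit (k + 2) q ι)) fun q _ => by
      have := hx.le_last (hdig ι q)
      omega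
  let F : Finset ℕ := insert (K * V + Y) ((Finset.range K).image fun ι => ι * V + val ι)
  have hdiv : ∀ b y, y < V → (b * V + y) / V = b ∧ (b * V + y) % V = y := fun b y hy => by
    rw [mul_comm, Nat.mul_add_div hVpos, Nat.mul_add_mod, Nat.div_eq_of_lt hy, Nat.mod_eq_of_lt hy]
    simp
  refine ⟨F, ?_, ?_, fun a _ => ?_⟩
  · intro e he
    rw [Finset.mem_range, add_mul, one_mul]
    rcases Finset.mem_insert.1 he with rfl | he
    · omega
    · obtain ⟨ι, hι, rfl⟩ := Finset.mem_image.1 he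
      have h1 := hval ι
      have h2 : ι * V ≤ K * V := Nat.mul_le_mul_right _ (Finset.mem_range.1 hι).le
      omega
  · refine (Finset.card_insert_le _ _).trans (Nat.add_le_add_right ?_ 1)
    simpa using Finset.card_image_le (s := Finset.range K) (f := fun ι => ι * V + val ι)
  suffices h : ∀ τ α β t q q', ∃ e ∈ F, N.HitsRow d k τ α β t q q' (e / V) (e % V) from
    h _ _ _ _ _ _
  intro τ α β t q q'
  have hsel : N.HitsRow d k τ α β t q q' K Y → ∃ e ∈ F, N.HitsRow d k τ α β t q q' (e / V) (e % V) :=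
    fun h => ⟨K * V + Y, Finset.mem_insert_self _ _, by rwa [(hdiv K Y hY).1, (hdiv K Y hY).2]⟩
  have hpos : ∀ ι < K, N.HitsRow d k τ α β t q q' ι (val ι) →
      ∃ e ∈ F, N.HitsRow d k τ α β t q q' (e / V) (e % V) :=
    fun ι hι h => ⟨ι * V + val ι, Finset.mem_insert_of_mem (Finset.mem_image_of_mem _
      (Finset.mem_range.2 hι)), by rwa [(hdiv ι _ (hval ι)).1, (hdiv ι _ (hval ι)).2]⟩
  rcases (show τ = 0 ∨ τ = 1 ∨ τ = 2 ∨ 2 < τ by omega) with rfl | rfl | rfl | h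
  · rcases lt_trichotomy α K with hαK | rfl | hαK
    · refine hpos α hαK ?_
      refine ⟨fun _ _ => ⟨rfl, fun _ q hq => ?_⟩, by simp, by simp⟩
      rw [hvald α q hq]
      refine ⟨fun h => by rw [h, hx.first], fun h => by rw [h, hx.last], fun h1 h2 => ?_,
        fun q' hq' h => ?_⟩
      · have hp := hx.lt h1 (by omega)
        have hp' := hx.lt h2 le_rfl
        rw [hx.first] at hp
        rw [hx.last] at hp'
        refine ⟨hp, hp', ?_⟩
        exact ((hS _).1 (hx.mem_of_eq (i := digit (k + 2) q α) (by omega) (by omega) (by omega))).2.1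
      · rw [hvald α q' hq', h]
        exact hx.lt_succ _ (by have := hdig α q'; omega)
    · refine hsel ?_
      exact ⟨fun _ _ => ⟨rfl, fun h => absurd h (lt_irrefl _)⟩, by simp, by simp⟩
    · refine hsel ?_
      exact ⟨fun _ h => by omega, by simp, by simp⟩
  · by_cases hpre : α < K ∧ β < K ∧ q < numD d ∧ q' < numD d ∧
        digit (k + 2) q α = digit (k + 2) q' β
    · obtain ⟨h1, h2, h3, h4, h5⟩ := hpre
      by_cases hqt : digit (N.n + 2) q (val α) = t
      · refine hpos β h2 ?_
        refine ⟨by simp, fun _ _ _ r hr hqr r' hr' hqr' h => Or.inr ⟨rfl, ?_⟩, by simp⟩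
        rw [← hqr', hvald β q' h4, ← hqt, hvald α q h3, h5]
      · refine hpos α h1 ?_
        exact ⟨by simp, fun _ _ _ r hr hqr r' hr' hqr' h => Or.inl ⟨rfl, hqr ▸ hqt⟩, by simp⟩
    · refine hsel ?_
      refine ⟨by simp, fun _ h1 h2 r hr hqr r' hr' hqr' h => absurd ?_ hpre, by simp⟩
      subst hqr hqr'
      exact ⟨h1, h2, hr, hr', h⟩
  · by_cases hαY : Y = α
    · subst hαY
      obtain ⟨Xs, hXc, hXm⟩ := exists_finset_of_code (N.n + 2) (numX d) β
      have hYeq : CodeMem (N.n + 2) (numY d) Y = (· ∈ Ys) := funext fun j => propext (hYm j)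
      have hXeq : CodeMem (N.n + 2) (numX d) β = (· ∈ Xs) := funext fun j => propext (hXm j)
      obtain ⟨Q, hQc, hQ, hshow⟩ := shows_of_known hv hXc le_rfl hh (by omega) hw hYs
      choose! gap hgapk hgap using fun j (hj : j < N.n) => hx.exists_gap hj
      have hlen : Q.toList.length ≤ (numX d + 2) ^ d := by simpa using hQc
      -- The digits `2 * p` and `2 * p + 1` ask for both ends of the gap that contains the `p`-th
      -- input in `Q`.
      obtain ⟨ι, hι, hιd⟩ := exists_digits (B := k + 2) (D := numD d)
        (g := fun q => if h : q / 2 < Q.toList.length then gap Q.toList[q / 2] + q % 2 else 0) (by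
          intro q hq
          split_ifs with h
          · have := hgapk _ (hQ _ (Finset.mem_toList.1 (List.getElem_mem h))).2
            omega
          · omega)
      refine hpos ι hι ?_
      refine ⟨by simp, by simp, fun _ => Or.inr ⟨hι, ?_⟩⟩
      rw [hYeq, hXeq, ← hout]
      refine hshow _ fun j hj => ?_
      obtain ⟨p, hp, hpj⟩ := List.getElem_of_mem (Finset.mem_toList.2 hj)
      have hjn := (hQ j hj).2
      have hd0 : digit (k + 2) (2 * p) ι = gap j := by
        rw [hιd (2 * p) (by omega), dif_pos (by omega)]
        simp [hpj]
      have hd1 : digit (k + 2) (2 * p + 1) ι = gap j + 1 := by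
        rw [hιd (2 * p + 1) (by omega), dif_pos (by omega)]
        simp [hpj, Nat.add_div, Nat.add_mod]
      have hv0 := hvald ι (2 * p) (by omega)
      have hv1 := hvald ι (2 * p + 1) (by omega)
      rw [hd0] at hv0
      rw [hd1] at hv1
      rcases Nat.lt_or_eq_of_le (hgap j hjn).1 with hlt | heq
      · have : v j = false := by
          have := mt (hS j).2 (hx.notMem_of_between (hgapk j hjn) hlt (hgap j hjn).2)
          simpa [hjn, (hQ j hj).1] using this
        rw [this]
        exact ⟨2 * p, by omega, 2 * p + 1, by omega, by rw [hd0, hd1], by rwa [hv0],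
          by rw [hv1]; exact (hgap j hjn).2⟩
      · rw [((hS j).1 (hx.mem_of_eq hjn (by have := hgapk j hjn; omega) heq)).2.2]
        exact ⟨2 * p, by omega, by rw [hv0, heq]⟩
    · refine hsel ?_
      exact ⟨by simp, by simp, fun _ => Or.inl ⟨rfl, hαY⟩⟩
  · refine hsel ?_
    exact ⟨by omega, by omega, by omega⟩

/-- The hitting set has one tuple of values per block, and the sets of type `1` make a value depend
on its position alone. The values therefore form one increasing sequence of inputs, that is, an
assignment of weight `k`. If its output were false, the set of type `2` for the announced `Y` and a
refuting `X` could not be hit. -/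
theorem weightedSat_of_hitting (hn : 0 < N.n) (hh : N.HeightLE d (N.n - 1))
    (hw : N.wt (N.n - 1) ≤ 2) {F : Finset ℕ} (hF : F.card ≤ (k + 2) ^ numD d + 1)
    (hits : ∀ a < N.base d k ^ 6, ∃ e ∈ F,
      N.Hits d k a (e / (N.n + 2) ^ numD d) (e % (N.n + 2) ^ numD d)) :
    N.WeightedSat k := by
  classical
  obtain ⟨hXD, hYD, hQD, hD2⟩ := le_numD (d := d)
  have hbase : N.base d k = (N.n + 2) ^ numD d + (k + 2) ^ numD d + numD d + 3 := rfl
  have hBV : N.n + 2 ≤ (N.n + 2) ^ numD d := Nat.le_self_pow (by omega) _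
  set Z := N.base d k with hZ
  set K := (k + 2) ^ numD d with hK
  set V := (N.n + 2) ^ numD d with hV
  have hVpos : 0 < V := by positivity
  have hb : ∀ b, ∃ e, b ≤ K → e ∈ F ∧ e / V = b ∧ (b < K → N.Good d k b (e % V)) := by
    intro b
    by_cases hbK : b ≤ K
    · obtain ⟨a, ha, h0, h1, -⟩ := exists_row_code (Z := Z) (τ := 0) (α := b) (β := 0) (t := 0)
        (q := 0) (q' := 0) (by omega) (by omega) (by omega) (by omega) (by omega) (by omega)
      obtain ⟨e, he, hhit, -⟩ := hits a ha
      rw [h1] at hhit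
      obtain ⟨h2, h3⟩ := hhit h0 hbK
      exact ⟨e, fun _ => ⟨he, h2, h3⟩⟩
    · exact ⟨0, fun h => absurd h hbK⟩
  choose e he using hb
  -- Type `0` forces an element in each of the `K + 1` blocks, and the budget allows no more.
  have himage : (Finset.range (K + 1)).image e = F := by
    refine Finset.eq_of_subset_of_card_le (fun y hy => ?_) ?_
    · obtain ⟨b, hb, rfl⟩ := Finset.mem_image.1 hy
      exact (he b (Nat.lt_succ_iff.1 (Finset.mem_range.1 hb))).1
    · rw [Finset.card_image_of_injOn, Finset.card_range]
      · exact hF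
      · intro b hb b' hb' h
        rw [Finset.coe_range, Set.mem_Iio] at hb hb'
        rw [← (he b (by omega)).2.1, ← (he b' (by omega)).2.1, h]
  let s : ℕ → ℕ := fun b => e b % V
  have hFs : ∀ f ∈ F, f / V ≤ K ∧ f % V = s (f / V) := by
    intro f hf
    rw [← himage] at hf
    obtain ⟨b, hb, rfl⟩ := Finset.mem_image.1 hf
    have hbK := Nat.lt_succ_iff.1 (Finset.mem_range.1 hb)
    rw [(he b hbK).2.1]
    exact ⟨hbK, rfl⟩
  have hgood : ∀ b < K, N.Good d k b (s b) := fun b hb => (he b hb.le).2.2 hb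
  -- The set with `t` the value chosen in block `α` is the clause "if `α` answers `t`, so does `β`".
  have hcons : ∀ α < K, ∀ β < K, ∀ q < numD d, ∀ q' < numD d,
      digit (k + 2) q α = digit (k + 2) q' β →
        digit (N.n + 2) q (s α) = digit (N.n + 2) q' (s β) := by
    intro α hα β hβ q hq q' hq' h
    have hlt := digit_lt (show 0 < N.n + 2 by omega) q (s α)
    obtain ⟨a, ha, h0, h1, h2, h3, h4, h5⟩ := exists_row_code (Z := Z) (τ := 1) (α := α) (β := β)
      (t := digit (N.n + 2) q (s α)) (q := q) (q' := q') (by omega) (by omega) (by omega) (by omega)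
      (by omega) (by omega)
    obtain ⟨f, hf, -, hhit, -⟩ := hits a ha
    rw [← hZ, h0, h1, h2, h3, h4, h5, (hFs f hf).2] at hhit
    rcases hhit rfl hα hβ q hq rfl q' hq' rfl h with ⟨h6, h7⟩ | ⟨h6, h7⟩
    · rw [h6] at h7
      exact absurd rfl h7
    · rw [h6] at h7
      exact h7.symm
  -- The tuple `pos i` starts with the positions `i` and `i + 1`. Its first value defines the
  -- sequence, its second one compares consecutive terms.
  choose pos hpos hposd using fun i => exists_digits (B := k + 2) (D := numD d)
    (g := fun q => if q = 0 then min i (k + 1) else min (i + 1) (k + 1)) fun q _ => by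
      split_ifs <;> omega
  let x : ℕ → ℕ := fun i => digit (N.n + 2) 0 (s (pos i))
  have hp0 : ∀ i ≤ k + 1, digit (k + 2) 0 (pos i) = i := fun i hi => by
    rw [hposd i 0 (by omega), if_pos rfl]
    omega
  have hp1 : ∀ i ≤ k, digit (k + 2) 1 (pos i) = i + 1 := fun i hi => by
    rw [hposd i 1 (by omega), if_neg one_ne_zero]
    omega
  have hval : ∀ ι < K, ∀ q < numD d, digit (N.n + 2) q (s ι) = x (digit (k + 2) q ι) := by
    intro ι hι q hq
    refine hcons ι hι _ (hpos _) q hq 0 (by omega) ?_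
    rw [hp0]
    exact Nat.lt_succ_iff.1 (digit_lt (by omega) q ι)
  have hg := fun i => hgood (pos i) (hpos i) 0 (by omega)
  have hx0 : x 0 = 0 := (hg 0).1 (hp0 0 (by omega))
  have hxl : x (k + 1) = N.n + 1 := (hg (k + 1)).2.1 (hp0 (k + 1) le_rfl)
  have hxi : ∀ i, 1 ≤ i → i ≤ k → 0 < x i ∧ x i < N.n + 1 ∧ N.indeg (x i - 1) = 0 := fun i h1 h2 =>
    (hg i).2.2.1 (by rw [hp0 i (by omega)]; omega) (by rw [hp0 i (by omega)]; omega)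
  have hxs : ∀ i ≤ k, x i < x (i + 1) := by
    intro i hi
    have := (hg i).2.2.2 1 (by omega) (by rw [hp0 i (by omega), hp1 i hi])
    rwa [hval _ (hpos i) 0 (by omega), hval _ (hpos i) 1 (by omega), hp0 i (by omega),
      hp1 i hi] at this
  let S : Finset ℕ := (Finset.Icc 1 k).image fun i => x i - 1
  have hx : Enumerates N.n k x S := by
    refine ⟨hx0, hxl, hxs, fun j => ?_⟩
    simp only [S, Finset.mem_image, Finset.mem_Icc]
    constructor
    · rintro ⟨i, ⟨h1, h2⟩, rfl⟩
      exact ⟨i, h1, h2, by have := (hxi i h1 h2).1; omega⟩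
    · rintro ⟨i, h1, h2, h⟩
      exact ⟨i, ⟨h1, h2⟩, by omega⟩
  obtain ⟨v, hv, hvS⟩ := exists_isVal N fun j => decide (j ∈ S)
  have hSprop : ∀ j ∈ S, j < N.n ∧ N.indeg j = 0 := by
    intro j hj
    obtain ⟨i, hi, rfl⟩ := Finset.mem_image.1 hj
    obtain ⟨h1, h2⟩ := Finset.mem_Icc.1 hi
    obtain ⟨h3, h4, h5⟩ := hxi i h1 h2
    exact ⟨by omega, h5⟩
  refine ⟨v, S, hv, ?_, ?_, fun j => ⟨fun hj => ?_, fun ⟨_, h0, h⟩ => ?_⟩⟩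
  · by_contra hout
    -- The refuter reacts to the selection in the last block; any number is the code of a set of
    -- bounded size.
    obtain ⟨Ys, hYc, hYm⟩ := exists_finset_of_code (N.n + 2) (numY d) (s K)
    obtain ⟨Xs, hXc, hXn, hXs⟩ := exists_refutes₂ hv hh hYc
    obtain ⟨X, hX, hXm⟩ := exists_code hXD hXc hXn
    have hYeq : CodeMem (N.n + 2) (numY d) (s K) = (· ∈ Ys) := funext fun j => propext (hYm j)
    have hXeq : CodeMem (N.n + 2) (numX d) X = (· ∈ Xs) := funext fun j => propext (hXm j)
    have hsK : s K < V := Nat.mod_lt _ hVpos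
    obtain ⟨a, ha, h0, h1, h2, -⟩ := exists_row_code (Z := Z) (τ := 2) (α := s K) (β := X) (t := 0)
        (q := 0) (q' := 0) (by omega) (by omega) (by omega) (by omega) (by omega) (by omega)
    obtain ⟨f, hf, -, -, hhit⟩ := hits a ha
    rw [← hZ, h0, h1, h2, hYeq, hXeq, (hFs f hf).2] at hhit
    rcases hhit rfl with ⟨h3, h4⟩ | ⟨h3, h4⟩
    · rw [h3] at h4
      exact h4 rfl
    · refine hout (eq_of_shows hv ?_ le_rfl hh (by omega) hw hXs h4)
      generalize f / V = b at h3 h4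
      intro c j hj0 hjn hkn
      rw [hvS j hj0]
      cases c with
      | true =>
        obtain ⟨q, hq, h⟩ := hkn
        rw [hval b h3 q hq] at h
        simpa using hx.mem_of_eq hjn (Nat.lt_succ_iff.1 (digit_lt (by omega) q b)) h
      | false =>
        obtain ⟨q, hq, q', hq', h, h5, h6⟩ := hkn
        rw [hval b h3 q hq] at h5
        rw [hval b h3 q' hq', h] at h6
        have := digit_lt (show 0 < k + 2 by omega) q' b
        simpa using hx.notMem_of_between (by omega) h5 h6
  · rw [Finset.card_image_of_injOn, Nat.card_Icc, Nat.add_sub_cancel]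
    intro i hi i' hi' h
    rw [Finset.coe_Icc, Set.mem_Icc] at hi hi'
    have h1 := (hxi i hi.1 hi.2).1
    have h2 := (hxi i' hi'.1 hi'.2).1
    simp only at h
    rcases lt_trichotomy i i' with hlt | heq | hlt
    · have := hx.lt hlt (by omega)
      omega
    · exact heq
    · have := hx.lt hlt (by omega)
      omega
  · exact ⟨(hSprop j hj).1, (hSprop j hj).2, by rw [hvS j (hSprop j hj).2]; simpa using hj⟩
  · rw [hvS j h0] at h
    simpa using h

end Net

/-! ### Circuits and words -/

theorem getElem?_flatMap_finRange {α : Type*} {n c : ℕ} {f : Fin n → List α}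
    (hf : ∀ i, (f i).length = c) :
    ((List.finRange n).flatMap f).length = n * c ∧
      ∀ (i : Fin n) (j : ℕ), j < c → ((List.finRange n).flatMap f)[i * c + j]? = (f i)[j]? := by
  induction n with
  | zero => exact ⟨by simp, fun i => i.elim0⟩
  | succ n ih =>
    obtain ⟨h1, h2⟩ := ih (f := fun i => f i.succ) fun i => hf _
    have e : (List.finRange (n + 1)).flatMap f =
        f 0 ++ (List.finRange n).flatMap fun i => f i.succ := by
      rw [List.finRange_succ, List.flatMap_cons, List.flatMap_map]
    rw [e]
    refine ⟨by rw [List.length_append, h1, hf]; ring, fun i j hj => ?_⟩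
    refine Fin.cases ?_ (fun i => ?_) i
    · simp [List.getElem?_append_left, hf, hj]
    · rw [List.getElem?_append_right (by rw [hf, Fin.val_succ]; nlinarith), hf, ← h2 i j hj]
      congr 1
      rw [Fin.val_succ, Nat.add_mul]
      omega

/-- The net `N` represents the circuit `C`. -/
structure Represents (C : Circuit) (N : Net) : Prop where
  n_eq : N.n = C.last + 1
  wire_iff : ∀ i j : Fin (C.last + 1), N.wire j i ↔ C.wire j i = true
  isAnd_eq : ∀ i : Fin (C.last + 1), N.isAnd i = C.isAnd i

namespace Represents

variable {C : Circuit} {N : Net}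

theorem exists_of_wire (h : Represents C N) {i : Fin (C.last + 1)} {j : ℕ} (hj : N.wire j i) :
    ∃ j' : Fin (C.last + 1), j = j' ∧ C.wire j' i = true := by
  have hlt : j < C.last + 1 := (N.lt_of_wire hj).trans i.2
  exact ⟨⟨j, hlt⟩, rfl, (h.wire_iff i ⟨j, hlt⟩).1 hj⟩

theorem children_eq (h : Represents C N) (i : Fin (C.last + 1)) :
    N.children i = (C.inputsOf i).map Fin.valEmbedding := by
  ext j
  simp only [Net.mem_children, Finset.mem_map, Circuit.inputsOf, Finset.mem_filter,
    Finset.mem_univ, true_and, Fin.valEmbedding_apply]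
  constructor
  · intro hj
    obtain ⟨j', rfl, hj'⟩ := h.exists_of_wire hj
    exact ⟨j', hj', rfl⟩
  · rintro ⟨j', hj', rfl⟩
    exact (h.wire_iff i j').2 hj'

theorem indeg_eq (h : Represents C N) (i : Fin (C.last + 1)) : N.indeg i = C.indeg i := by
  rw [Net.indeg, h.children_eq, Finset.card_map, Circuit.indeg]

/-- Paths are read backwards from `i`, following the recursion over inputs; `forall_path_iff`
reverses them. -/
theorem heightLE_iff (h : Represents C N) (δ : ℕ) (i : Fin (C.last + 1)) :
    N.HeightLE δ i ↔ ∀ q, (i :: q).IsChain (fun a b => C.wire b a = true) → q.length ≤ δ := by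
  induction δ generalizing i with
  | zero =>
    rw [Net.HeightLE, Net.indeg_eq_zero]
    constructor
    · rintro h0 (_ | ⟨j, q⟩) hq
      · simp
      · exact absurd ((h.wire_iff i j).2 (List.isChain_cons_cons.1 hq).1) (h0 j)
    · intro hq j hj
      obtain ⟨j', rfl, hj'⟩ := h.exists_of_wire hj
      have := hq [j'] (by simp [hj'])
      simp at this
  | succ δ ih =>
    constructor
    · rintro h0 (_ | ⟨j, q⟩) hq
      · simp
      · rw [List.isChain_cons_cons] at hq
        have := (ih j).1 (Net.HeightLE.child h0 ((h.wire_iff i j).2 hq.1)) q hq.2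
        simpa using this
    · intro hq j _ hj
      obtain ⟨j', rfl, hj'⟩ := h.exists_of_wire hj
      rw [ih]
      intro q hq'
      have := hq (j' :: q) (List.isChain_cons_cons.2 ⟨hj', hq'⟩)
      simpa using this

theorem weft_le_iff (h : Represents C N) {δ t : ℕ} {i : Fin (C.last + 1)} (hi : N.HeightLE δ i) :
    N.weft δ i ≤ t ↔ ∀ q, (i :: q).IsChain (fun a b => C.wire b a = true) →
      ((i :: q).filter fun i => decide (2 < C.indeg i)).length ≤ t := by
  induction δ generalizing i t with
  | zero =>
    refine ⟨fun _ q hq => ?_, fun _ => Nat.zero_le _⟩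
    have hlen := (h.heightLE_iff 0 i).1 hi q hq
    have h0 : C.indeg i = 0 := by rw [← h.indeg_eq]; exact hi
    rw [Nat.le_zero, List.length_eq_zero_iff] at hlen
    simp [hlen, h0]
  | succ δ ih =>
    rw [Net.weft, h.indeg_eq]
    constructor
    · intro hle q hq
      match q, hq with
      | [], _ =>
        split_ifs at hle with hl <;> simp [hl]
        omega
      | j :: q, hq =>
        rw [List.isChain_cons_cons] at hq
        have hj := (h.wire_iff i j).2 hq.1
        have h1 := (ih (hi.child hj)).1 le_rfl q hq.2
        have h2 := Finset.le_sup (f := N.weft δ) (Net.mem_children.2 hj)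
        rw [List.filter_cons]
        split_ifs at hle with hl <;> simp only [hl, decide_true, decide_false, if_true,
          Bool.false_eq_true, if_false, List.length_cons] <;> omega
    · intro hq
      have hL : (if 2 < C.indeg i then 1 else 0) ≤ t := by
        have := hq [] (by simp)
        split_ifs with hl
        · simpa [hl] using this
        · exact Nat.zero_le _
      have hsup : (N.children i).sup (N.weft δ) ≤ t - if 2 < C.indeg i then 1 else 0 := by
        refine Finset.sup_le fun j hj => ?_
        obtain ⟨j', rfl, hj'⟩ := h.exists_of_wire (Net.mem_children.1 hj)
        rw [ih (hi.child (Net.mem_children.1 hj))]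
        intro q hq'
        have := hq (j' :: q) (List.isChain_cons_cons.2 ⟨hj', hq'⟩)
        rw [List.filter_cons] at this
        split_ifs with hl <;> simp only [hl, decide_true, decide_false, if_true,
          Bool.false_eq_true, if_false, List.length_cons] at this <;> omega
      omega

theorem forall_path_iff (C : Circuit) {Q : List (Fin (C.last + 1)) → Prop}
    (hQ : ∀ p, Q p.reverse ↔ Q p) : (∀ p, C.IsPathToOutput p → Q p) ↔
      ∀ q, (Fin.last C.last :: q).IsChain (fun a b => C.wire b a = true) →
        Q (Fin.last C.last :: q) := by
  constructor
  · intro h q hq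
    rw [← hQ]
    refine h _ ⟨?_, by simp⟩
    rw [List.isChain_reverse]
    exact hq
  · rintro h p ⟨hp, hl⟩
    rw [← hQ]
    rw [← List.head?_reverse] at hl
    rw [← List.reverse_reverse p, List.isChain_reverse] at hp
    match p.reverse, hl, hp with
    | a :: q, hl, hp =>
      obtain rfl : a = Fin.last C.last := by simpa using hl
      exact h q hp

theorem depthLE_iff (h : Represents C N) (d : ℕ) : C.DepthLE d ↔ N.HeightLE d C.last := by
  have := h.heightLE_iff d (Fin.last C.last)
  rw [Fin.val_last] at this
  rw [this, Circuit.DepthLE, forall_path_iff C (by simp)]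
  simp

theorem weftLE_iff (h : Represents C N) {d : ℕ} (hd : N.HeightLE d C.last) (t : ℕ) :
    C.WeftLE t ↔ N.weft d C.last ≤ t := by
  have := h.weft_le_iff (t := t) (i := Fin.last C.last) (δ := d) (by rwa [Fin.val_last])
  rw [Fin.val_last] at this
  rw [this, Circuit.WeftLE, forall_path_iff C (by simp [List.filter_reverse])]

theorem isValuation_iff (h : Represents C N) {v : Fin (C.last + 1) → Bool} {v' : ℕ → Bool}
    (hv : ∀ i : Fin (C.last + 1), v' i = v i) : C.IsValuation v ↔ N.IsVal v' := by
  have hwire : ∀ (i : Fin (C.last + 1)) (P : ℕ → Prop),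
      (∀ j, N.wire j i → P j) ↔ ∀ j : Fin (C.last + 1), j ∈ C.inputsOf i → P j := by
    intro i P
    constructor
    · intro hP j hj
      exact hP j ((h.wire_iff i j).2 (by simpa [Circuit.inputsOf] using hj))
    · intro hP j hj
      obtain ⟨j', rfl, hj'⟩ := h.exists_of_wire hj
      exact hP j' (by simpa [Circuit.inputsOf] using hj')
  have hall : N.IsVal v' ↔ ∀ i : Fin (C.last + 1),
      (C.indeg i = 1 → ∀ j ∈ C.inputsOf i, v i = !v j) ∧
      (2 ≤ C.indeg i → (v i = C.isAnd i ↔ ∀ j ∈ C.inputsOf i, v j = C.isAnd i)) := by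
    rw [Net.IsVal, h.n_eq]
    constructor
    · intro hN i
      have := hN i i.2
      simpa only [h.indeg_eq, hwire, hv, h.isAnd_eq] using this
    · intro hN i hi
      have := hN ⟨i, hi⟩
      have e1 := h.indeg_eq ⟨i, hi⟩
      have e2 := hwire ⟨i, hi⟩
      have e3 := h.isAnd_eq ⟨i, hi⟩
      have e4 := hv ⟨i, hi⟩
      simp only at e1 e2 e3 e4
      simpa only [e1, e2, e3, e4, hv] using this
  rw [hall, Circuit.IsValuation]
  refine forall_congr' fun i => and_congr (imp_congr_right fun h1 => ?_) ?_
  · obtain ⟨j, hj⟩ := Finset.card_eq_one.1 h1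
    simp only [hj, Finset.mem_singleton, forall_eq]
    cases v i <;> cases v j <;> simp
  · cases C.isAnd i
    · simp only [Bool.false_eq_true, false_imp_iff, forall_const, true_and, imp_true_iff]
      refine imp_congr_right fun _ => ?_
      rw [← not_iff_not (a := v i = true) (b := ∃ j ∈ C.inputsOf i, v j = true)]
      simp
    · exact ⟨fun h h2 => h.1 h2 rfl, fun h => ⟨fun h2 _ => h h2, fun _ hc => by cases hc⟩⟩

theorem weightedSat_iff (h : Represents C N) (k : ℕ) : C.WeightedSat k ↔ N.WeightedSat k := by
  have hlast : N.n - 1 = C.last := by rw [h.n_eq]; rfl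
  constructor
  · rintro ⟨v, hv, hout, hcard⟩
    let v' : ℕ → Bool := fun i => if hi : i < C.last + 1 then v ⟨i, hi⟩ else false
    have hv' : ∀ i : Fin (C.last + 1), v' i = v i := fun i => dif_pos i.2
    refine ⟨v', (Finset.univ.filter fun i => C.indeg i = 0 ∧ v i = true).map Fin.valEmbedding,
      (h.isValuation_iff hv').1 hv, ?_, by rwa [Finset.card_map], fun i => ?_⟩
    · rw [hlast, ← hout, ← hv' (Fin.last C.last), Fin.val_last]
    · simp only [Finset.mem_map, Finset.mem_filter, Finset.mem_univ, true_and,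
        Fin.valEmbedding_apply]
      constructor
      · rintro ⟨i, ⟨h1, h2⟩, rfl⟩
        exact ⟨by rw [h.n_eq]; exact i.2, by rw [h.indeg_eq, h1], by rw [hv', h2]⟩
      · rintro ⟨h1, h2, h3⟩
        rw [h.n_eq] at h1
        exact ⟨⟨i, h1⟩, ⟨by rw [← h.indeg_eq]; exact h2, by rw [← hv']; exact h3⟩, rfl⟩
  · rintro ⟨v', S, hv, hout, hcard, hS⟩
    refine ⟨fun i => v' i, (h.isValuation_iff fun _ => rfl).2 hv, ?_, ?_⟩
    · change v' C.last = true
      rw [← hlast, hout]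
    · rw [← hcard, ← Finset.card_map Fin.valEmbedding]
      congr 1
      ext i
      simp only [Finset.mem_map, Finset.mem_filter, Finset.mem_univ, true_and,
        Fin.valEmbedding_apply, hS]
      constructor
      · rintro ⟨i, ⟨h1, h2⟩, rfl⟩
        exact ⟨by rw [h.n_eq]; exact i.2, by rw [h.indeg_eq, h1], h2⟩
      · rintro ⟨h1, h2, h3⟩
        rw [h.n_eq] at h1
        exact ⟨⟨i, h1⟩, ⟨by rw [← h.indeg_eq]; exact h2, h3⟩, rfl⟩

end Represents

/-- The number of nodes of the circuit with code `x`. -/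
def netSize (x : List (Fin 2)) : ℕ :=
  ∑ i ∈ Finset.range (x.length + 1), if i * (i + 1) = x.length then i else 0

theorem netSize_eq {x : List (Fin 2)} {n : ℕ} (h : x.length = n * (n + 1)) : netSize x = n := by
  have key : ∀ i, i * (i + 1) = x.length ↔ i = n := by
    intro i
    rw [h]
    constructor
    · intro hi
      rcases lt_trichotomy i n with hlt | heq | hlt
      · nlinarith
      · exact heq
      · nlinarith
    · rintro rfl
      rfl
  simp only [netSize, key]
  rw [Finset.sum_ite_eq' (Finset.range (x.length + 1)) n, if_pos]
  rw [Finset.mem_range]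
  nlinarith

theorem length_eq_of_netSize_pos {x : List (Fin 2)} (h : 0 < netSize x) :
    x.length = netSize x * (netSize x + 1) := by
  have : ∃ i, i * (i + 1) = x.length := by
    by_contra! hc
    simp [netSize, hc] at h
  obtain ⟨i, hi⟩ := this
  rw [netSize_eq hi.symm, hi]

/-- The entry of the adjacency matrix of the circuit with code `x`. -/
def wireBit (x : List (Fin 2)) (j i : ℕ) : Prop :=
  wordCells x (i * (netSize x + 1) + (j + 1)) = 2

open Classical in
/-- The net of the circuit with code `x`. -/
noncomputable def wordNet (x : List (Fin 2)) : Net where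
  n := netSize x
  isAnd i := decide (wordCells x (i * (netSize x + 1)) = 2)
  wire j i := j < i ∧ i < netSize x ∧ wireBit x j i
  lt_of_wire h := h.1
  lt_n_of_wire h := h.2.1

/-- `x` is the code of a circuit of depth at most `d` and weft at most `2`. -/
def Valid (d : ℕ) (x : List (Fin 2)) : Prop :=
  0 < netSize x ∧ (∀ i, i < netSize x → ∀ j, j < netSize x → wireBit x j i → j < i) ∧
    (wordNet x).HeightLE d (netSize x - 1) ∧ (wordNet x).weft d (netSize x - 1) ≤ 2

theorem encode_getElem? (C : Circuit) : C.encode.length = (C.last + 1) * (C.last + 2) ∧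
    (∀ i : Fin (C.last + 1), C.encode[i * (C.last + 2)]? =
      some (if C.isAnd i = true then 1 else 0)) ∧
    ∀ i j : Fin (C.last + 1), C.encode[i * (C.last + 2) + (j + 1)]? =
      some (if C.wire j i = true then 1 else 0) := by
  obtain ⟨h1, h2⟩ := getElem?_flatMap_finRange (c := C.last + 2)
    (f := fun i : Fin (C.last + 1) => (if C.isAnd i = true then (1 : Fin 2) else 0) ::
      (List.finRange (C.last + 1)).map fun j => if C.wire j i = true then 1 else 0) (by simp)
  refine ⟨h1, fun i => ?_, fun i j => ?_⟩
  · have := h2 i 0 (by omega)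
    rw [Circuit.encode]
    simpa using this
  · have := h2 i (j + 1) (by omega)
    rw [Circuit.encode]
    have hj : (List.finRange (C.last + 1))[(j : ℕ)]? = some j := by
      rw [List.getElem?_eq_getElem (by simpa using j.is_le), List.getElem_finRange]
      rfl
    simpa [hj] using this

theorem wordCells_eq_two {x : List (Fin 2)} {i : ℕ} : wordCells x i = 2 ↔ x[i]? = some 1 := by
  rw [wordCells]
  cases x[i]? with
  | none => simp
  | some c => fin_cases c <;> simp

theorem represents_encode (C : Circuit) : Represents C (wordNet C.encode) := by
  obtain ⟨h1, h2, h3⟩ := encode_getElem? C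
  have hn : netSize C.encode = C.last + 1 := netSize_eq h1
  refine ⟨hn, fun i j => ?_, fun i => ?_⟩
  · have hbit : wireBit C.encode j i ↔ C.wire j i = true := by
      rw [wireBit, hn, wordCells_eq_two, h3]
      by_cases h : C.wire j i = true <;> simp [h]
    change _ < _ ∧ _ < netSize _ ∧ _ ↔ _
    rw [hbit, hn]
    exact ⟨fun h => h.2.2, fun h => ⟨C.topological j i h, i.2, h⟩⟩
  · change decide _ = _
    simp only [hn, wordCells_eq_two, h2]
    cases C.isAnd i <;> simp

theorem exists_circuit {d : ℕ} {x : List (Fin 2)} (h : Valid d x) : ∃ C : Circuit, x = C.encode := by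
  classical
  obtain ⟨hpos, htop, -⟩ := h
  have hlen := length_eq_of_netSize_pos hpos
  obtain ⟨m, hm⟩ : ∃ m, netSize x = m + 1 := ⟨netSize x - 1, by omega⟩
  let C : Circuit :=
    { last := m
      isAnd := fun i => decide (wordCells x (i * (netSize x + 1)) = 2)
      wire := fun j i => decide (wireBit x j i)
      topological := fun j i h => htop i (by omega) j (by omega) (by simpa using h) }
  obtain ⟨h1, h2, h3⟩ := encode_getElem? C
  refine ⟨C, List.ext_getElem? fun p => ?_⟩
  have hx : ∀ p < x.length, x[p]? = some (if wordCells x p = 2 then 1 else 0) := by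
    intro p hp
    have hbit : ∀ c : Fin 2, c = if c = 1 then 1 else 0 := by decide
    simp only [wordCells_eq_two, List.getElem?_eq_getElem hp, Option.some.injEq]
    exact hbit _
  rcases Nat.lt_or_ge p x.length with hp | hp
  · rw [hx p hp]
    have hp2 : p < (m + 1) * (m + 2) := by rwa [hlen, hm] at hp
    have hdiv : p / (m + 2) < m + 1 := Nat.div_lt_of_lt_mul (by rwa [mul_comm])
    have hmod : p % (m + 2) < m + 2 := Nat.mod_lt _ (by omega)
    have hdm := Nat.div_add_mod p (m + 2)
    rw [mul_comm] at hdm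
    rcases Nat.eq_zero_or_pos (p % (m + 2)) with h0 | h0
    · have e : p / (m + 2) * (m + 2) = p := by omega
      have hc : C.isAnd ⟨p / (m + 2), hdiv⟩ = decide (wordCells x p = 2) := by
        simp only [C, hm, e]
      have := h2 ⟨p / (m + 2), hdiv⟩
      rw [hc] at this
      change C.encode[p / (m + 2) * (m + 2)]? = _ at this
      rw [e] at this
      simpa using this.symm
    · have hlt : p % (m + 2) - 1 < m + 1 := by omega
      have e : p / (m + 2) * (m + 2) + (p % (m + 2) - 1 + 1) = p := by omega
      have hc : C.wire ⟨p % (m + 2) - 1, hlt⟩ ⟨p / (m + 2), hdiv⟩ =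
          decide (wordCells x p = 2) := by
        simp only [C, wireBit, hm, e]
      have := h3 ⟨p / (m + 2), hdiv⟩ ⟨p % (m + 2) - 1, hlt⟩
      rw [hc] at this
      change C.encode[p / (m + 2) * (m + 2) + (p % (m + 2) - 1 + 1)]? = _ at this
      rw [e] at this
      simpa using this.symm
  · rw [List.getElem?_eq_none hp, List.getElem?_eq_none]
    rw [h1]
    rw [hlen, hm] at hp
    exact hp

/-- The quantifier over circuits is replaced by conditions on the letters of `x`, which arithmetic
terms can express. The reduction also has to answer correctly on words that are not codes of
circuits. -/
theorem mem_WCS_iff (d : ℕ) (x : List (Fin 2)) (k : ℕ) :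
    (x, k) ∈ (WCS 2 d).L ↔ Valid d x ∧ (wordNet x).WeightedSat k := by
  constructor
  · rintro ⟨C, hx, hw, hd, hs⟩
    simp only at hx hs
    subst hx
    have hrep := represents_encode C
    have hn : netSize C.encode = C.last + 1 := hrep.n_eq
    rw [hrep.depthLE_iff] at hd
    refine ⟨⟨by omega, fun i hi j hj hb => ?_, ?_, ?_⟩, (hrep.weightedSat_iff k).1 hs⟩
    · have := (encode_getElem? C).2.2 ⟨i, by omega⟩ ⟨j, by omega⟩
      rw [wireBit, hn, wordCells_eq_two, this] at hb
      refine C.topological ⟨j, by omega⟩ ⟨i, by omega⟩ ?_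
      by_contra hc
      simp [hc] at hb
    · rwa [hn, Nat.add_sub_cancel]
    · rw [hn, Nat.add_sub_cancel]
      exact (hrep.weftLE_iff hd 2).1 hw
  · rintro ⟨hv, hs⟩
    obtain ⟨C, rfl⟩ := exists_circuit hv
    have hrep := represents_encode C
    have hn : netSize C.encode = C.last + 1 := hrep.n_eq
    obtain ⟨-, -, hh, hw⟩ := hv
    rw [hn, Nat.add_sub_cancel] at hh hw
    exact ⟨C, rfl, (hrep.weftLE_iff hh 2).2 hw, (hrep.depthLE_iff d).2 hh,
      (hrep.weightedSat_iff k).2 hs⟩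

/-! ### Definability of the hitting set instance -/

section

variable {Γ : Type} {c : Γ → (ℕ → ℕ) × (ℕ → ℕ)} {x : Γ → List (Fin 2)} {i j k : Γ → ℕ}

theorem Dfn.digit {f g : Γ → ℕ} (hf : Dfn c f) (p : ℕ) (hg : Dfn c g) :
    Dfn c fun γ => digit (f γ) p (g γ) :=
  (hg.div (hf.pow p)).mod hf

theorem DfnP.codeMem {f g h : Γ → ℕ} (hf : Dfn c f) (M : ℕ) (hg : Dfn c g) (hh : Dfn c h) :
    DfnP c fun γ => CodeMem (f γ) M (g γ) (h γ) :=
  DfnP.exists_fixed M fun p => DfnP.eq (hf.digit p hg) (hh.add (.const 1))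

theorem DfnP.known {f v : Γ → ℕ} (hk : Dfn c k) (hf : Dfn c f) (D : ℕ) (hi : Dfn c i)
    (hv : Dfn c v) (b : Bool) (hj : Dfn c j) :
    DfnP c fun γ => Known (k γ) (f γ) D (i γ) (v γ) b (j γ) := by
  cases b with
  | true => exact DfnP.exists_fixed D fun q => DfnP.eq (hf.digit q hv) (hj.add (.const 1))
  | false =>
    exact DfnP.exists_fixed D fun q => DfnP.exists_fixed D fun q' =>
      (DfnP.eq ((hk.add (.const 2)).digit q' hi)
        (((hk.add (.const 2)).digit q hi).add (.const 1))).and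
      ((DfnP.lt (hf.digit q hv) (hj.add (.const 1))).and
        (DfnP.lt (hj.add (.const 1)) (hf.digit q' hv)))

theorem DfnP.subst {F : Γ → ℕ → Prop} (hF : DfnP (extend c) fun p => F p.1 p.2) (hi : Dfn c i) :
    DfnP c fun γ => F γ (i γ) := by
  classical
  refine (DfnP.eq (hi.bind (F := fun γ n => if F γ n then 1 else 0)
    (hF.toNat.congr fun _ => by congr)) (.const 1)).congr fun γ => ?_
  simp

/-- Insertion of a variable below the innermost one, which the renaming leaves fixed. -/
theorem DfnP.wk_under {F : Γ → ℕ → Prop} (hF : DfnP (extend c) fun p => F p.1 p.2) :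
    DfnP (extend (extend c)) fun p => F p.1.1 p.2 := by
  obtain ⟨a, ha⟩ := hF
  refine ⟨a.rename fun i => if i = 0 then 0 else i + 1, fun γ => ?_⟩
  rw [Arith.eval_rename]
  convert ha (γ.1.1, γ.2) using 4 <;>
  · funext i
    cases i <;> rfl

/-- In the context `c`, the word `x` is on the tape and its number of nodes is definable. -/
structure WordCtx (c : Γ → (ℕ → ℕ) × (ℕ → ℕ)) (x : Γ → List (Fin 2)) : Prop where
  tape : ∀ γ, (c γ).1 = wordCells (x γ)
  n : Dfn c fun γ => (wordNet (x γ)).n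

namespace WordCtx

theorem extend (h : WordCtx c x) : WordCtx (extend c) fun p => x p.1 :=
  ⟨fun p => h.tape p.1, h.n.wk⟩

theorem cells (h : WordCtx c x) (hi : Dfn c i) : Dfn c fun γ => wordCells (x γ) (i γ) :=
  hi.read.congr fun γ => by rw [h.tape]

theorem wireBit (h : WordCtx c x) (hj : Dfn c j) (hi : Dfn c i) :
    DfnP c fun γ => wireBit (x γ) (j γ) (i γ) :=
  DfnP.eq (h.cells ((hi.mul (h.n.add (.const 1))).add (hj.add (.const 1)))) (.const 2)

theorem wire (h : WordCtx c x) (hj : Dfn c j) (hi : Dfn c i) :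
    DfnP c fun γ => (wordNet (x γ)).wire (j γ) (i γ) :=
  (DfnP.lt hj hi).and ((DfnP.lt hi h.n).and (h.wireBit hj hi))

theorem isAnd_eq (h : WordCtx c x) (hi : Dfn c i) (b : Bool) :
    DfnP c fun γ => (wordNet (x γ)).isAnd (i γ) = b := by
  have key : DfnP c fun γ => wordCells (x γ) (i γ * ((wordNet (x γ)).n + 1)) = 2 :=
    DfnP.eq (h.cells (hi.mul (h.n.add (.const 1)))) (.const 2)
  cases b with
  | true => exact key.congr fun γ => by simp [wordNet]
  | false => exact key.not.congr fun γ => by simp [wordNet]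

theorem indeg (h : WordCtx c x) (hi : Dfn c i) : Dfn c fun γ => (wordNet (x γ)).indeg (i γ) := by
  classical
  refine (h.n.sum (F := fun γ j => if (wordNet (x γ)).wire j (i γ) then 1 else 0)
    ((h.extend.wire .last hi.wk).toNat.congr fun _ => by congr)).congr fun γ => ?_
  rw [Net.indeg, Net.children, Finset.card_filter]

theorem heightLE (h : WordCtx c x) (δ : ℕ) (hi : Dfn c i) :
    DfnP c fun γ => (wordNet (x γ)).HeightLE δ (i γ) := by
  induction δ generalizing Γ with
  | zero => exact DfnP.eq (h.indeg hi) (.const 0)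
  | succ δ ih =>
    exact DfnP.forall_lt (F := fun γ j => (wordNet (x γ)).wire j (i γ) →
      (wordNet (x γ)).HeightLE δ j) h.n ((h.extend.wire .last hi.wk).imp (ih h.extend .last))

/-- For positive `s`, a finite supremum is at least `s` if and only if some member is, so only
bounded existential quantifiers are needed. The threshold `0` is separate because of gates without
inputs. -/
theorem le_weft (h : WordCtx c x) (δ t : ℕ) (hi : Dfn c i) :
    DfnP c fun γ => t ≤ (wordNet (x γ)).weft δ (i γ) := by
  induction δ generalizing Γ t with
  | zero => exact DfnP.const (t ≤ 0)
  | succ δ ih =>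
    match t with
    | 0 => exact (DfnP.const True).congr fun γ => by simp
    | t + 1 =>
      have hsome : ∀ s, DfnP c fun γ => ∃ j, j < (wordNet (x γ)).n ∧
          ((wordNet (x γ)).wire j (i γ) ∧ s ≤ (wordNet (x γ)).weft δ j) := fun s =>
        DfnP.exists_lt h.n ((h.extend.wire .last hi.wk).and (ih h.extend s .last))
      have hsup : ∀ γ s, 0 < s → ((∃ j, j < (wordNet (x γ)).n ∧
          ((wordNet (x γ)).wire j (i γ) ∧ s ≤ (wordNet (x γ)).weft δ j)) ↔
          s ≤ ((wordNet (x γ)).children (i γ)).sup ((wordNet (x γ)).weft δ)) := by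
        intro γ s hs
        rw [Finset.le_sup_iff hs]
        simp only [Net.mem_children]
        exact exists_congr fun j => ⟨fun h => h.2, fun h =>
          ⟨((wordNet (x γ)).lt_of_wire h.1).trans ((wordNet (x γ)).lt_n_of_wire h.1), h⟩⟩
      refine (((DfnP.lt (.const 2) (h.indeg hi)).and ((DfnP.const (t = 0)).or (hsome t))).or
        (hsome (t + 1))).congr fun γ => ?_
      rw [hsup γ (t + 1) t.succ_pos, Net.weft]
      rcases Nat.eq_zero_or_pos t with rfl | ht
      · split_ifs with hl <;> simp [hl]
      · rw [hsup γ t ht]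
        split_ifs with hl <;> omega

/-- Since `δ` is a constant, the recursion unfolds into a fixed term. The induction varies the
context, as each level passes below a bounded quantifier. -/
theorem shows (h : WordCtx c x) (d : ℕ) {kn : Γ → Bool → ℕ → Prop} {X Y : Γ → ℕ → Prop}
    (hkn : ∀ b, DfnP (ElimDist.extend c) fun p => kn p.1 b p.2)
    (hX : DfnP (ElimDist.extend c) fun p => X p.1 p.2)
    (hY : DfnP (ElimDist.extend c) fun p => Y p.1 p.2) (δ : ℕ) (b : Bool) (hi : Dfn c i) :
    DfnP c fun γ => (wordNet (x γ)).Shows d (kn γ) (X γ) (Y γ) δ b (i γ) := by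
  induction δ generalizing Γ b with
  | zero => exact (DfnP.eq (h.indeg hi) (.const 0)).and ((hkn b).subst hi)
  | succ δ ih =>
    have hdeg := h.extend.indeg hi.wk
    have hwire := h.extend.wire .last hi.wk
    have hshow : ∀ b', DfnP (ElimDist.extend c) fun p =>
        (wordNet (x p.1)).Shows d (kn p.1) (X p.1) (Y p.1) δ b' p.2 := fun b' =>
      ih h.extend (fun b => DfnP.wk_under (F := fun γ => kn γ b) (hkn b)) hX.wk_under hY.wk_under b' .last
    exact ((DfnP.eq (h.indeg hi) (.const 0)).and ((hkn b).subst hi)).or <|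
      ((DfnP.eq (h.indeg hi) (.const 1)).and <| DfnP.exists_lt h.n <| hwire.and (hshow !b)).or <|
      ((DfnP.le (.const 2) (h.indeg hi)).and <| (h.isAnd_eq hi b).and <| DfnP.forall_lt h.n <|
        hwire.imp <| ((DfnP.lt (.const 2) hdeg).imp hX).imp (hshow b)).or <|
      (DfnP.le (.const 2) (h.indeg hi)).and <| (h.isAnd_eq hi b).not.and <| DfnP.exists_lt h.n <|
        hwire.and <| ((DfnP.lt (.const 2) hdeg).imp <|
          (h.extend.le_weft d 2 hi.wk).imp hY).and (hshow b)

theorem good (h : WordCtx c x) (hk : Dfn c k) (d : ℕ) (hi : Dfn c i) (hj : Dfn c j) :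
    DfnP c fun γ => (wordNet (x γ)).Good d (k γ) (i γ) (j γ) := by
  have hn := h.n.add (.const 2)
  have hk2 := hk.add (.const 2)
  exact DfnP.forall_fixed (Net.numD d) fun q =>
    ((DfnP.eq (hk2.digit q hi) (.const 0)).imp (DfnP.eq (hn.digit q hj) (.const 0))).and <|
    ((DfnP.eq (hk2.digit q hi) (hk.add (.const 1))).imp
      (DfnP.eq (hn.digit q hj) (h.n.add (.const 1)))).and <|
    ((DfnP.lt (.const 0) (hk2.digit q hi)).imp <|
      (DfnP.lt (hk2.digit q hi) (hk.add (.const 1))).imp <|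
      (DfnP.lt (.const 0) (hn.digit q hj)).and <|
      (DfnP.lt (hn.digit q hj) (h.n.add (.const 1))).and
      (DfnP.eq (h.indeg ((hn.digit q hj).sub (.const 1))) (.const 0))).and <|
    DfnP.forall_fixed (Net.numD d) fun q' =>
      (DfnP.eq (hk2.digit q' hi) ((hk2.digit q hi).add (.const 1))).imp
      (DfnP.lt (hn.digit q hj) (hn.digit q' hj))

theorem base (h : WordCtx c x) (hk : Dfn c k) (d : ℕ) :
    Dfn c fun γ => (wordNet (x γ)).base d (k γ) :=
  ((((h.n.add (.const 2)).pow (Net.numD d)).add ((hk.add (.const 2)).pow (Net.numD d))).add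
    (.const (Net.numD d))).add (.const 3)

theorem hitsRow (h : WordCtx c x) (hk : Dfn c k) (d : ℕ) {τ α β t q q' b v : Γ → ℕ}
    (hτ : Dfn c τ) (hα : Dfn c α) (hβ : Dfn c β) (ht : Dfn c t) (hq : Dfn c q) (hq' : Dfn c q')
    (hb : Dfn c b) (hv : Dfn c v) :
    DfnP c fun γ => (wordNet (x γ)).HitsRow d (k γ) (τ γ) (α γ) (β γ) (t γ) (q γ) (q' γ) (b γ)
      (v γ) := by
  have hn := h.n.add (.const 2)
  have hk2 := hk.add (.const 2)
  have hpow := hk2.pow (Net.numD d)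
  refine ((DfnP.eq hτ (.const 0)).imp <| (DfnP.le hα hpow).imp <| (DfnP.eq hb hα).and <|
    (DfnP.lt hα hpow).imp (h.good hk d hα hv)).and (DfnP.and
    ((DfnP.eq hτ (.const 1)).imp <| (DfnP.lt hα hpow).imp <| (DfnP.lt hβ hpow).imp <|
      DfnP.forall_fixed (Net.numD d) fun r => (DfnP.eq hq (.const r)).imp <|
      DfnP.forall_fixed (Net.numD d) fun r' => (DfnP.eq hq' (.const r')).imp <|
      (DfnP.eq (hk2.digit r hα) (hk2.digit r' hβ)).imp <|
      ((DfnP.eq hb hα).and (DfnP.ne (hn.digit r hv) ht)).or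
      ((DfnP.eq hb hβ).and (DfnP.eq (hn.digit r' hv) ht)))
    ((DfnP.eq hτ (.const 2)).imp <| ((DfnP.eq hb hpow).and (DfnP.ne hv hα)).or <|
      (DfnP.lt hb hpow).and <| h.shows d (fun b' => DfnP.known hk.wk hn.wk _ hb.wk hv.wk b' .last)
        (DfnP.codeMem hn.wk _ hβ.wk .last) (DfnP.codeMem hn.wk _ hα.wk .last) d true
        (h.n.sub (.const 1))))

theorem hits (h : WordCtx c x) (hk : Dfn c k) (d : ℕ) {a b v : Γ → ℕ} (ha : Dfn c a)
    (hb : Dfn c b) (hv : Dfn c v) : DfnP c fun γ => (wordNet (x γ)).Hits d (k γ) (a γ) (b γ) (v γ) :=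
  have hZ := h.base hk d
  h.hitsRow hk d (hZ.digit 0 ha) (hZ.digit 1 ha) (hZ.digit 2 ha) (hZ.digit 3 ha) (hZ.digit 4 ha)
    (hZ.digit 5 ha) hb hv

theorem valid (h : WordCtx c x) (d : ℕ) : DfnP c fun γ => Valid d (x γ) := by
  have htop : DfnP c fun γ => ∀ i, i < (wordNet (x γ)).n → ∀ j, j < (wordNet (x γ)).n →
      ElimDist.wireBit (x γ) j i → j < i :=
    DfnP.forall_lt h.n <| DfnP.forall_lt h.extend.n <|
      (h.extend.extend.wireBit .last Dfn.last.wk).imp (DfnP.lt .last Dfn.last.wk)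
  refine ((DfnP.lt (.const 0) h.n).and (htop.and ((h.heightLE d (h.n.sub (.const 1))).and
    (h.le_weft d 3 (h.n.sub (.const 1))).not))).congr fun γ => ?_
  rw [Valid, not_le, Nat.lt_succ_iff]
  rfl

end WordCtx

theorem wordCtx_instanceCtx : WordCtx (instanceCtx (a := 2)) fun p => p.1 := by
  refine ⟨fun _ => rfl, ?_⟩
  have hlen : Dfn (instanceCtx (a := 2)) fun p => p.1.length := Dfn.var 1
  classical
  have := (hlen.add (.const 1)).sum (F := fun p i => if i * (i + 1) = p.1.length then i else 0)
    (((DfnP.eq (Dfn.last.mul (Dfn.last.add (.const 1))) hlen.wk).cond .last (.const 0)).congr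
      fun _ => by congr)
  exact this.congr fun _ => rfl

end

/-! ### The graph of a circuit -/

theorem encodeGraph_getElem? {n : ℕ} (G : SimpleGraph (Fin n)) [DecidableRel G.Adj] :
    (encodeGraph G).length = n * n ∧
      ∀ i j : Fin n, (encodeGraph G)[i * n + j]? = some (if G.Adj i j then 1 else 0) := by
  classical
  obtain ⟨h1, h2⟩ := getElem?_flatMap_finRange (c := n)
    (f := fun i : Fin n => (List.finRange n).map fun j =>
      if G.Adj i j then (1 : Fin 2) else 0) (by simp)
  have h : encodeGraph G = (List.finRange n).flatMap fun i : Fin n => (List.finRange n).map fun j =>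
      if G.Adj i j then (1 : Fin 2) else 0 := by
    unfold encodeGraph
    congr!
  rw [h]
  refine ⟨h1, fun i j => ?_⟩
  have hj : (List.finRange n)[(j : ℕ)]? = some j := by
    rw [List.getElem?_eq_getElem (by simp), List.getElem_finRange]
    rfl
  rw [h2 i j j.2, List.getElem?_map, hj]
  rfl

/-- Makes the existential quantifier over graphs in `EDProblem` refer to a single graph. -/
theorem encodeGraph_injective {n m : ℕ} {G : SimpleGraph (Fin n)} {H : SimpleGraph (Fin m)}
    (h : encodeGraph G = encodeGraph H) : ∃ e : n = m, e ▸ G = H := by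
  classical
  obtain ⟨h1, h2⟩ := encodeGraph_getElem? G
  obtain ⟨h3, h4⟩ := encodeGraph_getElem? H
  have e : n = m := by
    rw [h, h3] at h1
    exact Nat.mul_self_inj.1 h1.symm
  subst e
  refine ⟨rfl, ?_⟩
  ext i j
  have := h2 i j
  rw [h, h4 i j] at this
  by_cases hG : G.Adj i j <;> by_cases hH : H.Adj i j <;> simp_all

theorem encodeGraph_mem_EDProblem {n : ℕ} (G : SimpleGraph (Fin n)) (star : Variant)
    (φ : Language.graph.Sentence) (k : ℕ) :
    (encodeGraph G, k) ∈ (EDProblem star φ).L ↔ ed φ G star ≤ k := by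
  constructor
  · rintro ⟨m, H, he, hH⟩
    obtain ⟨rfl, rfl⟩ := encodeGraph_injective he
    exact hH
  · exact fun h => ⟨n, G, rfl, h⟩

theorem map_range_eq_encodeGraph {n : ℕ} (G : SimpleGraph (Fin n)) {g : ℕ → Fin 2}
    [DecidableRel G.Adj] (hg : ∀ i j : Fin n, g (i * n + j) = if G.Adj i j then 1 else 0) :
    (List.range (n * n)).map g = encodeGraph G := by
  obtain ⟨h1, h2⟩ := encodeGraph_getElem? G
  refine List.ext_getElem? fun p => ?_
  rcases Nat.lt_or_ge p (n * n) with hp | hp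
  · have hn : 0 < n := Nat.pos_of_mul_pos_left (Nat.zero_lt_of_lt hp)
    have hdiv : p / n < n := Nat.div_lt_of_lt_mul hp
    have := h2 ⟨p / n, hdiv⟩ ⟨p % n, Nat.mod_lt _ hn⟩
    rw [← hg] at this
    simp only [Nat.div_add_mod'] at this
    rw [this]
    simp [hp]
  · rw [List.getElem?_eq_none (by simpa using hp), List.getElem?_eq_none (by rwa [h1])]

/-! ### Numbering of the vertices of the gadget -/

section Layout

/-- The number of a vertex of the gadget for `η` elements and `ρ` sets. -/
def vertexIndex (η ρ : ℕ) {κ : ℕ} : GadgetVertex (Fin η) (Fin ρ) (Fin κ) → ℕ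
  | .el e => e
  | .mid e => η + e
  | .leaf e => 2 * η + e
  | .row a c => 3 * η + (c * ρ + a)

variable {η ρ κ : ℕ}

theorem vertexIndex_lt (x : GadgetVertex (Fin η) (Fin ρ) (Fin κ)) :
    vertexIndex η ρ x < 3 * η + κ * ρ := by
  match x with
  | .el e => have := e.2; simp only [vertexIndex]; omega
  | .mid e => have := e.2; simp only [vertexIndex]; omega
  | .leaf e => have := e.2; simp only [vertexIndex]; omega
  | .row a c =>
    have := a.2
    have : (c + 1) * ρ ≤ κ * ρ := Nat.mul_le_mul_right _ c.2
    rw [add_mul, one_mul] at this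
    simp only [vertexIndex]
    omega

theorem row_div_mod (a : Fin ρ) (c : ℕ) : (c * ρ + a) / ρ = c ∧ (c * ρ + a) % ρ = a := by
  have hρ : 0 < ρ := Nat.zero_lt_of_lt a.2
  rw [mul_comm, Nat.mul_add_div hρ, Nat.mul_add_mod, Nat.div_eq_of_lt a.2, Nat.mod_eq_of_lt a.2]
  exact ⟨by omega, rfl⟩

theorem vertexIndex_injective : Function.Injective (vertexIndex η ρ (κ := κ)) := by
  intro x y h
  match x, y with
  | .el e, .el e' | .mid e, .mid e' | .leaf e, .leaf e' =>
    obtain rfl : e = e' := Fin.ext (by simp only [vertexIndex] at h; omega)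
    rfl
  | .row a c, .row a' c' =>
    have h' : (c : ℕ) * ρ + a = c' * ρ + a' := by simp only [vertexIndex] at h; omega
    obtain ⟨h1, h2⟩ := row_div_mod a c
    obtain ⟨h3, h4⟩ := row_div_mod a' c'
    rw [h', h3] at h1
    rw [h', h4] at h2
    obtain rfl := Fin.ext h1
    obtain rfl := Fin.ext h2
    rfl
  | .el e, .mid e' | .el e, .leaf e' | .mid e, .leaf e' | .mid e, .el e' | .leaf e, .el e'
  | .leaf e, .mid e' | .el e, .row _ _ | .mid e, .row _ _ | .leaf e, .row _ _ | .row _ _, .el e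
  | .row _ _, .mid e | .row _ _, .leaf e =>
    have := e.2
    simp only [vertexIndex] at h
    omega

theorem vertexIndex_surjective {p : ℕ} (hp : p < 3 * η + κ * ρ) :
    ∃ x : GadgetVertex (Fin η) (Fin ρ) (Fin κ), vertexIndex η ρ x = p := by
  by_cases h1 : p < η
  · exact ⟨.el ⟨p, h1⟩, rfl⟩
  by_cases h2 : p < 2 * η
  · exact ⟨.mid ⟨p - η, by omega⟩, by simp only [vertexIndex]; omega⟩
  by_cases h3 : p < 3 * η
  · exact ⟨.leaf ⟨p - 2 * η, by omega⟩, by simp only [vertexIndex]; omega⟩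
  have hlt : p - 3 * η < κ * ρ := by omega
  have hρ : 0 < ρ := Nat.pos_of_mul_pos_left (Nat.zero_lt_of_lt hlt)
  refine ⟨.row ⟨(p - 3 * η) % ρ, Nat.mod_lt _ hρ⟩
    ⟨(p - 3 * η) / ρ, Nat.div_lt_of_lt_mul (by rwa [mul_comm ρ])⟩, ?_⟩
  simp only [vertexIndex, Nat.div_add_mod']
  omega

noncomputable def vertexEquiv (η ρ κ : ℕ) :
    GadgetVertex (Fin η) (Fin ρ) (Fin κ) ≃ Fin (3 * η + κ * ρ) :=
  Equiv.ofBijective (fun x => ⟨vertexIndex η ρ x, vertexIndex_lt x⟩)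
    ⟨fun _ _ h => vertexIndex_injective (congrArg Fin.val h), fun p => by
      obtain ⟨x, hx⟩ := vertexIndex_surjective p.2
      exact ⟨x, Fin.ext hx⟩⟩

/-- Half of the adjacency relation of the gadget, in terms of the numbers of the vertices. -/
def IndexArc (η ρ : ℕ) (R : ℕ → ℕ → Prop) (u w : ℕ) : Prop :=
  (u < η ∧ w = η + u) ∨ (η ≤ u ∧ u < 2 * η ∧ w = u + η) ∨
    (3 * η ≤ u ∧ w < η ∧ R ((u - 3 * η) % ρ) w) ∨ (3 * η ≤ u ∧ 3 * η ≤ w ∧ u ≠ w)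

/-- The adjacency relation of the gadget, in terms of the numbers of the vertices. -/
def IndexAdj (η ρ : ℕ) (R : ℕ → ℕ → Prop) (u w : ℕ) : Prop :=
  IndexArc η ρ R u w ∨ IndexArc η ρ R w u

theorem not_indexAdj_self {R : ℕ → ℕ → Prop} (u : ℕ) : ¬ IndexAdj η ρ R u u := by
  rw [IndexAdj, or_self, IndexArc]
  rintro (h | h | h | h) <;> omega

theorem indexAdj_vertexIndex {R : ℕ → ℕ → Prop} (x y : GadgetVertex (Fin η) (Fin ρ) (Fin κ)) :
    IndexAdj η ρ R (vertexIndex η ρ x) (vertexIndex η ρ y) ↔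
      gadgetAdj (fun (a : Fin ρ) (e : Fin η) => R a e) x y := by
  have hrow : ∀ (a : Fin ρ) (c : Fin κ) (e : Fin η),
      IndexAdj η ρ R (3 * η + (c * ρ + a)) e ↔ R a e := by
    intro a c e
    have he := e.2
    have hmod : (3 * η + (c * ρ + a) - 3 * η) % ρ = a := by
      rw [Nat.add_sub_cancel_left, (row_div_mod a c).2]
    simp only [IndexAdj, IndexArc, hmod]
    refine ⟨?_, fun h => Or.inl (Or.inr (Or.inr (Or.inl ⟨by omega, he, h⟩)))⟩
    rintro ((h | h | h | h) | (h | h | h | h)) <;> first | exact h.2.2 | omega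
  match x, y with
  | .row a c, .row a' c' =>
    have hinj := vertexIndex_injective.ne_iff (f := vertexIndex η ρ (κ := κ))
      (x := .row a c) (y := .row a' c')
    simp only [vertexIndex, ne_eq, GadgetVertex.row.injEq] at hinj
    rw [gadgetAdj, ← hinj]
    simp only [IndexAdj, IndexArc, vertexIndex]
    refine ⟨?_, fun h => Or.inl (Or.inr (Or.inr (Or.inr ⟨by omega, by omega, h⟩)))⟩
    rintro ((h | h | h | h) | (h | h | h | h)) <;> omega
  | .row a c, .el e => exact hrow a c e
  | .el e, .row a c => exact or_comm.trans (hrow a c e)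
  | .el e, .el e' | .el e, .mid e' | .el e, .leaf e' | .mid e, .el e' | .mid e, .mid e'
  | .mid e, .leaf e' | .leaf e, .el e' | .leaf e, .mid e' | .leaf e, .leaf e' =>
    have := e.2
    have := e'.2
    simp only [IndexAdj, IndexArc, vertexIndex, gadgetAdj, Fin.ext_iff]
    constructor
    · rintro ((h | h | h | h) | (h | h | h | h)) <;> omega
    · intro h
      first
        | exact h.elim
        | exact Or.inl (Or.inl (by omega))
        | exact Or.inr (Or.inl (by omega))
        | exact Or.inl (Or.inr (Or.inl (by omega)))
        | exact Or.inr (Or.inr (Or.inl (by omega)))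
  | .mid e, .row _ _ | .leaf e, .row _ _ | .row _ _, .mid e | .row _ _, .leaf e =>
    have := e.2
    simp only [IndexAdj, IndexArc, vertexIndex, gadgetAdj, iff_false]
    rintro ((h | h | h | h) | (h | h | h | h)) <;> omega

/-- The gadget graph on the numbers of the vertices. -/
def indexGraph (η ρ κ : ℕ) (R : ℕ → ℕ → Prop) : SimpleGraph (Fin (3 * η + κ * ρ)) where
  Adj u w := IndexAdj η ρ R u w
  symm := ⟨fun _ _ h => Or.symm h⟩
  loopless := ⟨fun u => not_indexAdj_self (u : ℕ)⟩

theorem indexGraph_ed_le_iff {R : ℕ → ℕ → Prop} (hρ : 0 < ρ) (hR : ∀ e < η, ∃ a < ρ, R a e)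
    (K : ℕ) (star : Variant) : ed nearLeafSentence (indexGraph η ρ (K + 3) R) star ≤ K ↔
      ∃ F ⊆ Finset.range η, F.card ≤ K ∧ ∀ a < ρ, ∃ e ∈ F, R a e := by
  have : NeZero ρ := ⟨hρ.ne'⟩
  rw [gadget_ed_le_iff (f := vertexEquiv η ρ (K + 3)) (R := fun (a : Fin ρ) (e : Fin η) => R a e)
    (fun x y => indexAdj_vertexIndex x y) (fun e => ?_) (by simp)]
  · constructor
    · rintro ⟨F, hF, h⟩
      refine ⟨F.map Fin.valEmbedding, fun e he => ?_, by rwa [Finset.card_map], fun a ha => ?_⟩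
      · obtain ⟨e', -, rfl⟩ := Finset.mem_map.1 he
        exact Finset.mem_range.2 e'.2
      · obtain ⟨e, he, hae⟩ := h ⟨a, ha⟩
        exact ⟨e, Finset.mem_map_of_mem _ he, hae⟩
    · rintro ⟨F, hFη, hF, h⟩
      refine ⟨Finset.univ.filter fun e : Fin η => (e : ℕ) ∈ F, ?_, fun a => ?_⟩
      · refine le_trans ?_ hF
        rw [← Finset.card_map Fin.valEmbedding]
        refine Finset.card_le_card fun e he => ?_
        obtain ⟨e', he', rfl⟩ := Finset.mem_map.1 he
        exact (Finset.mem_filter.1 he').2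
      · obtain ⟨e, he, hae⟩ := h a a.2
        exact ⟨⟨e, Finset.mem_range.1 (hFη he)⟩, by simpa using he, hae⟩
  · obtain ⟨a, ha, hae⟩ := hR e e.2
    exact ⟨⟨a, ha⟩, hae⟩

end Layout

/-! ### The reduction -/

section Reduction

variable (d : ℕ) (x : List (Fin 2)) (k : ℕ)

/-- The size of the hitting set. -/
def budget : ℕ := (k + 2) ^ Net.numD d + 1

noncomputable def numElements : ℕ := budget d k * ((wordNet x).n + 2) ^ Net.numD d

noncomputable def numSets : ℕ := (wordNet x).base d k ^ 6 + 1

/-- The membership relation of the hitting set instance. The last set contains all elements. -/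
def Covers (a e : ℕ) : Prop :=
  a = (wordNet x).base d k ^ 6 ∨ (Valid d x ∧ (wordNet x).Hits d k a
    (e / ((wordNet x).n + 2) ^ Net.numD d) (e % ((wordNet x).n + 2) ^ Net.numD d))

noncomputable def numVertices : ℕ := 3 * numElements d x k + (budget d k + 3) * numSets d x k

/-- The additional last set puts every element into some set, as the gadget requires, and is hit by
every nonempty selection. If `x` is not valid, all other sets are empty; there is at least one of
them, so the instance is negative. -/
theorem mem_WCS_iff_exists_hitting : (x, k) ∈ (WCS 2 d).L ↔
    ∃ F ⊆ Finset.range (numElements d x k), F.card ≤ budget d k ∧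
      ∀ a < numSets d x k, ∃ e ∈ F, Covers d x k a e := by
  rw [mem_WCS_iff]
  have hbase : 0 < (wordNet x).base d k ^ 6 := pow_pos (by rw [Net.base]; omega) _
  constructor
  · rintro ⟨hv, hs⟩
    obtain ⟨hn, -, hh, hw⟩ := id hv
    obtain ⟨F, hF, hc, h⟩ := Net.exists_hitting_of_weightedSat hn hh
      ((Net.weft_eq_wt hh).symm.trans_le hw) hs
    refine ⟨F, hF, hc, fun a ha => ?_⟩
    rcases Nat.lt_succ_iff_lt_or_eq.1 ha with ha | rfl
    · obtain ⟨e, he, hae⟩ := h a ha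
      exact ⟨e, he, Or.inr ⟨hv, hae⟩⟩
    · obtain ⟨e, he, -⟩ := h 0 hbase
      exact ⟨e, he, Or.inl rfl⟩
  · rintro ⟨F, -, hc, h⟩
    have hits : ∀ a < (wordNet x).base d k ^ 6, Valid d x ∧ ∃ e ∈ F, (wordNet x).Hits d k a
        (e / ((wordNet x).n + 2) ^ Net.numD d) (e % ((wordNet x).n + 2) ^ Net.numD d) := by
      intro a ha
      obtain ⟨e, he, hae | ⟨hv, hae⟩⟩ := h a (Nat.lt_succ_of_lt ha)
      · omega
      · exact ⟨hv, e, he, hae⟩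
    have hv := (hits 0 hbase).1
    obtain ⟨hn, -, hh, hw⟩ := id hv
    exact ⟨hv, Net.weightedSat_of_hitting hn hh ((Net.weft_eq_wt hh).symm.trans_le hw) hc
      fun a ha => (hits a ha).2⟩

end Reduction

theorem dfnP_covers {Γ : Type} {c : Γ → (ℕ → ℕ) × (ℕ → ℕ)} {x : Γ → List (Fin 2)} {k a e : Γ → ℕ}
    (h : WordCtx c x) (hk : Dfn c k) (d : ℕ) (ha : Dfn c a) (he : Dfn c e) :
    DfnP c fun γ => Covers d (x γ) (k γ) (a γ) (e γ) :=
  have hV := (h.n.add (.const 2)).pow (Net.numD d)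
  (DfnP.eq ha ((h.base hk d).pow 6)).or ((h.valid d).and (h.hits hk d ha (he.div hV) (he.mod hV)))

theorem dfnP_indexAdj {Γ : Type} {c : Γ → (ℕ → ℕ) × (ℕ → ℕ)} {η ρ u w : Γ → ℕ}
    {R : Γ → ℕ → ℕ → Prop} (hη : Dfn c η) (hρ : Dfn c ρ) (hu : Dfn c u) (hw : Dfn c w)
    (hR : ∀ {a e : Γ → ℕ}, Dfn c a → Dfn c e → DfnP c fun γ => R γ (a γ) (e γ)) :
    DfnP c fun γ => IndexAdj (η γ) (ρ γ) (R γ) (u γ) (w γ) := by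
  have h2 := (Dfn.const 2).mul hη
  have h3 := (Dfn.const 3).mul hη
  have key : ∀ {u w : Γ → ℕ}, Dfn c u → Dfn c w →
      DfnP c fun γ => IndexArc (η γ) (ρ γ) (R γ) (u γ) (w γ) := fun hu hw =>
    ((DfnP.lt hu hη).and (DfnP.eq hw (hη.add hu))).or <|
    ((DfnP.le hη hu).and <| (DfnP.lt hu h2).and (DfnP.eq hw (hu.add hη))).or <|
    ((DfnP.le h3 hu).and <| (DfnP.lt hw hη).and (hR ((hu.sub h3).mod hρ) hw)).or <|
    (DfnP.le h3 hu).and <| (DfnP.le h3 hw).and (DfnP.ne hu hw)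
  exact (key hu hw).or (key hw hu)

open Classical in
/-- The adjacency matrix of the graph of the instance, row by row. -/
noncomputable def graphCell (d : ℕ) (p : List (Fin 2) × ℕ) (i : ℕ) : Fin 2 :=
  if IndexAdj (numElements d p.1 p.2) (numSets d p.1 p.2) (Covers d p.1 p.2)
    (i / numVertices d p.1 p.2) (i % numVertices d p.1 p.2) then 1 else 0

theorem graphCell_eq_encodeGraph (d : ℕ) (x : List (Fin 2)) (k : ℕ) :
    (List.range (numVertices d x k * numVertices d x k)).map (graphCell d (x, k)) =
      encodeGraph (indexGraph (numElements d x k) (numSets d x k) (budget d k + 3)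
        (Covers d x k)) := by
  classical
  refine map_range_eq_encodeGraph _ fun i j => ?_
  have hpos : 0 < numVertices d x k := Nat.zero_lt_of_lt i.2
  have h1 : (i * numVertices d x k + j) / numVertices d x k = i := by
    rw [mul_comm, Nat.mul_add_div hpos, Nat.div_eq_of_lt j.2, add_zero]
  have h2 : (i * numVertices d x k + j) % numVertices d x k = j := by
    rw [mul_comm, Nat.mul_add_mod, Nat.mod_eq_of_lt j.2]
  change graphCell d (x, k) (i * numVertices d x k + j) = _
  rw [graphCell]
  simp only [h1, h2]
  congr

/-! ### Definability of the instance graph -/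

section

variable (d : ℕ)

theorem dfn_budget : Dfn (instanceCtx (a := 2)) fun p => budget d p.2 :=
  (((Dfn.var 0).add (.const 2)).pow (Net.numD d)).add (.const 1)

theorem dfn_numElements : Dfn (instanceCtx (a := 2)) fun p => numElements d p.1 p.2 :=
  (dfn_budget d).mul ((wordCtx_instanceCtx.n.add (.const 2)).pow (Net.numD d))

theorem dfn_numSets : Dfn (instanceCtx (a := 2)) fun p => numSets d p.1 p.2 :=
  ((wordCtx_instanceCtx.base (Dfn.var 0) d).pow 6).add (.const 1)

theorem dfn_numVertices : Dfn (instanceCtx (a := 2)) fun p => numVertices d p.1 p.2 :=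
  ((Dfn.const 3).mul (dfn_numElements d)).add
    (((dfn_budget d).add (.const 3)).mul (dfn_numSets d))

theorem dfnP_covers_instance {a e : (List (Fin 2) × ℕ) × ℕ → ℕ}
    (ha : Dfn (extend (instanceCtx (a := 2))) a) (he : Dfn (extend (instanceCtx (a := 2))) e) :
    DfnP (extend (instanceCtx (a := 2))) fun p => Covers d p.1.1 p.1.2 (a p) (e p) := by
  have hx : WordCtx (extend (instanceCtx (a := 2))) fun p => p.1.1 := wordCtx_instanceCtx.extend
  have hk : Dfn (extend (instanceCtx (a := 2))) fun p => p.1.2 := Dfn.var 1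
  exact dfnP_covers (x := fun p : (List (Fin 2) × ℕ) × ℕ => p.1.1) hx hk d ha he

theorem dfn_graphCell :
    Dfn (extend (instanceCtx (a := 2))) fun p => (graphCell d p.1 p.2 : ℕ) := by
  classical
  have hE : Dfn (extend (instanceCtx (a := 2))) fun p => numElements d p.1.1 p.1.2 :=
    (dfn_numElements d).wk
  have hS : Dfn (extend (instanceCtx (a := 2))) fun p => numSets d p.1.1 p.1.2 :=
    (dfn_numSets d).wk
  have hN : Dfn (extend (instanceCtx (a := 2))) fun p => numVertices d p.1.1 p.1.2 :=
    (dfn_numVertices d).wk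
  have hadj := dfnP_indexAdj (R := fun p : (List (Fin 2) × ℕ) × ℕ => Covers d p.1.1 p.1.2) hE hS
    (Dfn.last.div hN) (Dfn.last.mod hN) (dfnP_covers_instance d)
  refine hadj.toNat.congr fun p => ?_
  rw [graphCell]
  split_ifs <;> rfl

end

/-- Membership in `W[2]` fixes a depth `d`, and all exponents in the construction depend on `d`
only. -/
theorem wHard_EDProblem (star : Variant) : WHard 2 (EDProblem star nearLeafSentence) := by
  rintro A ⟨d, hA⟩
  have hiff : ∀ (x : List (Fin 2)) k, (x, k) ∈ (WCS 2 d).L ↔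
      ((List.range (numVertices d x k * numVertices d x k)).map (graphCell d (x, k)),
        budget d k) ∈ (EDProblem star nearLeafSentence).L := by
    intro x k
    rw [graphCell_eq_encodeGraph]
    refine (mem_WCS_iff_exists_hitting d x k).trans
      (Iff.trans ?_ (encodeGraph_mem_EDProblem _ star nearLeafSentence _).symm)
    exact (indexGraph_ed_le_iff (ρ := numSets d x k) (R := Covers d x k) (Nat.succ_pos _)
      (fun e _ => ⟨(wordNet x).base d k ^ 6, Nat.lt_succ_self _, Or.inl rfl⟩) _ star).symm
  have hle : ∀ k, budget d k ≤ (k + 2) ^ (Net.numD d + 1) := by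
    intro k
    rw [budget, pow_succ]
    have : 1 ≤ (k + 2) ^ Net.numD d := Nat.one_le_pow _ _ (by omega)
    nlinarith
  exact hA.trans_dfn (C := EDProblem star nearLeafSentence)
    (T := fun p => numVertices d p.1 p.2 * numVertices d p.1 p.2) (K := fun p => budget d p.2)
    (cell := graphCell d) ((dfn_numVertices d).mul (dfn_numVertices d)) (dfn_budget d)
    (dfn_graphCell d) (fun _ k => hle k) hiff

end ElimDist

theorem theorem2 (star : ElimDist.Variant) :
    ∃ φ : FirstOrder.Language.graph.Sentence,
      ElimDist.IsPi 3 φ ∧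
      (∀ (V : Type) [Finite V] (G : SimpleGraph V),
        ElimDist.Models G φ ↔ ∀ u, ∃ v, G.edist u v ≤ 2 ∧ (G.neighborSet v).ncard ≤ 1) ∧
      ElimDist.WHard 2 (ElimDist.EDProblem star φ) :=
  ⟨ElimDist.nearLeafSentence, ElimDist.isPi_nearLeafSentence,
    fun _ _ G => ElimDist.models_nearLeafSentence_iff G, ElimDist.wHard_EDProblem star⟩
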